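/- Let $\ell>0$, $I=(-\ell/2,\ell/2)$ and $S=I\times(-\tfrac12,\tfrac12)$. Let $c_1,c_2>0$, $\bar e\ge 0$, $\bar A\in\mathbb R^{2\times2}_{\rm sym}$, $\theta\in[0,\pi)$, and put $$c=c_1+c_2,\qquad R_\theta=\begin{pmatrix}\cos\theta&-\sin\theta\\ \sin\theta&\cos\theta\end{pmatrix},\qquad \bar A^\theta=R_\theta^{\rm T}\bar A R_\theta,$$ $$L^\theta(A)=-2c_1A\cdot\bar A^\theta-2c_2\,{\rm tr}A\,{\rm tr}\bar A^\theta+c_1|\bar A^\theta|^2+c_2\,{\rm tr}^2\bar A^\theta+\bar e ,$$ where $A\cdot B=\sum_{i,j}A_{ij}B_{ij}$ and $|A|^2=A\cdot A$. For $\varepsilon>0$ let $\nabla_\varepsilon y=(\partial_1y\,|\,\varepsilon^{-1}\partial_2y)$, and let $W^{2,2}_{{\rm iso},\varepsilon}(S,\mathbb R^3)$ be the set of $y\in W^{2,2}(S,\mathbb R^3)$ with $|\partial_1y|=|\varepsilon^{-1}\partial_2y|=1$ and $\partial_1y\cdot\partial_2y=0$ a.e. in $S$. For such $y$ let $n_{y,\varepsilon}=\partial_1y\wedge\varepsilon^{-1}\partial_2y$,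 $$A_{y,\varepsilon}=\begin{pmatrix}n_{y,\varepsilon}\cdot\partial_1\partial_1y&\varepsilon^{-1}n_{y,\varepsilon}\cdot\partial_1\partial_2y\\ \varepsilon^{-1}n_{y,\varepsilon}\cdot\partial_1\partial_2y&\varepsilon^{-2}n_{y,\varepsilon}\cdot\partial_2\partial_2y\end{pmatrix},\qquad \mathscr J^\theta_\varepsilon(y)=\int_S\big\{c|A_{y,\varepsilon}|^2+L^\theta(A_{y,\varepsilon})\big\}\,dx .$$ Let $\varepsilon_n>0$ with $\varepsilon_n\to0$, and let $y_n\in W^{2,2}_{{\rm iso},\varepsilon_n}(S,\mathbb R^3)$ satisfy $\sup_n\mathscr J^\theta_{\varepsilon_n}(y_n)<\infty$. Then there exist a subsequence (not relabelled), constants $a_n\in\mathbb R^3$, a deformation $y\in W^{2,2}(I,\mathbb R^3)$ and an orthonormal frame $(d_1|d_2|d_3)\in W^{1,2}(I,SO(3))$ such that $$d_1=y'\quad\text{and}\quad d_1'\cdot d_2=0\qquad\text{a.e. in }I,$$ and, functions on $I$ being regarded as functions on $S$ that do not depend on $x_2$, $$y_n-a_n\rightharpoonup y\ \text{ in }W^{2,2}(S,\mathbb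 R^3),\qquad \nabla_{\varepsilon_n}y_n\rightharpoonup(d_1|d_2)\ \text{ in }W^{1,2}(S,\mathbb R^{3\times2}).$$ Moreover, along the same subsequence, for some scalar function $\gamma\in L^2(S)$, $$A_{y_n,\varepsilon_n}\rightharpoonup\begin{pmatrix}d_1'\cdot d_3&d_2'\cdot d_3\\ d_2'\cdot d_3&\gamma\end{pmatrix}\quad\text{in }L^2(S,\mathbb R^{2\times2}_{\rm sym}).$$ -/

import Mathlib

open MeasureTheory Filter Topology Set
open scoped ContDiff Matrix

noncomputable section

namespace Ribbon

/-! ### Sobolev spaces `W^{k,2}` through weak derivatives -/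

section Sobolev

variable {E F : Type*} [NormedAddCommGroup E] [NormedSpace ℝ E] [MeasureSpace E]
  [NormedAddCommGroup F] [InnerProductSpace ℝ F]

/-- `g` is a weak derivative of `f` in the direction `v` on the open set `Ω`:
`∫_Ω (∂_v φ) f = - ∫_Ω φ g` for all test functions `φ ∈ C_c^∞(Ω)`. -/
def HasWeakDeriv (Ω : Set E) (v : E) (f g : E → F) : Prop :=
  LocallyIntegrableOn f Ω ∧ LocallyIntegrableOn g Ω ∧
    ∀ φ : E → ℝ, ContDiff ℝ ∞ φ → HasCompactSupport φ → tsupport φ ⊆ Ω →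
      ∫ x in Ω, (fderiv ℝ φ x v) • f x = -∫ x in Ω, φ x • g x

open Classical in
/-- The weak derivative of `f` in the direction `v` on `Ω` (a representative of it; it is unique
up to null sets). It is only used where a weak derivative exists. -/
def weakDeriv (Ω : Set E) (v : E) (f : E → F) : E → F :=
  if h : ∃ g, HasWeakDeriv Ω v f g then h.choose else 0

/-- `f ∈ W^{k,2}(Ω, F)`: `f` and its weak derivatives up to order `k` (in all directions, which
is the same as all iterated partial derivatives) are in `L²(Ω, F)`. -/
def MemSobolev (Ω : Set E) : ℕ → (E → F) → Prop
  | 0, f => MemLp f 2 (volume.restrict Ω)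
  | k + 1, f => MemLp f 2 (volume.restrict Ω) ∧
      ∀ v : E, ∃ g : E → F, HasWeakDeriv Ω v f g ∧ MemSobolev Ω k g

/-- Weak convergence `f n ⇀ f₀` in `L²(Ω, F)`. -/
def TendstoWeakL2 (Ω : Set E) (f : ℕ → E → F) (f₀ : E → F) : Prop :=
  (∀ n, MemLp (f n) 2 (volume.restrict Ω)) ∧ MemLp f₀ 2 (volume.restrict Ω) ∧
    ∀ g : E → F, MemLp g 2 (volume.restrict Ω) →
      Tendsto (fun n => ∫ x in Ω, inner ℝ (f n x) (g x)) atTop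
        (𝓝 (∫ x in Ω, inner ℝ (f₀ x) (g x)))

/-- Weak convergence `f n ⇀ f₀` in `W^{k,2}(Ω, F)`: all functions are in `W^{k,2}(Ω, F)`, and all
weak derivatives of order at most `k` converge weakly in `L²(Ω, F)`. -/
def TendstoWeakSobolev (Ω : Set E) : ℕ → (ℕ → E → F) → (E → F) → Prop
  | 0, f, f₀ => TendstoWeakL2 Ω f f₀
  | k + 1, f, f₀ =>
      (∀ n, MemSobolev Ω (k + 1) (f n)) ∧ MemSobolev Ω (k + 1) f₀ ∧ TendstoWeakL2 Ω f f₀ ∧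
        ∀ v : E, TendstoWeakSobolev Ω k (fun n => weakDeriv Ω v (f n)) (weakDeriv Ω v f₀)

end Sobolev

/-! ### Scaled isometries and the energy -/

/-- Euclidean space `ℝ³`. -/
abbrev R3 : Type := EuclideanSpace ℝ (Fin 3)

/-- The interval `I = (-ℓ/2, ℓ/2)`. -/
def interval (ℓ : ℝ) : Set ℝ := Ioo (-ℓ / 2) (ℓ / 2)

/-- The rescaled strip `S = I × (-1/2, 1/2)`. -/
def strip (ℓ : ℝ) : Set (ℝ × ℝ) := interval ℓ ×ˢ Ioo (-1 / 2 : ℝ) (1 / 2)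

/-- The weak partial derivative `∂₁` on `S`. -/
def pd1 (ℓ : ℝ) (y : ℝ × ℝ → R3) : ℝ × ℝ → R3 := weakDeriv (strip ℓ) (1, 0) y

/-- The weak partial derivative `∂₂` on `S`. -/
def pd2 (ℓ : ℝ) (y : ℝ × ℝ → R3) : ℝ × ℝ → R3 := weakDeriv (strip ℓ) (0, 1) y

/-- The two columns of the scaled gradient `∇_ε y = (∂₁ y | ε⁻¹ ∂₂ y)`. -/
def scaledGrad (ℓ ε : ℝ) (y : ℝ × ℝ → R3) : Fin 2 → ℝ × ℝ → R3 :=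
  ![pd1 ℓ y, fun x => ε⁻¹ • pd2 ℓ y x]

/-- The space `W^{2,2}_{iso,ε}(S, ℝ³)` of scaled isometries. -/
def IsScaledIsometry (ℓ ε : ℝ) (y : ℝ × ℝ → R3) : Prop :=
  MemSobolev (strip ℓ) 2 y ∧
    ∀ᵐ x ∂(volume.restrict (strip ℓ)),
      ‖pd1 ℓ y x‖ = 1 ∧ ‖ε⁻¹ • pd2 ℓ y x‖ = 1 ∧ inner ℝ (pd1 ℓ y x) (pd2 ℓ y x) = 0

/-- The cross product on `ℝ³`. -/
def cross (a b : R3) : R3 := WithLp.toLp 2 (crossProduct a.ofLp b.ofLp)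

/-- The scaled unit normal `n_{y,ε} = ∂₁ y ∧ ε⁻¹ ∂₂ y`. -/
def scaledNormal (ℓ ε : ℝ) (y : ℝ × ℝ → R3) (x : ℝ × ℝ) : R3 :=
  cross (pd1 ℓ y x) (ε⁻¹ • pd2 ℓ y x)

/-- The scaled second fundamental form `A_{y,ε}`. -/
def secondForm (ℓ ε : ℝ) (y : ℝ × ℝ → R3) (x : ℝ × ℝ) : Matrix (Fin 2) (Fin 2) ℝ :=
  !![inner ℝ (scaledNormal ℓ ε y x) (pd1 ℓ (pd1 ℓ y) x),
      ε⁻¹ * inner ℝ (scaledNormal ℓ ε y x) (pd1 ℓ (pd2 ℓ y) x);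
    ε⁻¹ * inner ℝ (scaledNormal ℓ ε y x) (pd1 ℓ (pd2 ℓ y) x),
      (ε ^ 2)⁻¹ * inner ℝ (scaledNormal ℓ ε y x) (pd2 ℓ (pd2 ℓ y) x)]

/-- The Euclidean (Frobenius) scalar product `A · B` of matrices; `|A|² = A · A`. -/
def frob (A B : Matrix (Fin 2) (Fin 2) ℝ) : ℝ := ∑ i, ∑ j, A i j * B i j

/-- The rotation `R_θ`. -/
def rot (θ : ℝ) : Matrix (Fin 2) (Fin 2) ℝ :=
  !![Real.cos θ, -Real.sin θ; Real.sin θ, Real.cos θ]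

/-- The rotated target curvature `Ā^θ = R_θᵀ Ā R_θ`. -/
def rotTarget (Abar : Matrix (Fin 2) (Fin 2) ℝ) (θ : ℝ) : Matrix (Fin 2) (Fin 2) ℝ :=
  (rot θ)ᵀ * Abar * rot θ

/-- The affine function `L^θ`. -/
def Ltheta (c₁ c₂ ebar : ℝ) (Abar : Matrix (Fin 2) (Fin 2) ℝ) (θ : ℝ)
    (A : Matrix (Fin 2) (Fin 2) ℝ) : ℝ :=
  -2 * c₁ * frob A (rotTarget Abar θ) - 2 * c₂ * A.trace * (rotTarget Abar θ).trace
    + c₁ * frob (rotTarget Abar θ) (rotTarget Abar θ) + c₂ * (rotTarget Abar θ).trace ^ 2 + ebar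

/-- The energy `𝒥_ε^θ(y) = ∫_S { c |A_{y,ε}|² + L^θ(A_{y,ε}) } dx` with `c = c₁ + c₂`. -/
def energy (ℓ c₁ c₂ ebar : ℝ) (Abar : Matrix (Fin 2) (Fin 2) ℝ) (θ ε : ℝ)
    (y : ℝ × ℝ → R3) : ℝ :=
  ∫ x in strip ℓ, ((c₁ + c₂) * frob (secondForm ℓ ε y x) (secondForm ℓ ε y x)
    + Ltheta c₁ c₂ ebar Abar θ (secondForm ℓ ε y x))

/-- `(d₁|d₂|d₃) ∈ W^{1,2}(I, SO(3))`, where `d₁, d₂, d₃` are the columns `d 0, d 1, d 2`. -/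
def IsSobolevFrame (ℓ : ℝ) (d : Fin 3 → ℝ → R3) : Prop :=
  (∀ i, MemSobolev (interval ℓ) 1 (d i)) ∧
    ∀ᵐ t ∂(volume.restrict (interval ℓ)),
      (Matrix.of fun i j => d j t i) ∈ Matrix.specialOrthogonalGroup (Fin 3) ℝ

/-- The limit matrix field with entries `d₁'·d₃`, `d₂'·d₃` and `γ`. -/
def limitForm (ℓ : ℝ) (d : Fin 3 → ℝ → R3) (γ : ℝ × ℝ → ℝ) (x : ℝ × ℝ) :
    Matrix (Fin 2) (Fin 2) ℝ :=
  !![inner ℝ (weakDeriv (interval ℓ) 1 (d 0) x.1) (d 2 x.1),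
      inner ℝ (weakDeriv (interval ℓ) 1 (d 1) x.1) (d 2 x.1);
    inner ℝ (weakDeriv (interval ℓ) 1 (d 1) x.1) (d 2 x.1), γ x]

end Ribbon

end

noncomputable section

set_option linter.unusedSectionVars false

/-! Completing squares absorbs the affine part of the energy into its quadratic part, so an energy
bound bounds every entry of `secondForm` in `L²` (`exists_bound_of_energy`). The isometry
constraints turn this into bounds on second derivatives. Differentiating `|∂₁y| = 1`, `|∂₂y| = ε`
and `∂₁y · ∂₂y = 0` shows that all second derivatives are normal to the surface, hence `|∂₁∂₁y| =
|A₁₁|`, `|∂₁∂₂y| = ε |A₁₂|` and `|∂₂∂₂y| = ε² |A₂₂|` (`IsScaledIsometry.ae_structure`). The fields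
`∂₁y` and `ε⁻¹∂₂y` thus have longitudinal derivatives bounded in `L²` and transversal derivatives of
order `ε`.

Such fields are strongly compact in `L²` on the strip, with limits depending on `x₁` only
(`exists_subseq_tendstoL2_strip`). Two integral formulas replace Rellich's theorem. By a Poincaré
inequality on the fibres, a field is close to its weighted fibre average. That average is, up to a
constant, an integral of the longitudinal derivative against a bounded kernel, so weak convergence
of the derivatives gives pointwise convergence of the averages. For `y` itself the constants remain
and become the `a n`; for the unit fields they are bounded and converge along a subsequence.

Almost everywhere convergence of `∂₁y` and `ε⁻¹∂₂y` makes the limits `d₁, d₂` orthonormal and makes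
the normals converge to `d₁ ∧ d₂`. A bounded, almost everywhere convergent factor may be paired with
a weakly convergent one (`TendstoWeakL2.inner_of_ae_tendsto`); this identifies the limits of the
entries of `A` in the first row and first column. It also passes the identity `ε⁻¹∂₂y · ∂₁∂₁y = 0`
to the limit, which is `d₁' · d₂ = 0`. The entry `A₂₂` is only bounded, and its weak limit is the
unidentified `γ`. -/

namespace Ribbon

/-! ### Strong and weak convergence in `L²` -/

section L2

variable {α F : Type*} [MeasurableSpace α] {μ : Measure α} [NormedAddCommGroup F]
  [InnerProductSpace ℝ F]

theorem inner_toLp {f g : α → F} (hf : MemLp f 2 μ) (hg : MemLp g 2 μ) :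
    inner ℝ (hf.toLp f) (hg.toLp g) = ∫ x, inner ℝ (f x) (g x) ∂μ := by
  rw [L2.inner_def]
  refine integral_congr_ae ?_
  filter_upwards [hf.coeFn_toLp, hg.coeFn_toLp] with x h1 h2
  rw [h1, h2]

theorem norm_toLp_sq {f : α → F} (hf : MemLp f 2 μ) :
    ‖hf.toLp f‖ ^ 2 = ∫ x, ‖f x‖ ^ 2 ∂μ := by
  rw [← real_inner_self_eq_norm_sq, inner_toLp hf hf]
  simp

theorem memLp_integrable_inner {f g : α → F} (hf : MemLp f 2 μ) (hg : MemLp g 2 μ) :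
    Integrable (fun x => inner ℝ (f x) (g x)) μ := by
  refine (L2.integrable_inner (𝕜 := ℝ) (hf.toLp f) (hg.toLp g)).congr ?_
  filter_upwards [hf.coeFn_toLp, hg.coeFn_toLp] with x h1 h2
  rw [h1, h2]

theorem memLp_integrable_norm_sq {f : α → F} (hf : MemLp f 2 μ) :
    Integrable (fun x => ‖f x‖ ^ 2) μ := by
  simpa using memLp_integrable_inner hf hf

theorem abs_integral_inner_le {f g : α → F} (hf : MemLp f 2 μ) (hg : MemLp g 2 μ) :
    |∫ x, inner ℝ (f x) (g x) ∂μ| ≤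
      Real.sqrt (∫ x, ‖f x‖ ^ 2 ∂μ) * Real.sqrt (∫ x, ‖g x‖ ^ 2 ∂μ) := by
  rw [← inner_toLp hf hg, ← norm_toLp_sq hf, ← norm_toLp_sq hg, Real.sqrt_sq (norm_nonneg _),
    Real.sqrt_sq (norm_nonneg _)]
  exact abs_real_inner_le_norm _ _

/-- Strong convergence `f n → f₀` in `L²(μ)`. -/
def TendstoL2 (μ : Measure α) (f : ℕ → α → F) (f₀ : α → F) : Prop :=
  (∀ n, MemLp (f n) 2 μ) ∧ MemLp f₀ 2 μ ∧
    Tendsto (fun n => ∫ x, ‖f n x - f₀ x‖ ^ 2 ∂μ) atTop (𝓝 0)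

theorem TendstoL2.comp {f : ℕ → α → F} {f₀ : α → F} (h : TendstoL2 μ f f₀) {σ : ℕ → ℕ}
    (hσ : StrictMono σ) : TendstoL2 μ (fun n => f (σ n)) f₀ :=
  ⟨fun _ => h.1 _, h.2.1, h.2.2.comp hσ.tendsto_atTop⟩

theorem norm_sq_add_le (a b : F) : ‖a + b‖ ^ 2 ≤ 2 * ‖a‖ ^ 2 + 2 * ‖b‖ ^ 2 := by
  have := norm_add_le a b
  nlinarith [norm_nonneg (a + b), norm_nonneg a, norm_nonneg b, sq_nonneg (‖a‖ - ‖b‖)]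

theorem TendstoL2.add {f g : ℕ → α → F} {f₀ g₀ : α → F} (hf : TendstoL2 μ f f₀)
    (hg : TendstoL2 μ g g₀) : TendstoL2 μ (fun n x => f n x + g n x) (fun x => f₀ x + g₀ x) := by
  refine ⟨fun n => (hf.1 n).add (hg.1 n), hf.2.1.add hg.2.1, ?_⟩
  have h := (hf.2.2.const_mul 2).add (hg.2.2.const_mul 2)
  simp only [mul_zero, add_zero] at h
  refine squeeze_zero (fun n => integral_nonneg fun x => by positivity) (fun n => ?_) h
  have i1 : Integrable (fun x => ‖f n x - f₀ x‖ ^ 2) μ :=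
    memLp_integrable_norm_sq ((hf.1 n).sub hf.2.1)
  have i2 : Integrable (fun x => ‖g n x - g₀ x‖ ^ 2) μ :=
    memLp_integrable_norm_sq ((hg.1 n).sub hg.2.1)
  have i3 := memLp_integrable_norm_sq (((hf.1 n).add (hg.1 n)).sub (hf.2.1.add hg.2.1))
  rw [← integral_const_mul, ← integral_const_mul, ← integral_add (i1.const_mul 2) (i2.const_mul 2)]
  refine integral_mono i3 ((i1.const_mul 2).add (i2.const_mul 2)) fun x => ?_
  have : f n x + g n x - (f₀ x + g₀ x) = (f n x - f₀ x) + (g n x - g₀ x) := by abel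
  simp only [this]
  exact norm_sq_add_le _ _

theorem TendstoL2.congr {f g : ℕ → α → F} {f₀ g₀ : α → F} (hf : TendstoL2 μ f f₀)
    (h : ∀ n, f n =ᵐ[μ] g n) (h₀ : f₀ =ᵐ[μ] g₀) : TendstoL2 μ g g₀ := by
  refine ⟨fun n => (hf.1 n).ae_eq (h n), hf.2.1.ae_eq h₀, hf.2.2.congr fun n => ?_⟩
  refine integral_congr_ae ?_
  filter_upwards [h n, h₀] with x h1 h2
  rw [h1, h2]

theorem TendstoL2.ae_subseq {f : ℕ → α → F} {f₀ : α → F} (hf : TendstoL2 μ f f₀) :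
    ∃ σ : ℕ → ℕ, StrictMono σ ∧ ∀ᵐ x ∂μ, Tendsto (fun n => f (σ n) x) atTop (𝓝 (f₀ x)) := by
  have h : Tendsto (fun n => ((hf.1 n).sub hf.2.1).toLp (f n - f₀)) atTop (𝓝 0) := by
    rw [tendsto_zero_iff_norm_tendsto_zero]
    have h2 : Tendsto (fun n => Real.sqrt (∫ x, ‖f n x - f₀ x‖ ^ 2 ∂μ)) atTop (𝓝 0) := by
      simpa [Function.comp_def] using (Real.continuous_sqrt.tendsto 0).comp hf.2.2
    refine h2.congr fun n => ?_
    have := norm_toLp_sq ((hf.1 n).sub hf.2.1)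
    simp only [Pi.sub_apply] at this
    rw [← this, Real.sqrt_sq (norm_nonneg _)]
  obtain ⟨σ, hσ, h3⟩ := (tendstoInMeasure_of_tendsto_Lp h).exists_seq_tendsto_ae
  refine ⟨σ, hσ, ?_⟩
  have h4 := ae_all_iff.2 fun n => ((hf.1 n).sub hf.2.1).coeFn_toLp
  filter_upwards [h3, h4, Lp.coeFn_zero F 2 μ] with x h5 h6 h7
  rw [h7] at h5
  simp only [h6, Pi.sub_apply, Pi.zero_apply] at h5
  simpa using h5.add_const (f₀ x)

theorem tendstoL2_of_dominated {f : ℕ → α → F} {f₀ : α → F} {b : α → ℝ}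
    (hf : ∀ n, AEStronglyMeasurable (f n) μ) (hb : MemLp b 2 μ)
    (hfb : ∀ n, ∀ᵐ x ∂μ, ‖f n x‖ ≤ b x)
    (h : ∀ᵐ x ∂μ, Tendsto (fun n => f n x) atTop (𝓝 (f₀ x))) : TendstoL2 μ f f₀ := by
  have hf₀ : AEStronglyMeasurable f₀ μ := aestronglyMeasurable_of_tendsto_ae _ hf h
  have hfb₀ : ∀ᵐ x ∂μ, ‖f₀ x‖ ≤ b x := by
    filter_upwards [h, ae_all_iff.2 hfb] with x h1 h2
    exact le_of_tendsto h1.norm (Eventually.of_forall h2)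
  have m : ∀ n, MemLp (f n) 2 μ := fun n => hb.of_le (hf n) <| by
    filter_upwards [hfb n] with x hx using hx.trans (le_abs_self _)
  have m₀ : MemLp f₀ 2 μ := hb.of_le hf₀ <| by
    filter_upwards [hfb₀] with x hx using hx.trans (le_abs_self _)
  refine ⟨m, m₀, ?_⟩
  have key : Tendsto (fun n => ∫ x, ‖f n x - f₀ x‖ ^ 2 ∂μ) atTop (𝓝 (∫ _, (0 : ℝ) ∂μ)) := by
    refine tendsto_integral_of_dominated_convergence (fun x => 4 * ‖b x‖ ^ 2) (fun n => ?_)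
      ((memLp_integrable_norm_sq hb).const_mul 4) (fun n => ?_) ?_
    · exact (((hf n).sub hf₀).norm).pow 2
    · filter_upwards [hfb n, hfb₀] with x h1 h2
      have : ‖f n x - f₀ x‖ ≤ 2 * ‖b x‖ :=
        (norm_sub_le _ _).trans (by linarith [le_abs_self (b x), Real.norm_eq_abs (b x)])
      rw [Real.norm_of_nonneg (by positivity)]
      nlinarith [norm_nonneg (f n x - f₀ x)]
    · filter_upwards [h] with x hx
      simpa using ((hx.sub_const (f₀ x)).norm).pow 2
  simpa using key

end L2

section WeakL2

variable {E F : Type*} [NormedAddCommGroup E] [NormedSpace ℝ E] [MeasureSpace E]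
  [NormedAddCommGroup F] [InnerProductSpace ℝ F] {Ω : Set E}

theorem TendstoWeakL2.comp {f : ℕ → E → F} {f₀ : E → F} (h : TendstoWeakL2 Ω f f₀) {σ : ℕ → ℕ}
    (hσ : StrictMono σ) : TendstoWeakL2 Ω (fun n => f (σ n)) f₀ :=
  ⟨fun _ => h.1 _, h.2.1, fun g hg => (h.2.2 g hg).comp hσ.tendsto_atTop⟩

theorem TendstoWeakL2.congr {f g : ℕ → E → F} {f₀ g₀ : E → F} (hf : TendstoWeakL2 Ω f f₀)
    (h : ∀ n, f n =ᵐ[volume.restrict Ω] g n) (h₀ : f₀ =ᵐ[volume.restrict Ω] g₀) :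
    TendstoWeakL2 Ω g g₀ := by
  refine ⟨fun n => (hf.1 n).ae_eq (h n), hf.2.1.ae_eq h₀, fun k hk => ?_⟩
  have e₀ : ∫ x in Ω, inner ℝ (g₀ x) (k x) = ∫ x in Ω, inner ℝ (f₀ x) (k x) :=
    integral_congr_ae (by filter_upwards [h₀] with x hx; rw [hx])
  rw [e₀]
  refine (hf.2.2 k hk).congr fun n => integral_congr_ae ?_
  filter_upwards [h n] with x hx
  rw [hx]

theorem TendstoWeakL2.add {f g : ℕ → E → F} {f₀ g₀ : E → F} (hf : TendstoWeakL2 Ω f f₀)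
    (hg : TendstoWeakL2 Ω g g₀) :
    TendstoWeakL2 Ω (fun n x => f n x + g n x) (fun x => f₀ x + g₀ x) := by
  refine ⟨fun n => (hf.1 n).add (hg.1 n), hf.2.1.add hg.2.1, fun k hk => ?_⟩
  simp only [inner_add_left]
  rw [integral_add (memLp_integrable_inner hf.2.1 hk) (memLp_integrable_inner hg.2.1 hk)]
  refine ((hf.2.2 k hk).add (hg.2.2 k hk)).congr fun n => ?_
  rw [integral_add (memLp_integrable_inner (hf.1 n) hk) (memLp_integrable_inner (hg.1 n) hk)]

theorem TendstoWeakL2.const_smul {f : ℕ → E → F} {f₀ : E → F} (hf : TendstoWeakL2 Ω f f₀) (c : ℝ) :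
    TendstoWeakL2 Ω (fun n x => c • f n x) (fun x => c • f₀ x) := by
  refine ⟨fun n => (hf.1 n).const_smul c, hf.2.1.const_smul c, fun k hk => ?_⟩
  simp only [real_inner_smul_left, integral_const_mul]
  exact (hf.2.2 k hk).const_mul c

theorem TendstoL2.weak {f : ℕ → E → F} {f₀ : E → F} (hf : TendstoL2 (volume.restrict Ω) f f₀) :
    TendstoWeakL2 Ω f f₀ := by
  refine ⟨hf.1, hf.2.1, fun k hk => ?_⟩
  rw [tendsto_iff_dist_tendsto_zero]
  have h : Tendsto (fun n => Real.sqrt (∫ x in Ω, ‖f n x - f₀ x‖ ^ 2) *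
      Real.sqrt (∫ x in Ω, ‖k x‖ ^ 2)) atTop (𝓝 0) := by
    simpa using ((Real.continuous_sqrt.tendsto 0).comp hf.2.2).mul_const _
  refine squeeze_zero (fun n => dist_nonneg) (fun n => ?_) h
  rw [Real.dist_eq, ← integral_sub (memLp_integrable_inner (hf.1 n) hk)
    (memLp_integrable_inner hf.2.1 hk)]
  simp only [← inner_sub_left]
  exact abs_integral_inner_le ((hf.1 n).sub hf.2.1) hk

theorem TendstoWeakL2.ae_unique [CompleteSpace F] {f : ℕ → E → F} {f₀ f₁ : E → F}
    (h₀ : TendstoWeakL2 Ω f f₀) (h₁ : TendstoWeakL2 Ω f f₁) : f₀ =ᵐ[volume.restrict Ω] f₁ := by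
  have m := h₀.2.1.sub h₁.2.1
  have e := tendsto_nhds_unique (h₀.2.2 _ m) (h₁.2.2 _ m)
  rw [← sub_eq_zero, ← integral_sub (memLp_integrable_inner h₀.2.1 m)
    (memLp_integrable_inner h₁.2.1 m)] at e
  simp only [← inner_sub_left, Pi.sub_apply, real_inner_self_eq_norm_sq] at e
  change ∫ x in Ω, ‖(f₀ - f₁) x‖ ^ 2 = 0 at e
  rw [integral_eq_zero_iff_of_nonneg (fun x => by positivity) (memLp_integrable_norm_sq m)] at e
  filter_upwards [e] with x hx
  simpa [sub_eq_zero] using hx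

/-- Inner products of weakly and strongly convergent sequences converge in the mean. -/
theorem TendstoWeakL2.tendsto_integral_inner {f : ℕ → E → F} {f₀ : E → F} (hf : TendstoWeakL2 Ω f f₀)
    {C : ℝ} (hC : ∀ n, ∫ x in Ω, ‖f n x‖ ^ 2 ≤ C) {g : ℕ → E → F} {g₀ : E → F}
    (hg : TendstoL2 (volume.restrict Ω) g g₀) :
    Tendsto (fun n => ∫ x in Ω, inner ℝ (f n x) (g n x)) atTop
      (𝓝 (∫ x in Ω, inner ℝ (f₀ x) (g₀ x))) := by
  have h1 := hf.2.2 g₀ hg.2.1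
  have h2 : Tendsto (fun n => ∫ x in Ω, inner ℝ (f n x) (g n x - g₀ x)) atTop (𝓝 0) := by
    have h : Tendsto (fun n => Real.sqrt C * Real.sqrt (∫ x in Ω, ‖g n x - g₀ x‖ ^ 2))
        atTop (𝓝 0) := by
      simpa [Function.comp_def] using
        ((Real.continuous_sqrt.tendsto 0).comp hg.2.2).const_mul (Real.sqrt C)
    refine squeeze_zero_norm (fun n => ?_) h
    refine (abs_integral_inner_le (hf.1 n) ((hg.1 n).sub hg.2.1)).trans ?_
    exact mul_le_mul_of_nonneg_right (Real.sqrt_le_sqrt (hC n)) (Real.sqrt_nonneg _)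
  have h3 := h1.add h2
  rw [add_zero] at h3
  refine h3.congr fun n => ?_
  have i2 : Integrable (fun x => inner ℝ (f n x) (g n x - g₀ x)) (volume.restrict Ω) :=
    memLp_integrable_inner (hf.1 n) ((hg.1 n).sub hg.2.1)
  rw [← integral_add (memLp_integrable_inner (hf.1 n) hg.2.1) i2]
  refine integral_congr_ae (ae_of_all _ fun x => ?_)
  simp [← inner_add_right]

/-- Sequential Banach–Alaoglu in the dual of the separable Hilbert space `L²`, transported by the
Riesz isomorphism. -/
theorem exists_subseq_tendstoWeakL2 [BorelSpace E] [SecondCountableTopology E]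
    [SFinite (volume : Measure E)] [SecondCountableTopology F] [CompleteSpace F]
    {f : ℕ → E → F} (hf : ∀ n, MemLp (f n) 2 (volume.restrict Ω)) {C : ℝ}
    (hC : ∀ n, ∫ x in Ω, ‖f n x‖ ^ 2 ≤ C) :
    ∃ (σ : ℕ → ℕ) (f₀ : E → F), StrictMono σ ∧ TendstoWeakL2 Ω (fun n => f (σ n)) f₀ := by
  -- The exponent is finite, so `L²` is separable; the sequential form of weak-* compactness needs
  -- this.
  have : Fact ((2 : ENNReal) ≠ ⊤) := ⟨by simp⟩
  let H := Lp F 2 (volume.restrict Ω)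
  let u : ℕ → H := fun n => (hf n).toLp (f n)
  have hu : ∀ n, ‖u n‖ ≤ Real.sqrt C := fun n => by
    rw [← Real.sqrt_sq (norm_nonneg (u n)), norm_toLp_sq (hf n)]
    exact Real.sqrt_le_sqrt (hC n)
  let T : ℕ → WeakDual ℝ H := fun n =>
    StrongDual.toWeakDual (InnerProductSpace.toDual ℝ H (u n))
  obtain ⟨t, -, σ, hσ, ht⟩ := WeakDual.isSeqCompact_closedBall ℝ H (0 : StrongDual ℝ H)
    (Real.sqrt C) (x := T) (fun n => by
      simp only [T, mem_preimage, Metric.mem_closedBall, dist_zero_right]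
      exact ((InnerProductSpace.toDual ℝ H).norm_map (u n)).trans_le (hu n))
  let f₀ : H := (InnerProductSpace.toDual ℝ H).symm (WeakDual.toStrongDual t)
  refine ⟨σ, f₀, hσ, fun n => hf _, Lp.memLp _, fun g hg => ?_⟩
  have h := ((WeakDual.eval_continuous (hg.toLp g)).tendsto t).comp ht
  have e : t (hg.toLp g) = ∫ x in Ω, inner ℝ (f₀ x) (g x) := by
    have : inner ℝ f₀ (hg.toLp g) = t (hg.toLp g) :=
      InnerProductSpace.toDual_symm_apply
    rw [← this, L2.inner_def]
    refine integral_congr_ae ?_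
    filter_upwards [hg.coeFn_toLp] with x h2
    rw [h2]
  rw [← e]
  refine h.congr fun n => ?_
  rw [← inner_toLp (hf _) hg]
  rfl

end WeakL2

/-! ### Calculus of weak derivatives -/

section WeakDerivative

variable {E F : Type*} [NormedAddCommGroup E] [NormedSpace ℝ E] [MeasureSpace E]
  [NormedAddCommGroup F] [InnerProductSpace ℝ F] {Ω : Set E} {v w : E} {f f' g g' : E → F}

theorem tsupport_fderiv_apply_subset (φ : E → ℝ) (v : E) :
    tsupport (fun x => fderiv ℝ φ x v) ⊆ tsupport φ :=
  closure_minimal (fun x hx => by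
    by_contra h
    exact hx (by simp [fderiv_of_notMem_tsupport (𝕜 := ℝ) h])) isClosed_closure

theorem hasCompactSupport_fderiv_apply {φ : E → ℝ} (hφ : HasCompactSupport φ) (v : E) :
    HasCompactSupport (fun x => fderiv ℝ φ x v) :=
  hφ.of_isClosed_subset isClosed_closure (tsupport_fderiv_apply_subset φ v)

theorem contDiff_fderiv_apply {φ : E → ℝ} (hφ : ContDiff ℝ ∞ φ) (v : E) :
    ContDiff ℝ ∞ (fun x => fderiv ℝ φ x v) :=
  (hφ.fderiv_right (m := ∞) (by simp)).clm_apply contDiff_const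

section Borel

variable [BorelSpace E]

theorem integrable_smul_of_tsupport_subset (hf : LocallyIntegrableOn f Ω) {φ : E → ℝ}
    (hφ : Continuous φ) (hc : HasCompactSupport φ) (hs : tsupport φ ⊆ Ω) :
    Integrable (fun x => φ x • f x) := by
  have h1 : IntegrableOn f (tsupport φ) := hf.integrableOn_compact_subset hs hc
  have h2 : IntegrableOn (fun x => φ x • f x) (tsupport φ) :=
    h1.continuousOn_smul hφ.continuousOn hc
  rwa [integrableOn_iff_integrable_of_support_subset] at h2
  intro x hx
  by_contra h
  exact hx (by simp [image_eq_zero_of_notMem_tsupport h])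

theorem integrableOn_smul_of_tsupport_subset (hf : LocallyIntegrableOn f Ω) {φ : E → ℝ}
    (hφ : Continuous φ) (hc : HasCompactSupport φ) (hs : tsupport φ ⊆ Ω) :
    IntegrableOn (fun x => φ x • f x) Ω :=
  (integrable_smul_of_tsupport_subset hf hφ hc hs).integrableOn

theorem setIntegral_smul_of_tsupport_subset {φ : E → ℝ} (hs : tsupport φ ⊆ Ω) (f : E → F) :
    ∫ x in Ω, φ x • f x = ∫ x, φ x • f x :=
  setIntegral_eq_integral_of_forall_compl_eq_zero fun x hx => by
    rw [image_eq_zero_of_notMem_tsupport fun h => hx (hs h), zero_smul]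

theorem locallyIntegrableOn_of_memLp [IsLocallyFiniteMeasure (volume : Measure E)]
    (hf : MemLp f 2 (volume.restrict Ω)) : LocallyIntegrableOn f Ω :=
  locallyIntegrableOn_of_locallyIntegrable_restrict (hf.locallyIntegrable (by norm_num))

theorem HasWeakDeriv.congr (h : HasWeakDeriv Ω v f g) (hf : f =ᵐ[volume.restrict Ω] f')
    (hg : g =ᵐ[volume.restrict Ω] g') : HasWeakDeriv Ω v f' g' := by
  refine ⟨h.1.congr hf, h.2.1.congr hg, fun φ h1 h2 h3 => ?_⟩
  have e1 : ∫ x in Ω, (fderiv ℝ φ x v) • f' x = ∫ x in Ω, (fderiv ℝ φ x v) • f x :=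
    integral_congr_ae (by filter_upwards [hf] with x hx; rw [hx])
  have e2 : ∫ x in Ω, φ x • g' x = ∫ x in Ω, φ x • g x :=
    integral_congr_ae (by filter_upwards [hg] with x hx; rw [hx])
  rw [e1, e2, h.2.2 φ h1 h2 h3]

theorem HasWeakDeriv.add (h : HasWeakDeriv Ω v f g) (h' : HasWeakDeriv Ω v f' g') :
    HasWeakDeriv Ω v (fun x => f x + f' x) (fun x => g x + g' x) := by
  refine ⟨h.1.add h'.1, h.2.1.add h'.2.1, fun φ h1 h2 h3 => ?_⟩
  have hd := (contDiff_fderiv_apply h1 v).continuous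
  have hdc := hasCompactSupport_fderiv_apply h2 v
  have hds := (tsupport_fderiv_apply_subset φ v).trans h3
  simp only [smul_add]
  rw [integral_add (integrableOn_smul_of_tsupport_subset h.1 hd hdc hds)
      (integrableOn_smul_of_tsupport_subset h'.1 hd hdc hds),
    integral_add (integrableOn_smul_of_tsupport_subset h.2.1 h1.continuous h2 h3)
      (integrableOn_smul_of_tsupport_subset h'.2.1 h1.continuous h2 h3),
    h.2.2 φ h1 h2 h3, h'.2.2 φ h1 h2 h3, neg_add]

theorem HasWeakDeriv.const_smul (h : HasWeakDeriv Ω v f g) (c : ℝ) :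
    HasWeakDeriv Ω v (fun x => c • f x) (fun x => c • g x) := by
  refine ⟨h.1.smul c, h.2.1.smul c, fun φ h1 h2 h3 => ?_⟩
  simp only [smul_comm _ c, integral_smul]
  rw [h.2.2 φ h1 h2 h3, smul_neg]

theorem HasWeakDeriv.add_dir (h : HasWeakDeriv Ω v f g) (h' : HasWeakDeriv Ω w f g') :
    HasWeakDeriv Ω (v + w) f (fun x => g x + g' x) := by
  refine ⟨h.1, h.2.1.add h'.2.1, fun φ h1 h2 h3 => ?_⟩
  simp only [smul_add, map_add, add_smul]
  rw [integral_add (integrableOn_smul_of_tsupport_subset h.1 (contDiff_fderiv_apply h1 v).continuous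
        (hasCompactSupport_fderiv_apply h2 v) ((tsupport_fderiv_apply_subset φ v).trans h3))
      (integrableOn_smul_of_tsupport_subset h'.1 (contDiff_fderiv_apply h1 w).continuous
        (hasCompactSupport_fderiv_apply h2 w) ((tsupport_fderiv_apply_subset φ w).trans h3)),
    integral_add (integrableOn_smul_of_tsupport_subset h.2.1 h1.continuous h2 h3)
      (integrableOn_smul_of_tsupport_subset h'.2.1 h1.continuous h2 h3),
    h.2.2 φ h1 h2 h3, h'.2.2 φ h1 h2 h3, neg_add]

theorem HasWeakDeriv.smul_dir (h : HasWeakDeriv Ω v f g) (c : ℝ) :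
    HasWeakDeriv Ω (c • v) f (fun x => c • g x) := by
  refine ⟨h.1, h.2.1.smul c, fun φ h1 h2 h3 => ?_⟩
  simp only [map_smul, smul_eq_mul, mul_smul, smul_comm _ c, integral_smul]
  rw [h.2.2 φ h1 h2 h3, smul_neg]

theorem hasWeakDeriv_weakDeriv (h : HasWeakDeriv Ω v f g) :
    HasWeakDeriv Ω v f (weakDeriv Ω v f) := by
  have hex : ∃ g, HasWeakDeriv Ω v f g := ⟨g, h⟩
  rw [weakDeriv, dif_pos hex]
  exact hex.choose_spec

theorem HasWeakDeriv.inner_const (h : HasWeakDeriv Ω v f g) [CompleteSpace F] (c : F) :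
    HasWeakDeriv Ω v (fun x => inner ℝ c (f x)) (fun x => inner ℝ c (g x)) := by
  have hl : ∀ k : E → F, LocallyIntegrableOn k Ω →
      LocallyIntegrableOn (fun x => inner ℝ c (k x)) Ω := fun k hk x hx => by
    obtain ⟨s, hs, hi⟩ := hk x hx
    exact ⟨s, hs, Integrable.const_inner c hi⟩
  refine ⟨hl f h.1, hl g h.2.1, fun φ h1 h2 h3 => ?_⟩
  have e : ∀ (ψ : E → ℝ) (k : E → F), IntegrableOn (fun x => ψ x • k x) Ω →
      ∫ x in Ω, ψ x • inner ℝ c (k x) = inner ℝ c (∫ x in Ω, ψ x • k x) := fun ψ k hk => by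
    rw [← integral_inner hk c]
    simp [real_inner_smul_right]
  rw [e _ f (integrableOn_smul_of_tsupport_subset h.1 (contDiff_fderiv_apply h1 v).continuous
    (hasCompactSupport_fderiv_apply h2 v) ((tsupport_fderiv_apply_subset φ v).trans h3)),
    e _ g (integrableOn_smul_of_tsupport_subset h.2.1 h1.continuous h2 h3),
    h.2.2 φ h1 h2 h3, inner_neg_right]

end Borel

section FiniteDimensional

variable [BorelSpace E] [FiniteDimensional ℝ E] [CompleteSpace F]

theorem HasWeakDeriv.unique (hΩ : IsOpen Ω) (h : HasWeakDeriv Ω v f g)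
    (h' : HasWeakDeriv Ω v f g') : g =ᵐ[volume.restrict Ω] g' := by
  have := hΩ.ae_eq_zero_of_integral_contDiff_smul_eq_zero (μ := volume) (h.2.1.sub h'.2.1)
    fun φ h1 h2 h3 => by
      have i1 := integrable_smul_of_tsupport_subset h.2.1 h1.continuous h2 h3
      have i2 := integrable_smul_of_tsupport_subset h'.2.1 h1.continuous h2 h3
      simp only [Pi.sub_apply, smul_sub]
      rw [integral_sub i1 i2, ← setIntegral_smul_of_tsupport_subset h3,
        ← setIntegral_smul_of_tsupport_subset h3, sub_eq_zero, ← neg_inj,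
        ← h.2.2 φ h1 h2 h3, ← h'.2.2 φ h1 h2 h3]
  rw [EventuallyEq, ae_restrict_iff' hΩ.measurableSet]
  filter_upwards [this] with x hx hxΩ
  exact sub_eq_zero.1 (hx hxΩ)

theorem HasWeakDeriv.ae_eq_weakDeriv (hΩ : IsOpen Ω) (h : HasWeakDeriv Ω v f g) :
    g =ᵐ[volume.restrict Ω] weakDeriv Ω v f :=
  h.unique hΩ (hasWeakDeriv_weakDeriv h)

theorem hasWeakDeriv_const [(volume : Measure E).IsAddHaarMeasure] (v : E) (c : F) :
    HasWeakDeriv Ω v (fun _ => c) (fun _ => 0) := by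
  refine ⟨(locallyIntegrable_const c).locallyIntegrableOn Ω,
    (locallyIntegrable_const 0).locallyIntegrableOn Ω, fun φ h1 h2 h3 => ?_⟩
  have hd := (contDiff_fderiv_apply h1 v).continuous.integrable_of_hasCompactSupport
    (μ := volume) (hasCompactSupport_fderiv_apply h2 v)
  have key := integral_smul_fderiv_eq_neg_fderiv_smul_of_integrable (μ := (volume : Measure E))
    (f := φ) (g := fun _ => c) (v := v) (hd.smul_const c) (by simp)
    ((h1.continuous.integrable_of_hasCompactSupport h2).smul_const c)
    (fun x _ => (h1.differentiable (by simp)) x) (fun x _ => differentiableAt_const c)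
  rw [setIntegral_smul_of_tsupport_subset ((tsupport_fderiv_apply_subset φ v).trans h3)]
  simp at key
  simp [key]

/-- Mixed weak derivatives commute. -/
theorem HasWeakDeriv.comm (hΩ : IsOpen Ω) {p q a b : E → F} (hp : HasWeakDeriv Ω v f p)
    (hq : HasWeakDeriv Ω w f q) (ha : HasWeakDeriv Ω w p a) (hb : HasWeakDeriv Ω v q b) :
    a =ᵐ[volume.restrict Ω] b := by
  refine HasWeakDeriv.unique hΩ (v := w) ha ⟨ha.1, hb.2.1, fun φ h1 h2 h3 => ?_⟩
  have hsw : ∀ x, fderiv ℝ (fun z => fderiv ℝ φ z v) x w =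
      fderiv ℝ (fun z => fderiv ℝ φ z w) x v := fun x => by
    have hd : DifferentiableAt ℝ (fderiv ℝ φ) x :=
      ((h1.fderiv_right (m := ∞) (by simp)).differentiable (by simp)) x
    have hs : IsSymmSndFDerivAt ℝ φ x :=
      h1.contDiffAt.isSymmSndFDerivAt (by
        simpa using (WithTop.coe_le_coe.2 le_top : ((2 : ℕ∞) : WithTop ℕ∞) ≤ ∞))
    rw [fderiv_clm_apply hd (differentiableAt_const _),
      fderiv_clm_apply hd (differentiableAt_const _)]
    simpa using hs.eq w v
  have hs := fun u => (tsupport_fderiv_apply_subset φ u).trans h3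
  -- Directional derivatives of `φ` are again test functions. Evaluating `∫ (∂ᵥ∂_w φ) f` with `p`
  -- and with `q` gives the same number because second derivatives of `φ` are symmetric.
  have e1 := hp.2.2 _ (contDiff_fderiv_apply h1 w) (hasCompactSupport_fderiv_apply h2 w) (hs w)
  have e2 := hq.2.2 _ (contDiff_fderiv_apply h1 v) (hasCompactSupport_fderiv_apply h2 v) (hs v)
  have e3 := hb.2.2 φ h1 h2 h3
  simp only [hsw] at e2
  rw [e1] at e2
  rw [← e3]
  exact neg_inj.1 e2

/-- The weak derivative is closed under weak convergence in `L²`. -/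
theorem HasWeakDeriv.of_tendstoWeakL2 [IsLocallyFiniteMeasure (volume : Measure E)]
    {f g : ℕ → E → F} {f₀ g₀ : E → F} (hf : TendstoWeakL2 Ω f f₀) (hg : TendstoWeakL2 Ω g g₀)
    (h : ∀ n, HasWeakDeriv Ω v (f n) (g n)) : HasWeakDeriv Ω v f₀ g₀ := by
  have lf := locallyIntegrableOn_of_memLp hf.2.1
  have lg := locallyIntegrableOn_of_memLp hg.2.1
  -- Pairing the vector identity with a fixed `c` turns both sides into `L²` products with the test
  -- fields `∂ᵥφ c` and `φ c`, to which weak convergence applies.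
  refine ⟨lf, lg, fun φ h1 h2 h3 => ext_inner_left ℝ fun c => ?_⟩
  have e : ∀ (ψ : E → ℝ) (k : E → F), IntegrableOn (fun x => ψ x • k x) Ω →
      inner ℝ c (∫ x in Ω, ψ x • k x) = ∫ x in Ω, inner ℝ (k x) (ψ x • c) := fun ψ k hk => by
    rw [← integral_inner hk c]
    simp [real_inner_smul_right, real_inner_comm]
  have hd := (contDiff_fderiv_apply h1 v).continuous
  have hdc := hasCompactSupport_fderiv_apply h2 v
  have hds := (tsupport_fderiv_apply_subset φ v).trans h3
  have m1 : MemLp (fun x => (fderiv ℝ φ x v) • c) 2 (volume.restrict Ω) :=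
    ((hd.smul continuous_const).memLp_of_hasCompactSupport hdc.smul_right).restrict Ω
  have m2 : MemLp (fun x => φ x • c) 2 (volume.restrict Ω) :=
    ((h1.continuous.smul continuous_const).memLp_of_hasCompactSupport h2.smul_right).restrict Ω
  rw [inner_neg_right, e _ _ (integrableOn_smul_of_tsupport_subset lf hd hdc hds),
    e _ _ (integrableOn_smul_of_tsupport_subset lg h1.continuous h2 h3)]
  refine tendsto_nhds_unique (hf.2.2 _ m1) ((hg.2.2 _ m2).neg.congr fun n => ?_)
  rw [← e _ _ (integrableOn_smul_of_tsupport_subset (h n).1 hd hdc hds),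
    ← e _ _ (integrableOn_smul_of_tsupport_subset (h n).2.1 h1.continuous h2 h3),
    ← inner_neg_right, (h n).2.2 φ h1 h2 h3]

end FiniteDimensional

end WeakDerivative

/-! ### Mollification and the product rule -/

section Mollification

open scoped Convolution
open ContinuousLinearMap (lsmul)

variable {E : Type*} [NormedAddCommGroup E] [NormedSpace ℝ E] [MeasureSpace E] [BorelSpace E]
  [FiniteDimensional ℝ E] [(volume : Measure E).IsAddHaarMeasure]

/-- A sequence of bump functions around `0` with radii tending to `0`. -/
def shrinkingBump (E : Type*) [NormedAddCommGroup E] [NormedSpace ℝ E] (n : ℕ) :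
    ContDiffBump (0 : E) where
  rIn := 1 / (n + 1)
  rOut := 2 / (n + 1)
  rIn_pos := by positivity
  rIn_lt_rOut := by
    have : (0 : ℝ) < n + 1 := by positivity
    gcongr
    norm_num

/-- The mollifiers associated with `shrinkingBump`. -/
def mollifier (E : Type*) [NormedAddCommGroup E] [NormedSpace ℝ E] [MeasureSpace E]
    [BorelSpace E] [FiniteDimensional ℝ E] (n : ℕ) : E → ℝ :=
  (shrinkingBump E n).normed volume

/-- The mollification of a function. -/
def mollify (n : ℕ) (f : E → ℝ) (x : E) : ℝ := ∫ y, mollifier E n (x - y) * f y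

theorem mollify_eq_convolution (n : ℕ) (f : E → ℝ) :
    mollify n f = (mollifier E n ⋆[lsmul ℝ ℝ, volume] f : E → ℝ) := by
  ext x
  rw [convolution_eq_swap]
  rfl

theorem tendsto_shrinkingBump_rOut :
    Tendsto (fun n => (shrinkingBump E n).rOut) atTop (𝓝 0) := by
  have := (tendsto_one_div_add_atTop_nhds_zero_nat (𝕜 := ℝ)).const_mul 2
  simp only [mul_zero] at this
  refine this.congr fun n => ?_
  simp [shrinkingBump, div_eq_mul_inv]

theorem mollifier_contDiff (n : ℕ) : ContDiff ℝ ∞ (mollifier E n) :=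
  (shrinkingBump E n).contDiff_normed

theorem mollifier_hasCompactSupport (n : ℕ) : HasCompactSupport (mollifier E n) :=
  (shrinkingBump E n).hasCompactSupport_normed

theorem mollifier_nonneg (n : ℕ) (x : E) : 0 ≤ mollifier E n x :=
  (shrinkingBump E n).nonneg_normed x

theorem mollifier_integrable_comp_sub (n : ℕ) (x : E) :
    Integrable (fun y => mollifier E n (x - y)) :=
  ((mollifier_contDiff n).continuous.integrable_of_hasCompactSupport
    (mollifier_hasCompactSupport n)).comp_sub_left x

theorem integral_mollifier_sub (n : ℕ) (x : E) : ∫ y, mollifier E n (x - y) = 1 := by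
  rw [integral_sub_left_eq_self]
  exact (shrinkingBump E n).integral_normed

theorem mollifier_sub_comm (n : ℕ) (x y : E) :
    mollifier E n (x - y) = mollifier E n (y - x) := by
  rw [← neg_sub]
  exact (shrinkingBump E n).normed_neg (y - x)

theorem tsupport_mollifier (n : ℕ) :
    tsupport (mollifier E n) = Metric.closedBall 0 (shrinkingBump E n).rOut :=
  (shrinkingBump E n).tsupport_normed_eq

theorem ae_tendsto_mollify {f : E → ℝ} (hf : LocallyIntegrable f) :
    ∀ᵐ x, Tendsto (fun n => mollify n f x) atTop (𝓝 (f x)) := by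
  simp only [mollify_eq_convolution]
  -- The constant `2` is the ratio of outer to inner radius; a bounded ratio is what Lebesgue
  -- differentiation requires here.
  refine ContDiffBump.ae_convolution_tendsto_right_of_locallyIntegrable (K := 2)
    tendsto_shrinkingBump_rOut (Eventually.of_forall fun n => le_of_eq ?_) hf
  simp [shrinkingBump]
  ring

theorem abs_mollify_le {f : E → ℝ} {M : ℝ} (hf : ∀ x, |f x| ≤ M) (n : ℕ) (x : E) :
    |mollify n f x| ≤ M := by
  have h : ‖∫ y, mollifier E n (x - y) * f y‖ ≤ ∫ y, mollifier E n (x - y) * M := by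
    refine norm_integral_le_of_norm_le ((mollifier_integrable_comp_sub n x).mul_const M)
      (ae_of_all _ fun y => ?_)
    rw [norm_mul, Real.norm_of_nonneg (mollifier_nonneg n _)]
    exact mul_le_mul_of_nonneg_left (hf y) (mollifier_nonneg n _)
  rwa [integral_mul_const, integral_mollifier_sub, one_mul] at h

theorem mollify_contDiff {f : E → ℝ} (hf : LocallyIntegrable f) (n : ℕ) :
    ContDiff ℝ ∞ (mollify n f) := by
  rw [mollify_eq_convolution]
  exact (mollifier_hasCompactSupport n).contDiff_convolution_left _ (mollifier_contDiff n) hf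

theorem fderiv_mollify {f : E → ℝ} (hf : LocallyIntegrable f) (n : ℕ) (x v : E) :
    fderiv ℝ (mollify n f) x v = ∫ y, fderiv ℝ (mollifier E n) (x - y) v * f y := by
  have he : mollify n f = (f ⋆[lsmul ℝ ℝ, volume] mollifier E n : E → ℝ) := by
    ext z
    simp [mollify, convolution_def, mul_comm]
  rw [he, ((mollifier_hasCompactSupport n).hasFDerivAt_convolution_right (lsmul ℝ ℝ) hf
    ((mollifier_contDiff n).of_le (by simp)) x).fderiv,
    convolution_precompR_apply (lsmul ℝ ℝ) hf ((mollifier_hasCompactSupport n).fderiv ℝ)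
      ((mollifier_contDiff n).continuous_fderiv (by simp))]
  simp [convolution_def, mul_comm]

/-- The mollifier centred at `x` is itself a test function in `Ω` once its ball lies in `Ω`. The
sign from differentiating `x - y` in `y` cancels the sign in the definition of the weak derivative.
-/
theorem fderiv_mollify_indicator {Ω : Set E} (hΩ : IsOpen Ω) {v : E} {f f' : E → ℝ}
    (h : HasWeakDeriv Ω v f f') (hf : LocallyIntegrable (Ω.indicator f)) {n : ℕ} {x : E}
    (hx : Metric.closedBall x (shrinkingBump E n).rOut ⊆ Ω) :
    fderiv ℝ (mollify n (Ω.indicator f)) x v = mollify n (Ω.indicator f') x := by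
  have hd : ∀ y, fderiv ℝ (fun y => mollifier E n (x - y)) y v =
      -fderiv ℝ (mollifier E n) (x - y) v := fun y => by
    have h1 : HasFDerivAt (fun y : E => x - y) (-ContinuousLinearMap.id ℝ E) y :=
      (hasFDerivAt_id y).const_sub x
    have h2 := (((mollifier_contDiff (E := E) n).differentiable (by simp)) (x - y)).hasFDerivAt
    have h3 : HasFDerivAt (fun y => mollifier E n (x - y))
        ((fderiv ℝ (mollifier E n) (x - y)).comp (-ContinuousLinearMap.id ℝ E)) y := h2.comp y h1
    rw [h3.fderiv]
    simp
  have hs : tsupport (fun y => mollifier E n (x - y)) ⊆ Metric.closedBall x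
      (shrinkingBump E n).rOut := by
    have : tsupport (fun y => mollifier E n (x - y)) ⊆
        (fun y => x - y) ⁻¹' tsupport (mollifier E n) :=
      tsupport_comp_subset_preimage (mollifier E n) (f := fun y => x - y) (by fun_prop)
    refine this.trans fun y hy => ?_
    rw [mem_preimage, tsupport_mollifier, Metric.mem_closedBall, dist_zero_right] at hy
    rwa [Metric.mem_closedBall, dist_comm, dist_eq_norm]
  have hc : HasCompactSupport (fun y => mollifier E n (x - y)) :=
    (isCompact_closedBall _ _).of_isClosed_subset isClosed_closure hs
  have key := h.2.2 (fun y => mollifier E n (x - y))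
    ((mollifier_contDiff n).comp (contDiff_const.sub contDiff_id)) hc (hs.trans hx)
  simp only [hd, smul_eq_mul, neg_mul, integral_neg, neg_inj] at key
  rw [fderiv_mollify hf, mollify]
  have e : ∀ a k : E → ℝ, ∫ y, a y * Ω.indicator k y = ∫ y in Ω, a y * k y := fun a k => by
    rw [← integral_indicator hΩ.measurableSet]
    congr 1 with y
    by_cases hy : y ∈ Ω <;> simp [hy]
  rw [e, e, key]

/-- Mollification is self-adjoint because the mollifier is even. Fubini applies since the kernel is
bounded and the product of `k` and `g` in separate variables is integrable. -/
theorem integral_mul_mollify_comm {k g : E → ℝ} (hk : Integrable k) (hg : Integrable g) (n : ℕ) :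
    ∫ x, k x * mollify n g x = ∫ y, g y * mollify n k y := by
  have hint : Integrable (Function.uncurry fun x y : E => k x * (mollifier E n (x - y) * g y))
      (volume.prod volume) := by
    have h1 : Integrable (fun z : E × E => k z.1 * g z.2) (volume.prod volume) := hk.mul_prod hg
    obtain ⟨C, hC⟩ := (mollifier_contDiff (E := E) n).continuous.bounded_above_of_compact_support
      (mollifier_hasCompactSupport n)
    have h2 := h1.bdd_mul (c := C) (f := fun z : E × E => mollifier E n (z.1 - z.2))
      ((mollifier_contDiff n).continuous.comp
        (continuous_fst.sub continuous_snd)).aestronglyMeasurable (ae_of_all _ fun z => hC _)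
    refine h2.congr (ae_of_all _ fun z => ?_)
    simp only [Function.uncurry]
    ring
  simp only [mollify, ← integral_const_mul]
  rw [integral_integral_swap hint]
  congr 1 with y
  congr 1 with x
  rw [mollifier_sub_comm]
  ring

/-- Only `f` is mollified: `φ` times the mollified `f` is smooth with compact support in `Ω`, hence
a test function for `g`. The limit of the resulting identity is the product rule, and neither `f`
nor `g` needs to be continuous. -/
theorem HasWeakDeriv.mul_of_forall_abs_le {Ω : Set E} (hΩ : IsOpen Ω) {v : E} {f f' g g' : E → ℝ}
    (hf : HasWeakDeriv Ω v f f') (hg : HasWeakDeriv Ω v g g') (hf' : IntegrableOn f' Ω) {M : ℝ}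
    (hfM : ∀ x, |f x| ≤ M) (hgM : ∀ x, |g x| ≤ M) :
    HasWeakDeriv Ω v (fun x => f x * g x) (fun x => f' x * g x + f x * g' x) := by
  have hm := hΩ.measurableSet
  have sf := hf.1.aestronglyMeasurable
  have sg := hg.1.aestronglyMeasurable
  have M0 : 0 ≤ M := (abs_nonneg _).trans (hfM 0)
  have lF : LocallyIntegrable (Ω.indicator f) := by
    refine (memLp_top_of_bound (C := M) ((aestronglyMeasurable_indicator_iff hm).2 sf)
      (ae_of_all _ fun x => ?_)).locallyIntegrable le_top
    by_cases hx : x ∈ Ω <;> simp [hx, hfM, M0]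
  have bF : ∀ x, |Ω.indicator f x| ≤ M := fun x => by
    by_cases hx : x ∈ Ω <;> simp [hx, hfM, M0]
  have iF' : Integrable (Ω.indicator f') := (integrable_indicator_iff hm).2 hf'
  have l1 : LocallyIntegrableOn (fun x => f x * g x) Ω := fun x hx => by
    obtain ⟨s, hs, hi⟩ := hf.1 x hx
    refine ⟨s ∩ Ω, inter_mem hs self_mem_nhdsWithin, ?_⟩
    exact (hi.mono_set inter_subset_left).mul_bdd (c := M)
      (sg.mono_set inter_subset_right) (ae_of_all _ hgM)
  have l2 : LocallyIntegrableOn (fun x => f' x * g x) Ω := fun x hx => by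
    obtain ⟨s, hs, hi⟩ := hf.2.1 x hx
    refine ⟨s ∩ Ω, inter_mem hs self_mem_nhdsWithin, ?_⟩
    exact (hi.mono_set inter_subset_left).mul_bdd (c := M)
      (sg.mono_set inter_subset_right) (ae_of_all _ hgM)
  have l3 : LocallyIntegrableOn (fun x => f x * g' x) Ω := fun x hx => by
    obtain ⟨s, hs, hi⟩ := hg.2.1 x hx
    refine ⟨s ∩ Ω, inter_mem hs self_mem_nhdsWithin, ?_⟩
    exact (hi.mono_set inter_subset_left).bdd_mul (c := M)
      (sf.mono_set inter_subset_right) (ae_of_all _ hfM)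
  refine ⟨l1, l2.add l3, fun φ h1 h2 h3 => ?_⟩
  have hd := (contDiff_fderiv_apply h1 v).continuous
  have hdc := hasCompactSupport_fderiv_apply h2 v
  have hds := (tsupport_fderiv_apply_subset φ v).trans h3
  have aeF : ∀ᵐ x ∂(volume.restrict Ω),
      Tendsto (fun n => mollify n (Ω.indicator f) x) atTop (𝓝 (f x)) := by
    filter_upwards [ae_restrict_of_ae (ae_tendsto_mollify lF), ae_restrict_mem hm] with x hx hxΩ
    simpa [hxΩ] using hx
  have cF : ∀ n, Continuous (mollify n (Ω.indicator f)) := fun n =>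
    (mollify_contDiff lF n).continuous
  obtain ⟨Cφ, hCφ⟩ := h1.continuous.bounded_above_of_compact_support h2
  have C0 : 0 ≤ Cφ := (norm_nonneg _).trans (hCφ 0)
  -- The product `φ g`, cut off so that it is defined and bounded on the whole space.
  set k : E → ℝ := fun x => φ x * Ω.indicator g x with hk
  have hk_eq : ∀ x, k x = φ x * g x := fun x => by
    by_cases hx : x ∈ Ω
    · simp [hk, hx]
    · simp [hk, hx, image_eq_zero_of_notMem_tsupport fun h => hx (h3 h)]
  have ik : Integrable k := by
    have := integrable_smul_of_tsupport_subset hg.1 h1.continuous h2 h3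
    exact this.congr (ae_of_all _ fun x => by simp [hk_eq])
  have bk : ∀ x, |k x| ≤ Cφ * M := fun x => by
    rw [hk_eq, abs_mul]
    exact mul_le_mul (hCφ x) (hgM x) (abs_nonneg _) C0
  have T1 : Tendsto (fun n => ∫ x in Ω, mollify n (Ω.indicator f) x * (fderiv ℝ φ x v * g x)) atTop
      (𝓝 (∫ x in Ω, f x * (fderiv ℝ φ x v * g x))) := by
    have i := integrableOn_smul_of_tsupport_subset hg.1 hd hdc hds
    refine tendsto_integral_of_dominated_convergence (fun x => M * ‖fderiv ℝ φ x v * g x‖)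
      (fun n => (cF n).aestronglyMeasurable.mul i.aestronglyMeasurable) (i.norm.const_mul M)
      (fun n => ae_of_all _ fun x => ?_) ?_
    · rw [norm_mul]
      exact mul_le_mul_of_nonneg_right (abs_mollify_le bF n x) (norm_nonneg _)
    · filter_upwards [aeF] with x hx using hx.mul_const _
  have T3 : Tendsto (fun n => ∫ x in Ω, mollify n (Ω.indicator f) x * (φ x * g' x)) atTop
      (𝓝 (∫ x in Ω, f x * (φ x * g' x))) := by
    have i := integrableOn_smul_of_tsupport_subset hg.2.1 h1.continuous h2 h3
    refine tendsto_integral_of_dominated_convergence (fun x => M * ‖φ x * g' x‖)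
      (fun n => (cF n).aestronglyMeasurable.mul i.aestronglyMeasurable) (i.norm.const_mul M)
      (fun n => ae_of_all _ fun x => ?_) ?_
    · rw [norm_mul]
      exact mul_le_mul_of_nonneg_right (abs_mollify_le bF n x) (norm_nonneg _)
    · filter_upwards [aeF] with x hx using hx.mul_const _
  have T2 : Tendsto (fun n => ∫ x, k x * mollify n (Ω.indicator f') x) atTop
      (𝓝 (∫ x, Ω.indicator f' x * k x)) := by
    -- As `f'` is merely integrable, its mollifications have no evident dominating function. Moving
    -- the mollifier onto the bounded function `k` makes dominated convergence available.
    simp only [integral_mul_mollify_comm ik iF']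
    refine tendsto_integral_of_dominated_convergence
      (fun x => ‖Ω.indicator f' x‖ * (Cφ * M)) (fun n => iF'.aestronglyMeasurable.mul
        (mollify_contDiff ik.locallyIntegrable n).continuous.aestronglyMeasurable)
      (iF'.norm.mul_const _) (fun n => ae_of_all _ fun x => ?_) ?_
    · rw [norm_mul]
      exact mul_le_mul_of_nonneg_left (abs_mollify_le bk n x) (norm_nonneg _)
    · filter_upwards [ae_tendsto_mollify ik.locallyIntegrable] with x hx using hx.const_mul _
  have e2 : ∫ x, Ω.indicator f' x * k x = ∫ x in Ω, φ x * (f' x * g x) := by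
    rw [← integral_indicator hm]
    congr 1 with x
    by_cases hx : x ∈ Ω
    · simp [hx, hk_eq]; ring
    · simp [hx]
  have step : ∀ᶠ n in atTop, (∫ x in Ω, mollify n (Ω.indicator f) x * (fderiv ℝ φ x v * g x)) +
      ∫ x, k x * mollify n (Ω.indicator f') x =
      -∫ x in Ω, mollify n (Ω.indicator f) x * (φ x * g' x) := by
    -- Extending `f` by zero may destroy its weak derivative at the boundary of `Ω`. For radii below
    -- the distance `δ` this is not felt on the support of `φ`.
    obtain ⟨δ, δ0, hδ⟩ := h2.isCompact.exists_cthickening_subset_open hΩ h3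
    have hev : ∀ᶠ n in atTop, (shrinkingBump E n).rOut < δ :=
      tendsto_shrinkingBump_rOut.eventually (gt_mem_nhds δ0)
    filter_upwards [hev] with n hn
    have hD : ∀ x ∈ tsupport φ, fderiv ℝ (mollify n (Ω.indicator f)) x v =
        mollify n (Ω.indicator f') x := fun x hx => by
      refine fderiv_mollify_indicator hΩ hf lF ((Metric.closedBall_subset_closedBall hn.le).trans ?_)
      exact (Metric.closedBall_subset_cthickening hx δ).trans hδ
    have hsub : tsupport (fun x => φ x * mollify n (Ω.indicator f) x) ⊆ tsupport φ :=
      tsupport_mul_subset_left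
    have key := hg.2.2 (fun x => φ x * mollify n (Ω.indicator f) x)
      (h1.mul (mollify_contDiff lF n)) h2.mul_right (hsub.trans h3)
    have hprod : ∀ x, fderiv ℝ (fun x => φ x * mollify n (Ω.indicator f) x) x v • g x =
        mollify n (Ω.indicator f) x * (fderiv ℝ φ x v * g x) +
          (φ x * g x) * fderiv ℝ (mollify n (Ω.indicator f)) x v := fun x => by
      rw [fderiv_fun_mul ((h1.differentiable (by simp)) x)
        (((mollify_contDiff lF n).differentiable (by simp)) x)]
      simp
      ring
    simp only [hprod] at key
    have i1 : IntegrableOn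
        (fun x => mollify n (Ω.indicator f) x * (fderiv ℝ φ x v * g x)) Ω :=
      (integrableOn_smul_of_tsupport_subset hg.1 hd hdc hds).bdd_mul (c := M)
        (cF n).aestronglyMeasurable (ae_of_all _ (abs_mollify_le bF n))
    have e3 : ∀ x, (φ x * g x) * fderiv ℝ (mollify n (Ω.indicator f)) x v =
        k x * mollify n (Ω.indicator f') x := fun x => by
      rw [hk_eq]
      by_cases hx : x ∈ tsupport φ
      · rw [hD x hx]
      · simp [image_eq_zero_of_notMem_tsupport hx]
    have i2 : IntegrableOn (fun x => k x * mollify n (Ω.indicator f') x) Ω := by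
      have : Integrable (fun x => (fderiv ℝ (mollify n (Ω.indicator f)) x v * φ x) • g x) := by
        refine integrable_smul_of_tsupport_subset hg.1
          ((contDiff_fderiv_apply (mollify_contDiff lF n) v).continuous.mul h1.continuous)
          h2.mul_left ((tsupport_mul_subset_right).trans h3)
      refine (this.congr (ae_of_all _ fun x => ?_)).integrableOn
      rw [← e3]
      simp
      ring
    simp only [e3] at key
    rw [integral_add i1 i2, setIntegral_eq_integral_of_forall_compl_eq_zero
      (f := fun x => k x * mollify n (Ω.indicator f') x)
      (fun x hx => by simp [hk, hx])] at key
    rw [key]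
    congr 2 with x
    simp
    ring
  have lim := tendsto_nhds_unique (((T1.add T2).congr' step)) T3.neg
  have iA := integrableOn_smul_of_tsupport_subset l2 h1.continuous h2 h3
  have iB := integrableOn_smul_of_tsupport_subset l3 h1.continuous h2 h3
  simp only [smul_add]
  rw [integral_add iA iB]
  have eA : ∫ x in Ω, (fderiv ℝ φ x v) • (f x * g x) =
      ∫ x in Ω, f x * (fderiv ℝ φ x v * g x) := by
    congr 1 with x; simp; ring
  have eB : ∫ x in Ω, φ x • (f x * g' x) = ∫ x in Ω, f x * (φ x * g' x) := by
    congr 1 with x; simp; ring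
  rw [eA, eB]
  rw [e2] at lim
  simp only [smul_eq_mul]
  linarith

/-- Product rule for bounded weakly differentiable functions. -/
theorem HasWeakDeriv.mul {Ω : Set E} (hΩ : IsOpen Ω) {v : E} {f f' g g' : E → ℝ}
    (hf : HasWeakDeriv Ω v f f') (hg : HasWeakDeriv Ω v g g') (hf' : IntegrableOn f' Ω) {M : ℝ}
    (hfM : ∀ᵐ x ∂(volume.restrict Ω), |f x| ≤ M) (hgM : ∀ᵐ x ∂(volume.restrict Ω), |g x| ≤ M) :
    HasWeakDeriv Ω v (fun x => f x * g x) (fun x => f' x * g x + f x * g' x) := by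
  -- Truncation at level `|M|` changes the functions only on null sets and turns almost everywhere
  -- bounds into bounds at every point.
  let tr : (E → ℝ) → E → ℝ := fun k x => max (-|M|) (min |M| (k x))
  have b : ∀ k x, |tr k x| ≤ |M| := fun k x => by
    rw [abs_le]
    exact ⟨le_max_left _ _, max_le (by linarith [abs_nonneg M]) (min_le_left _ _)⟩
  have e : ∀ {k : E → ℝ}, (∀ᵐ x ∂(volume.restrict Ω), |k x| ≤ M) →
      k =ᵐ[volume.restrict Ω] tr k := fun {k} hk => by
    filter_upwards [hk] with x hx
    have := abs_le.1 (hx.trans (le_abs_self M))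
    simp [tr, this.1, this.2]
  have h := HasWeakDeriv.mul_of_forall_abs_le hΩ (hf.congr (e hfM) EventuallyEq.rfl)
    (hg.congr (e hgM) EventuallyEq.rfl) hf' (b f) (b g)
  refine h.congr ?_ ?_
  · filter_upwards [e hfM, e hgM] with x h1 h2
    rw [← h1, ← h2]
  · filter_upwards [e hfM, e hgM] with x h1 h2
    rw [← h1, ← h2]

end Mollification

/-! ### Functions on product domains: slices, coordinate exchange, fibre averages -/

section Product

variable {F : Type*} [NormedAddCommGroup F] [InnerProductSpace ℝ F] {A B : Set ℝ}

theorem volume_restrict_prod (A B : Set ℝ) :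
    (volume.restrict (A ×ˢ B) : Measure (ℝ × ℝ)) =
      (volume.restrict A).prod (volume.restrict B) := by
  rw [Measure.prod_restrict, Measure.volume_eq_prod]

theorem tsupport_slice_fst {φ : ℝ × ℝ → ℝ} (hs : tsupport φ ⊆ A ×ˢ B) (t : ℝ) :
    tsupport (fun s => φ (s, t)) ⊆ A := by
  have : tsupport (fun s => φ (s, t)) ⊆ (fun s => (s, t)) ⁻¹' tsupport φ :=
    tsupport_comp_subset_preimage φ (f := fun s : ℝ => (s, t)) (by fun_prop)
  exact fun s hx => (hs (this hx)).1

theorem tsupport_slice_snd {φ : ℝ × ℝ → ℝ} (hs : tsupport φ ⊆ A ×ˢ B) (s : ℝ) :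
    tsupport (fun t => φ (s, t)) ⊆ B := by
  have : tsupport (fun t => φ (s, t)) ⊆ (fun t => (s, t)) ⁻¹' tsupport φ :=
    tsupport_comp_subset_preimage φ (f := fun t : ℝ => (s, t)) (by fun_prop)
  exact fun t hx => (hs (this hx)).2

theorem hasCompactSupport_slice_fst {φ : ℝ × ℝ → ℝ} (hc : HasCompactSupport φ) (t : ℝ) :
    HasCompactSupport (fun s => φ (s, t)) := by
  refine HasCompactSupport.intro (hc.isCompact.image continuous_fst) fun s hs => ?_
  by_contra h
  exact hs ⟨(s, t), subset_closure h, rfl⟩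

theorem hasCompactSupport_slice_snd {φ : ℝ × ℝ → ℝ} (hc : HasCompactSupport φ) (s : ℝ) :
    HasCompactSupport (fun t => φ (s, t)) := by
  refine HasCompactSupport.intro (hc.isCompact.image continuous_snd) fun t hs => ?_
  by_contra h
  exact hs ⟨(s, t), subset_closure h, rfl⟩

theorem fderiv_slice_fst {φ : ℝ × ℝ → ℝ} (hφ : ContDiff ℝ ∞ φ) (s t : ℝ) :
    fderiv ℝ (fun s => φ (s, t)) s 1 = fderiv ℝ φ (s, t) (1, 0) := by
  have h1 : HasFDerivAt (fun s : ℝ => (s, t)) (ContinuousLinearMap.inl ℝ ℝ ℝ) s :=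
    hasFDerivAt_prodMk_left s t
  have h2 := (((hφ.differentiable (by simp)) (s, t)).hasFDerivAt).comp s h1
  have h3 : fderiv ℝ (fun s => φ (s, t)) s = _ := h2.fderiv
  rw [h3]
  simp

theorem fderiv_slice_snd {φ : ℝ × ℝ → ℝ} (hφ : ContDiff ℝ ∞ φ) (s t : ℝ) :
    fderiv ℝ (fun t => φ (s, t)) t 1 = fderiv ℝ φ (s, t) (0, 1) := by
  have h1 : HasFDerivAt (fun t : ℝ => (s, t)) (ContinuousLinearMap.inr ℝ ℝ ℝ) t :=
    hasFDerivAt_prodMk_right s t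
  have h2 := (((hφ.differentiable (by simp)) (s, t)).hasFDerivAt).comp t h1
  have h3 : fderiv ℝ (fun t => φ (s, t)) t = _ := h2.fderiv
  rw [h3]
  simp

theorem integrable_comp_fst_prod [IsFiniteMeasure (volume.restrict B)] {f : ℝ → F}
    (hf : IntegrableOn f A) :
    IntegrableOn (fun x : ℝ × ℝ => f x.1) (A ×ˢ B) := by
  rw [IntegrableOn, volume_restrict_prod]
  exact Integrable.comp_fst hf _

theorem integrableOn_bdd_smul {Ω : Set (ℝ × ℝ)} {f : ℝ × ℝ → F} (hf : IntegrableOn f Ω)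
    {φ : ℝ × ℝ → ℝ} (hφ : Continuous φ) (hc : HasCompactSupport φ) :
    IntegrableOn (fun x => φ x • f x) Ω := by
  obtain ⟨C, hC⟩ := hφ.bounded_above_of_compact_support hc
  exact Integrable.bdd_smul hf C hφ.aestronglyMeasurable (ae_of_all _ hC)

theorem setIntegral_prod_symm {f : ℝ × ℝ → F} (hf : IntegrableOn f (A ×ˢ B)) :
    ∫ x in A ×ˢ B, f x = ∫ t in B, ∫ s in A, f (s, t) := by
  rw [IntegrableOn, volume_restrict_prod] at hf
  rw [volume_restrict_prod, integral_prod_symm _ hf]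

theorem setIntegral_prod' {f : ℝ × ℝ → F} (hf : IntegrableOn f (A ×ˢ B)) :
    ∫ x in A ×ˢ B, f x = ∫ s in A, ∫ t in B, f (s, t) := by
  rw [IntegrableOn, volume_restrict_prod] at hf
  rw [volume_restrict_prod, integral_prod _ hf]

theorem HasWeakDeriv.comp_fst [IsFiniteMeasure (volume.restrict B)] {f g : ℝ → F}
    (h : HasWeakDeriv A 1 f g) (hf : IntegrableOn f A) (hg : IntegrableOn g A) :
    HasWeakDeriv (A ×ˢ B) (1, 0) (fun x => f x.1) (fun x => g x.1) := by
  have if' := integrable_comp_fst_prod (B := B) hf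
  have ig' := integrable_comp_fst_prod (B := B) hg
  refine ⟨if'.locallyIntegrableOn, ig'.locallyIntegrableOn, fun φ h1 h2 h3 => ?_⟩
  rw [setIntegral_prod_symm (integrableOn_bdd_smul if' (contDiff_fderiv_apply h1 _).continuous
      (hasCompactSupport_fderiv_apply h2 _)),
    setIntegral_prod_symm (integrableOn_bdd_smul ig' h1.continuous h2), ← integral_neg]
  congr 1 with t
  have := h.2.2 (fun s => φ (s, t)) (h1.comp (contDiff_id.prodMk contDiff_const))
    (hasCompactSupport_slice_fst h2 t) (tsupport_slice_fst h3 t)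
  simpa only [fderiv_slice_fst h1] using this

theorem hasWeakDeriv_comp_fst_snd [IsFiniteMeasure (volume.restrict B)] [CompleteSpace F]
    {f : ℝ → F} (hf : IntegrableOn f A) :
    HasWeakDeriv (A ×ˢ B) (0, 1) (fun x => f x.1) (fun _ => 0) := by
  have if' := integrable_comp_fst_prod (B := B) hf
  refine ⟨if'.locallyIntegrableOn, (locallyIntegrable_const 0).locallyIntegrableOn _,
    fun φ h1 h2 h3 => ?_⟩
  rw [setIntegral_prod' (integrableOn_bdd_smul if' (contDiff_fderiv_apply h1 _).continuous
      (hasCompactSupport_fderiv_apply h2 _))]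
  simp only [smul_zero, integral_zero, neg_zero]
  refine integral_eq_zero_of_ae (ae_of_all _ fun s => ?_)
  have := (hasWeakDeriv_const (Ω := B) (1 : ℝ) (f s)).2.2 (fun t => φ (s, t))
    (h1.comp (contDiff_const.prodMk contDiff_id))
    (hasCompactSupport_slice_snd h2 s) (tsupport_slice_snd h3 s)
  simpa only [fderiv_slice_snd h1, smul_zero, integral_zero, neg_zero, Pi.zero_apply] using this

/-- Exchanging coordinates allows the representation formula, which integrates along the second
variable, to be used along the first one. -/
theorem HasWeakDeriv.swap {Ω : Set (ℝ × ℝ)} {v : ℝ × ℝ} {f g : ℝ × ℝ → F}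
    (h : HasWeakDeriv Ω v f g) (hf : IntegrableOn f Ω) (hg : IntegrableOn g Ω) :
    HasWeakDeriv (Prod.swap ⁻¹' Ω) v.swap (fun x => f x.swap) (fun x => g x.swap) := by
  have hmp : MeasurePreserving (Prod.swap : ℝ × ℝ → ℝ × ℝ) volume volume := by
    simpa only [Measure.volume_eq_prod] using
      Measure.measurePreserving_swap (μ := (volume : Measure ℝ)) (ν := (volume : Measure ℝ))
  have hme : MeasurableEmbedding (Prod.swap : ℝ × ℝ → ℝ × ℝ) :=
    MeasurableEquiv.prodComm.measurableEmbedding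
  have hi : ∀ k : ℝ × ℝ → F, IntegrableOn k Ω →
      IntegrableOn (fun x => k x.swap) (Prod.swap ⁻¹' Ω) := fun k hk =>
    (hmp.integrableOn_comp_preimage hme).2 hk
  refine ⟨(hi f hf).locallyIntegrableOn, (hi g hg).locallyIntegrableOn, fun φ h1 h2 h3 => ?_⟩
  have hsw : ContDiff ℝ ∞ (Prod.swap : ℝ × ℝ → ℝ × ℝ) := contDiff_snd.prodMk contDiff_fst
  have key := h.2.2 (fun x => φ x.swap) (h1.comp hsw)
    (h2.comp_homeomorph (Homeomorph.prodComm ℝ ℝ)) (by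
      refine (tsupport_comp_subset_preimage φ (f := Prod.swap) continuous_swap).trans ?_
      intro x hx
      exact h3 hx)
  have hd : ∀ x, fderiv ℝ (fun x : ℝ × ℝ => φ x.swap) x v = fderiv ℝ φ x.swap v.swap := fun x => by
    have h4 : HasFDerivAt (Prod.swap : ℝ × ℝ → ℝ × ℝ)
        ((ContinuousLinearMap.snd ℝ ℝ ℝ).prod (ContinuousLinearMap.fst ℝ ℝ ℝ)) x :=
      ((ContinuousLinearMap.snd ℝ ℝ ℝ).prod (ContinuousLinearMap.fst ℝ ℝ ℝ)).hasFDerivAt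
    have h5 : HasFDerivAt (fun x : ℝ × ℝ => φ x.swap) _ x :=
      (((h1.differentiable (by simp)) x.swap).hasFDerivAt).comp x h4
    rw [h5.fderiv]
    rfl
  have e : ∀ k : ℝ × ℝ → F, ∫ x in Prod.swap ⁻¹' Ω, k x.swap = ∫ x in Ω, k x := fun k =>
    hmp.setIntegral_preimage_emb hme k Ω
  simp only [hd] at key
  rw [← e, ← e] at key
  simpa using key

theorem memLp_comp_fst_iff [IsProbabilityMeasure (volume.restrict B)] {f : ℝ → F}
    (hf : AEStronglyMeasurable f (volume.restrict A)) :
    MemLp (fun x : ℝ × ℝ => f x.1) 2 (volume.restrict (A ×ˢ B)) ↔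
      MemLp f 2 (volume.restrict A) := by
  have hmp : MeasurePreserving (Prod.fst : ℝ × ℝ → ℝ) (volume.restrict (A ×ˢ B))
      (volume.restrict A) := by
    rw [volume_restrict_prod]
    exact measurePreserving_fst
  have := memLp_map_measure_iff (p := 2) (f := (Prod.fst : ℝ × ℝ → ℝ)) (g := f)
    (μ := volume.restrict (A ×ˢ B)) (by rwa [hmp.map_eq]) measurable_fst.aemeasurable
  rw [hmp.map_eq] at this
  exact this.symm

theorem ae_comp_fst_iff [IsProbabilityMeasure (volume.restrict B)] {p : ℝ → Prop} :
    (∀ᵐ x ∂(volume.restrict (A ×ˢ B)), p x.1) ↔ ∀ᵐ s ∂(volume.restrict A), p s := by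
  have hmp : MeasurePreserving (Prod.fst : ℝ × ℝ → ℝ) (volume.restrict (A ×ˢ B))
      (volume.restrict A) := by
    rw [volume_restrict_prod]
    exact measurePreserving_fst
  refine ⟨fun h => ?_, fun h => hmp.quasiMeasurePreserving.ae h⟩
  rw [volume_restrict_prod] at h
  have := Measure.ae_ae_of_ae_prod h
  filter_upwards [this] with s hs
  exact (hs.exists).choose_spec

/-- The weighted average of `f` in the second variable. -/
def fiberAvg (B : Set ℝ) (η : ℝ → ℝ) (f : ℝ × ℝ → F) (s : ℝ) : F := ∫ t in B, η t • f (s, t)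

theorem integrable_weight_smul {f : ℝ × ℝ → F} (hf : IntegrableOn f (A ×ˢ B)) {η : ℝ → ℝ}
    (hη : Continuous η) (hc : HasCompactSupport η) :
    IntegrableOn (fun x => η x.2 • f x) (A ×ˢ B) := by
  obtain ⟨C, hC⟩ := hη.bounded_above_of_compact_support hc
  exact Integrable.bdd_smul hf C (hη.comp continuous_snd).aestronglyMeasurable
    (ae_of_all _ fun x => hC _)

theorem integrableOn_fiberAvg {f : ℝ × ℝ → F} (hf : IntegrableOn f (A ×ˢ B)) {η : ℝ → ℝ}
    (hη : Continuous η) (hc : HasCompactSupport η) : IntegrableOn (fiberAvg B η f) A := by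
  have := integrable_weight_smul hf hη hc
  rw [IntegrableOn, volume_restrict_prod] at this
  exact this.integral_prod_left

/-- Test with `φ(x₁) η(x₂)`. This is admissible because `η` is smooth with compact support in `B`,
which is the reason for weighted averages instead of plain ones. -/
theorem HasWeakDeriv.fiberAvg {f g : ℝ × ℝ → F}
    (h : HasWeakDeriv (A ×ˢ B) (1, 0) f g) (hf : IntegrableOn f (A ×ˢ B))
    (hg : IntegrableOn g (A ×ˢ B)) {η : ℝ → ℝ} (hη : ContDiff ℝ ∞ η) (hc : HasCompactSupport η)
    (hs : tsupport η ⊆ B) : HasWeakDeriv A 1 (fiberAvg B η f) (fiberAvg B η g) := by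
  refine ⟨(integrableOn_fiberAvg hf hη.continuous hc).locallyIntegrableOn,
    (integrableOn_fiberAvg hg hη.continuous hc).locallyIntegrableOn, fun φ h1 h2 h3 => ?_⟩
  have hts : tsupport (fun x : ℝ × ℝ => φ x.1 * η x.2) ⊆ tsupport φ ×ˢ tsupport η := by
    refine closure_minimal (fun x hx => ?_) ((isClosed_tsupport _).prod (isClosed_tsupport _))
    have : φ x.1 * η x.2 ≠ 0 := hx
    exact ⟨subset_closure (left_ne_zero_of_mul this), subset_closure (right_ne_zero_of_mul this)⟩
  have hcs : HasCompactSupport (fun x : ℝ × ℝ => φ x.1 * η x.2) :=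
    (h2.isCompact.prod hc.isCompact).of_isClosed_subset (isClosed_tsupport _) hts
  have hcd : ContDiff ℝ ∞ (fun x : ℝ × ℝ => φ x.1 * η x.2) :=
    (h1.comp contDiff_fst).mul (hη.comp contDiff_snd)
  have key := h.2.2 _ hcd hcs (hts.trans (prod_mono h3 hs))
  have hd : ∀ s t, fderiv ℝ (fun x : ℝ × ℝ => φ x.1 * η x.2) (s, t) (1, 0) =
      fderiv ℝ φ s 1 * η t := fun s t => by
    rw [← fderiv_slice_fst hcd]
    simp only
    rw [fderiv_mul_const ((h1.differentiable (by simp)) s)]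
    simp [mul_comm]
  rw [setIntegral_prod' (integrableOn_bdd_smul hf (contDiff_fderiv_apply hcd _).continuous
      (hasCompactSupport_fderiv_apply hcs _)),
    setIntegral_prod' (integrableOn_bdd_smul hg hcd.continuous hcs)] at key
  simpa only [Ribbon.fiberAvg, hd, mul_smul, integral_smul] using key

theorem exists_weight {a b : ℝ} (hab : a < b) : ∃ η : ℝ → ℝ, ContDiff ℝ ∞ η ∧
    HasCompactSupport η ∧ tsupport η ⊆ Ioo a b ∧ (∀ t, 0 ≤ η t) ∧ ∫ t, η t = 1 := by
  let β : ContDiffBump ((a + b) / 2) :=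
    ⟨(b - a) / 8, (b - a) / 4, by linarith, by linarith⟩
  refine ⟨β.normed volume, β.contDiff_normed, β.hasCompactSupport_normed, ?_,
    β.nonneg_normed, β.integral_normed⟩
  rw [β.tsupport_normed_eq, Real.closedBall_eq_Icc]
  refine Icc_subset_Ioo ?_ ?_ <;> simp only [β] <;> linarith

end Product

/-! ### Smooth primitives and the averaging kernel -/

section Primitive

open scoped Convolution
open ContinuousLinearMap (lsmul)

theorem integrable_slice_of_support {G : ℝ × ℝ → ℝ} (hG : ContDiff ℝ ∞ G) {K : Set ℝ}
    (hK : IsCompact K) (h0 : ∀ p, ∀ r ∉ K, G (p, r) = 0) (p : ℝ) :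
    Integrable (fun r => G (p, r)) :=
  (hG.continuous.comp (Continuous.prodMk_right p)).integrable_of_hasCompactSupport
    (HasCompactSupport.intro hK fun r hr => h0 p r hr)

/-- The primitive is the convolution, in the second variable, of `G` with the Heaviside function, so
smoothness follows from that of convolutions depending on a parameter. -/
theorem contDiff_primitive {G : ℝ × ℝ → ℝ} (hG : ContDiff ℝ ∞ G) {K : Set ℝ} (hK : IsCompact K)
    (h0 : ∀ p, ∀ r ∉ K, G (p, r) = 0) :
    ContDiff ℝ ∞ (fun x : ℝ × ℝ => ∫ r in Iic x.2, G (x.1, r)) := by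
  have hH : LocallyIntegrable ((Ici (0 : ℝ)).indicator fun _ => (1 : ℝ)) :=
    (locallyIntegrable_const 1).indicator measurableSet_Ici
  have := contDiffOn_convolution_right_with_param (𝕜 := ℝ) (n := ⊤) (μ := volume) (lsmul ℝ ℝ)
    (f := (Ici (0 : ℝ)).indicator fun _ => (1 : ℝ)) (g := fun p r => G (p, r)) (s := univ)
    isOpen_univ hK (fun p r _ hr => h0 p r hr) hH hG.contDiffOn
  rw [univ_prod_univ, contDiffOn_univ] at this
  convert this using 2 with x
  rw [convolution_eq_swap, ← integral_indicator measurableSet_Iic]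
  congr 1 with r
  by_cases hr : r ≤ x.2 <;> simp [hr]

theorem fderiv_primitive {G : ℝ × ℝ → ℝ} (hG : ContDiff ℝ ∞ G) {K : Set ℝ} (hK : IsCompact K)
    (h0 : ∀ p, ∀ r ∉ K, G (p, r) = 0) (p t : ℝ) :
    fderiv ℝ (fun x : ℝ × ℝ => ∫ r in Iic x.2, G (x.1, r)) (p, t) (0, 1) = G (p, t) := by
  rw [← fderiv_slice_snd (contDiff_primitive hG hK h0)]
  have hi := integrable_slice_of_support hG hK h0 p
  have hc : Continuous fun r => G (p, r) := hG.continuous.comp (Continuous.prodMk_right p)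
  have e : (fun t => ∫ r in Iic t, G (p, r)) =
      fun t => (∫ r in Iic 0, G (p, r)) + ∫ r in (0 : ℝ)..t, G (p, r) := by
    ext t
    rw [← intervalIntegral.integral_Iic_sub_Iic hi.integrableOn hi.integrableOn]
    ring
  simp only
  rw [e]
  have := (intervalIntegral.integral_hasDerivAt_right (a := 0) (b := t)
    (hc.intervalIntegrable _ _) (hc.stronglyMeasurableAtFilter _ _) hc.continuousAt).const_add
    (∫ r in Iic 0, G (p, r))
  exact this.deriv

end Primitive

section Kernel

/-- The integral kernel in the representation of a function through its weak derivative and its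
average with weight `η`. -/
def avgKernel (η : ℝ → ℝ) (r t : ℝ) : ℝ := (Iic t).indicator (fun _ => 1) r - ∫ u in Iic t, η u

variable {η : ℝ → ℝ}

theorem measurable_avgKernel (hη : Integrable η) :
    Measurable (fun z : ℝ × ℝ => avgKernel η z.1 z.2) := by
  have h1 : Measurable (fun z : ℝ × ℝ => (Iic z.2).indicator (fun _ => (1 : ℝ)) z.1) := by
    have : (fun z : ℝ × ℝ => (Iic z.2).indicator (fun _ => (1 : ℝ)) z.1) =
        {z : ℝ × ℝ | z.1 ≤ z.2}.indicator fun _ => 1 := by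
      ext z; simp [indicator]
    rw [this]
    exact measurable_const.indicator (measurableSet_le measurable_fst measurable_snd)
  have h2 : Continuous (fun t => ∫ u in Iic t, η u) := by
    have e : (fun t => ∫ u in Iic t, η u) =
        fun t => (∫ u in Iic 0, η u) + ∫ u in (0 : ℝ)..t, η u := by
      ext t
      rw [← intervalIntegral.integral_Iic_sub_Iic hη.integrableOn hη.integrableOn]
      ring
    rw [e]
    exact continuous_const.add (intervalIntegral.continuous_primitive
      (fun a b => hη.intervalIntegrable) 0)
  exact h1.sub (h2.measurable.comp measurable_snd)

/-- The kernel is a difference of two numbers in `[0, 1]`. The resulting constant `1` is the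
constant in the Poincaré inequality. -/
theorem abs_avgKernel_le (hη : Integrable η) (h0 : ∀ t, 0 ≤ η t) (h1 : ∫ t, η t = 1) (r t : ℝ) :
    |avgKernel η r t| ≤ 1 := by
  have a1 : 0 ≤ ∫ u in Iic t, η u := integral_nonneg fun u => h0 u
  have a2 : ∫ u in Iic t, η u ≤ 1 :=
    h1 ▸ setIntegral_le_integral hη (ae_of_all _ h0)
  rw [abs_le, avgKernel]
  by_cases h : r ≤ t <;> simp only [mem_Iic, h, indicator_of_mem, indicator_of_notMem,
    not_false_eq_true] <;> constructor <;> linarith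

end Kernel

section Triple

variable {α β γ F : Type*} [MeasurableSpace α] [MeasurableSpace β] [MeasurableSpace γ]
  [NormedAddCommGroup F]

/-- Serves to exchange the two transversal variables in triple integrals over `(x₁, x₂, t)`. -/
theorem measurePreserving_swap_right (μ : Measure α) (ν : Measure β) (τ : Measure γ)
    [SFinite μ] [SFinite ν] [SFinite τ] :
    MeasurePreserving (fun z : (α × β) × γ => ((z.1.1, z.2), z.1.2)) ((μ.prod ν).prod τ)
      ((μ.prod τ).prod ν) := by
  have h1 := measurePreserving_prodAssoc μ ν τ
  have h2 := (MeasurePreserving.id μ).prod (Measure.measurePreserving_swap (μ := ν) (ν := τ))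
  have h3 := (measurePreserving_prodAssoc μ τ ν).symm
  exact h3.comp (h2.comp h1)

end Triple

/-! ### Representation by fibre averages, and the Poincaré inequality -/

section Representation

variable {F : Type*} [NormedAddCommGroup F] [InnerProductSpace ℝ F] [CompleteSpace F]
  {A : Set ℝ} {a b : ℝ} {η : ℝ → ℝ} {f g : ℝ × ℝ → F}

theorem integrable_avgKernel_smul (hg : IntegrableOn g (A ×ˢ Ioo a b))
    (hη : Integrable η) (h0 : ∀ t, 0 ≤ η t) (h1 : ∫ t, η t = 1) :
    Integrable (fun z : (ℝ × ℝ) × ℝ => avgKernel η z.1.2 z.2 • g (z.1.1, z.2))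
      (((volume.restrict A).prod (volume.restrict (Ioo a b))).prod
        (volume.restrict (Ioo a b))) := by
  rw [IntegrableOn, volume_restrict_prod] at hg
  have hmp := measurePreserving_swap_right (volume.restrict A) (volume.restrict (Ioo a b))
    (volume.restrict (Ioo a b))
  have h2 := hg.comp_fst (volume.restrict (Ioo a b))
  have h3 : Integrable (fun z : (ℝ × ℝ) × ℝ => g (z.1.1, z.2))
      (((volume.restrict A).prod (volume.restrict (Ioo a b))).prod
        (volume.restrict (Ioo a b))) :=
    hmp.integrable_comp_of_integrable h2
  refine h3.bdd_smul 1 ?_ (ae_of_all _ fun z => abs_avgKernel_le hη h0 h1 _ _)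
  exact ((measurable_avgKernel hη).comp
    ((measurable_snd.comp measurable_fst).prodMk measurable_snd)).aestronglyMeasurable

/-- A weakly differentiable function on a strip is recovered from its weighted averages over the
fibres and its weak derivative along the fibres. -/
theorem HasWeakDeriv.ae_eq_fiberAvg_sub (hA : IsOpen A)
    (h : HasWeakDeriv (A ×ˢ Ioo a b) (0, 1) f g) (hf : IntegrableOn f (A ×ˢ Ioo a b))
    (hg : IntegrableOn g (A ×ˢ Ioo a b)) (hη : ContDiff ℝ ∞ η) (hc : HasCompactSupport η)
    (hs : tsupport η ⊆ Ioo a b) (h0 : ∀ t, 0 ≤ η t) (h1 : ∫ t, η t = 1) :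
    ∀ᵐ x ∂(volume.restrict (A ×ˢ Ioo a b)), f x =
      Ribbon.fiberAvg (Ioo a b) η f x.1 - ∫ t in Ioo a b, avgKernel η x.2 t • g (x.1, t) := by
  set B := Ioo a b with hB
  have iη : Integrable η := hη.continuous.integrable_of_hasCompactSupport hc
  have iAvg : IntegrableOn (fun x : ℝ × ℝ => Ribbon.fiberAvg B η f x.1) (A ×ˢ B) :=
    integrable_comp_fst_prod (integrableOn_fiberAvg hf hη.continuous hc)
  have iT := integrable_avgKernel_smul hg iη h0 h1
  have iK : IntegrableOn (fun x : ℝ × ℝ => ∫ t in B, avgKernel η x.2 t • g (x.1, t))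
      (A ×ˢ B) := by
    rw [IntegrableOn, volume_restrict_prod]
    exact iT.integral_prod_left
  have hopen : IsOpen (A ×ˢ B) := hA.prod isOpen_Ioo
  have iH : IntegrableOn (fun x : ℝ × ℝ => f x - Ribbon.fiberAvg B η f x.1 +
      ∫ t in B, avgKernel η x.2 t • g (x.1, t)) (A ×ˢ B) := (hf.sub iAvg).add iK
  -- The formula is proved by duality: the difference of its two sides is integrated against an
  -- arbitrary test function `ψ`.
  have main := hopen.ae_eq_zero_of_integral_contDiff_smul_eq_zero (μ := volume)
    iH.locallyIntegrableOn fun ψ p1 p2 p3 => ?_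
  · rw [ae_restrict_iff' hopen.measurableSet]
    filter_upwards [main] with x hx hxS
    have := hx hxS
    rw [eq_sub_iff_add_eq, ← sub_eq_zero, ← this]
    abel
  rw [← setIntegral_smul_of_tsupport_subset p3]
  set K₁ := Prod.fst '' tsupport ψ with hK₁
  set K₂ := Prod.snd '' tsupport ψ ∪ tsupport η with hK₂
  have cK₁ : IsCompact K₁ := p2.isCompact.image continuous_fst
  have cK₂ : IsCompact K₂ := (p2.isCompact.image continuous_snd).union hc.isCompact
  have K₂B : K₂ ⊆ B := by
    rintro t (⟨x, hx, rfl⟩ | ht)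
    exacts [(p3 hx).2, hs ht]
  have ψ1 : ∀ s ∉ K₁, ∀ t, ψ (s, t) = 0 := fun s hs' t => by
    by_contra hne
    exact hs' ⟨(s, t), subset_closure hne, rfl⟩
  have ψ2 : ∀ s, ∀ t ∉ K₂, ψ (s, t) = 0 := fun s t ht => by
    by_contra hne
    exact ht (Or.inl ⟨(s, t), subset_closure hne, rfl⟩)
  have η2 : ∀ t ∉ K₂, η t = 0 := fun t ht => by
    by_contra hne
    exact ht (Or.inr (subset_closure hne))
  let m : ℝ → ℝ := fun s => ∫ r, ψ (s, r)
  have hm_eq : ∀ s, m s = ∫ r in B, ψ (s, r) := fun s =>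
    (setIntegral_eq_integral_of_forall_compl_eq_zero fun r hr =>
      ψ2 s r fun h => hr (K₂B h)).symm
  have hm : ContDiff ℝ ∞ m := by
    have e : m = fun s => ∫ r in Iic b, ψ (s, r) := by
      ext s
      refine (setIntegral_eq_integral_of_forall_compl_eq_zero fun r hr => ψ2 s r fun h => hr ?_).symm
      exact (K₂B h).2.le
    rw [e]
    exact (contDiff_primitive p1 cK₂ ψ2).comp (contDiff_id.prodMk contDiff_const)
  have m1 : ∀ s ∉ K₁, m s = 0 := fun s hs' => by simp [m, ψ1 s hs']
  -- Subtracting `m(x₁) η(x₂)` makes the integral over each fibre vanish, since `η` has integral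
  -- one. Hence the fibrewise primitive `P` of `G` has compact support and may be used as a test
  -- function for `f`.
  let G : ℝ × ℝ → ℝ := fun x => ψ x - m x.1 * η x.2
  have hmη : ContDiff ℝ ∞ (fun x : ℝ × ℝ => m x.1 * η x.2) :=
    (hm.comp contDiff_fst).mul (hη.comp contDiff_snd)
  have hG : ContDiff ℝ ∞ G := p1.sub hmη
  have G2 : ∀ s, ∀ t ∉ K₂, G (s, t) = 0 := fun s t ht => by simp [G, ψ2 s t ht, η2 t ht]
  let P : ℝ × ℝ → ℝ := fun x => ∫ r in Iic x.2, G (x.1, r)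
  have hP : ContDiff ℝ ∞ P := contDiff_primitive hG cK₂ G2
  have iψ : ∀ s, Integrable (fun r => ψ (s, r)) := integrable_slice_of_support p1 cK₂ ψ2
  have intG : ∀ s, ∫ r, G (s, r) = 0 := fun s => by
    simp only [G]
    rw [integral_sub (iψ s) (iη.const_mul _), integral_const_mul, h1]
    simp [m]
  -- Before `K₂` nothing has been integrated yet; beyond it the whole fibre integral of `G` has
  -- been, which is zero. Between the extreme points of `K₂` there may be gaps, hence the full
  -- interval.
  have P0 : ∀ x ∉ K₁ ×ˢ Icc (sInf K₂) (sSup K₂), P x = 0 := by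
    rintro ⟨s, t⟩ hx
    by_cases hsK : s ∈ K₁
    · have ht : ¬ (sInf K₂ ≤ t ∧ t ≤ sSup K₂) := fun ht => hx ⟨hsK, ht⟩
      rcases not_and_or.1 ht with ht | ht
      · refine setIntegral_eq_zero_of_forall_eq_zero fun r hr => G2 s r fun hrK => ht ?_
        exact (csInf_le cK₂.bddBelow hrK).trans hr
      · rw [← intG s]
        refine setIntegral_eq_integral_of_forall_compl_eq_zero fun r hr => G2 s r fun hrK => ht ?_
        exact ((not_le.1 hr).le).trans (le_csSup cK₂.bddAbove hrK)
    · simp [P, G, ψ1 s hsK, m1 s hsK]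
  have cP : IsCompact (K₁ ×ˢ Icc (sInf K₂) (sSup K₂)) := cK₁.prod isCompact_Icc
  have hPc : HasCompactSupport P := HasCompactSupport.intro cP P0
  have K₂ne : K₂.Nonempty := by
    by_contra hne
    rw [not_nonempty_iff_eq_empty] at hne
    have : ∫ t, η t = 0 := by
      refine integral_eq_zero_of_ae (ae_of_all _ fun t => ?_)
      exact η2 t (by simp [hne])
    linarith
  have hPs : tsupport P ⊆ A ×ˢ B := by
    have : tsupport P ⊆ K₁ ×ˢ Icc (sInf K₂) (sSup K₂) :=
      closure_minimal (fun x hx => by_contra fun h' => hx (P0 x h')) cP.isClosed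
    refine this.trans (prod_mono ?_ ?_)
    · rintro s ⟨x, hx, rfl⟩
      exact (p3 hx).1
    · have e1 := K₂B (cK₂.sInf_mem K₂ne)
      have e2 := K₂B (cK₂.sSup_mem K₂ne)
      exact Icc_subset_Ioo e1.1 e2.2
  -- The primitive is `ψ` integrated against the kernel, so the pairing of `P` with `g` becomes the
  -- pairing of `ψ` with the kernel integral of `g`.
  have P_eq : ∀ s t, P (s, t) = ∫ r in B, avgKernel η r t * ψ (s, r) := fun s t => by
    have e1 : ∫ r in B, avgKernel η r t * ψ (s, r) = ∫ r, avgKernel η r t * ψ (s, r) :=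
      setIntegral_eq_integral_of_forall_compl_eq_zero fun r hr => by
        simp [ψ2 s r fun h => hr (K₂B h)]
    have e2 : ∀ r, avgKernel η r t * ψ (s, r) =
        (Iic t).indicator (fun r => ψ (s, r)) r - (∫ u in Iic t, η u) * ψ (s, r) := fun r => by
      by_cases hr : r ≤ t <;> simp [avgKernel, hr, sub_mul]
    rw [e1]
    simp only [e2]
    rw [integral_sub ((iψ s).indicator measurableSet_Iic) ((iψ s).const_mul _),
      integral_indicator measurableSet_Iic, integral_const_mul]
    simp only [P, G]
    rw [integral_sub (iψ s).integrableOn (iη.const_mul _).integrableOn, integral_const_mul]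
    simp only [m]
    ring
  have key := h.2.2 P hP hPc hPs
  have hmηc : HasCompactSupport (fun x : ℝ × ℝ => m x.1 * η x.2) := by
    refine HasCompactSupport.intro (cK₁.prod cK₂) fun x hx => ?_
    by_cases hx1 : x.1 ∈ K₁
    · have : x.2 ∉ K₂ := fun hx2 => hx ⟨hx1, hx2⟩
      simp [η2 _ this]
    · simp [m1 _ hx1]
  have iψf := integrableOn_bdd_smul hf p1.continuous p2
  have iψavg := integrableOn_bdd_smul iAvg p1.continuous p2
  have iψK := integrableOn_bdd_smul iK p1.continuous p2
  have imηf := integrableOn_bdd_smul hf hmη.continuous hmηc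
  have L : ∫ x in A ×ˢ B, (fderiv ℝ P x (0, 1)) • f x =
      (∫ x in A ×ˢ B, ψ x • f x) - ∫ x in A ×ˢ B, ψ x • Ribbon.fiberAvg B η f x.1 := by
    have e1 : ∀ x, (fderiv ℝ P x (0, 1)) • f x = ψ x • f x - (m x.1 * η x.2) • f x := fun x => by
      rw [← sub_smul, fderiv_primitive hG cK₂ G2 x.1 x.2]
    simp only [e1]
    rw [integral_sub iψf imηf, setIntegral_prod' imηf, setIntegral_prod' iψavg]
    congr 2 with s
    simp only [mul_smul, integral_smul, integral_smul_const, ← hm_eq]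
    rfl
  -- Fubini on the triple integral, with the two transversal variables exchanged.
  have R : ∫ x in A ×ˢ B, P x • g x =
      ∫ x in A ×ˢ B, ψ x • ∫ t in B, avgKernel η x.2 t • g (x.1, t) := by
    obtain ⟨C, hC⟩ := p1.continuous.bounded_above_of_compact_support p2
    have iΦ : Integrable
        (fun z : (ℝ × ℝ) × ℝ => ψ z.1 • (avgKernel η z.1.2 z.2 • g (z.1.1, z.2)))
        (((volume.restrict A).prod (volume.restrict B)).prod (volume.restrict B)) :=
      iT.bdd_smul C (p1.continuous.comp continuous_fst).aestronglyMeasurable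
        (ae_of_all _ fun z => hC _)
    have hmp := measurePreserving_swap_right (volume.restrict A) (volume.restrict B)
      (volume.restrict B)
    have iΦ' : Integrable (fun z : (ℝ × ℝ) × ℝ =>
        ψ (z.1.1, z.2) • (avgKernel η z.2 z.1.2 • g (z.1.1, z.1.2)))
        (((volume.restrict A).prod (volume.restrict B)).prod (volume.restrict B)) :=
      hmp.integrable_comp_of_integrable iΦ
    have e3 : ∫ z, ψ z.1 • (avgKernel η z.1.2 z.2 • g (z.1.1, z.2))
          ∂(((volume.restrict A).prod (volume.restrict B)).prod (volume.restrict B)) =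
        ∫ z : (ℝ × ℝ) × ℝ, ψ (z.1.1, z.2) • (avgKernel η z.2 z.1.2 • g (z.1.1, z.1.2))
          ∂(((volume.restrict A).prod (volume.restrict B)).prod (volume.restrict B)) := by
      have := integral_map (φ := fun z : (ℝ × ℝ) × ℝ => ((z.1.1, z.2), z.1.2))
        hmp.measurable.aemeasurable (by rw [hmp.map_eq]; exact iΦ.aestronglyMeasurable)
      rw [hmp.map_eq] at this
      exact this
    rw [integral_prod _ iΦ, integral_prod _ iΦ'] at e3
    rw [volume_restrict_prod]
    simp only [integral_smul] at e3
    rw [e3]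
    congr 1 with x
    rw [show P x = P (x.1, x.2) from rfl, P_eq, ← integral_smul_const]
    congr 1 with r
    rw [smul_smul, mul_comm]
  simp only [smul_add, smul_sub]
  have isub : IntegrableOn (fun x => ψ x • f x - ψ x • Ribbon.fiberAvg B η f x.1) (A ×ˢ B) :=
    iψf.sub iψavg
  rw [integral_add isub iψK, integral_sub iψf iψavg, ← L, ← R, key, neg_add_cancel]

end Representation

section Poincare

variable {F : Type*} [NormedAddCommGroup F] [InnerProductSpace ℝ F] [CompleteSpace F]
  {A : Set ℝ} {a b : ℝ} {η : ℝ → ℝ} {f g : ℝ × ℝ → F}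

theorem sq_integral_norm_le {α : Type*} [MeasurableSpace α] {μ : Measure α}
    [IsProbabilityMeasure μ] {g : α → F} (hg : MemLp g 2 μ) :
    (∫ t, ‖g t‖ ∂μ) ^ 2 ≤ ∫ t, ‖g t‖ ^ 2 ∂μ := by
  have h := abs_integral_inner_le hg.norm (memLp_const (1 : ℝ))
  simp only [norm_norm, norm_one, one_pow, integral_const, probReal_univ, smul_eq_mul, mul_one,
    Real.sqrt_one] at h
  have e : ∫ t, inner ℝ ‖g t‖ (1 : ℝ) ∂μ = ∫ t, ‖g t‖ ∂μ := by simp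
  rw [e] at h
  have h0 : 0 ≤ ∫ t, ‖g t‖ ∂μ := integral_nonneg fun t => norm_nonneg _
  rw [abs_of_nonneg h0] at h
  calc (∫ t, ‖g t‖ ∂μ) ^ 2 ≤ Real.sqrt (∫ t, ‖g t‖ ^ 2 ∂μ) ^ 2 := by gcongr
    _ = _ := Real.sq_sqrt (integral_nonneg fun t => by positivity)

theorem isProbabilityMeasure_Ioo (hab : b - a = 1) :
    IsProbabilityMeasure (volume.restrict (Ioo a b)) :=
  ⟨by simp [hab]⟩

/-- Poincaré inequality along the fibres of a strip of width one. -/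
theorem HasWeakDeriv.integral_norm_sub_fiberAvg_sq_le (hA : IsOpen A) (hab : b - a = 1)
    (h : HasWeakDeriv (A ×ˢ Ioo a b) (0, 1) f g) (hf : IntegrableOn f (A ×ˢ Ioo a b))
    (hg : IntegrableOn g (A ×ˢ Ioo a b))
    (hg2 : MemLp g 2 (volume.restrict (A ×ˢ Ioo a b)))
    (hη : ContDiff ℝ ∞ η) (hc : HasCompactSupport η)
    (hs : tsupport η ⊆ Ioo a b) (h0 : ∀ t, 0 ≤ η t) (h1 : ∫ t, η t = 1) :
    MemLp (fun x => f x - Ribbon.fiberAvg (Ioo a b) η f x.1) 2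
        (volume.restrict (A ×ˢ Ioo a b)) ∧
      ∫ x in A ×ˢ Ioo a b, ‖f x - Ribbon.fiberAvg (Ioo a b) η f x.1‖ ^ 2 ≤
        ∫ x in A ×ˢ Ioo a b, ‖g x‖ ^ 2 := by
  have := isProbabilityMeasure_Ioo hab
  set B := Ioo a b with hB
  have iη : Integrable η := hη.continuous.integrable_of_hasCompactSupport hc
  have iAvg : IntegrableOn (fun x : ℝ × ℝ => Ribbon.fiberAvg B η f x.1) (A ×ˢ B) :=
    integrable_comp_fst_prod (integrableOn_fiberAvg hf hη.continuous hc)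
  have i2 := memLp_integrable_norm_sq hg2
  have i3 : IntegrableOn (fun s => ∫ t in B, ‖g (s, t)‖ ^ 2) A := by
    rw [volume_restrict_prod] at i2
    exact i2.integral_prod_left
  have i4 := integrable_comp_fst_prod (B := B) i3
  have hsl : ∀ᵐ s ∂(volume.restrict A), MemLp (fun t => g (s, t)) 2 (volume.restrict B) := by
    have m := hg2.1
    rw [volume_restrict_prod] at m i2
    filter_upwards [m.prodMk_left, i2.prod_right_ae] with s h1 h2
    exact (memLp_two_iff_integrable_sq_norm h1).2 h2
  have hsl' := ae_comp_fst_iff (B := B).2 hsl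
  -- By the representation formula and the bound `1` on the kernel, the deviation is at most `∫ |g|`
  -- over the fibre. The fibre has measure one, so Cauchy–Schwarz costs no constant.
  have hb : ∀ᵐ x ∂(volume.restrict (A ×ˢ B)), ‖f x - Ribbon.fiberAvg B η f x.1‖ ^ 2 ≤
      ∫ t in B, ‖g (x.1, t)‖ ^ 2 := by
    filter_upwards [h.ae_eq_fiberAvg_sub hA hf hg hη hc hs h0 h1, hsl'] with x hx hm
    rw [hx, sub_sub_cancel_left, norm_neg]
    refine le_trans ?_ (sq_integral_norm_le hm)
    gcongr
    refine norm_integral_le_of_norm_le (hm.integrable (by norm_num)).norm (ae_of_all _ fun t => ?_)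
    rw [norm_smul]
    exact mul_le_of_le_one_left (norm_nonneg _) (abs_avgKernel_le iη h0 h1 _ _)
  have hm : AEStronglyMeasurable (fun x => f x - Ribbon.fiberAvg B η f x.1)
      (volume.restrict (A ×ˢ B)) := hf.1.sub iAvg.1
  have i5 : IntegrableOn (fun x => ‖f x - Ribbon.fiberAvg B η f x.1‖ ^ 2) (A ×ˢ B) := by
    refine i4.mono' (hm.norm.pow 2) ?_
    filter_upwards [hb] with x hx
    rwa [Real.norm_of_nonneg (by positivity)]
  refine ⟨(memLp_two_iff_integrable_sq_norm hm).2 i5, ?_⟩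
  refine (integral_mono_ae i5 i4 hb).trans (le_of_eq ?_)
  rw [setIntegral_prod' i4, setIntegral_prod' i2]
  simp

/-- The representation formula applied to the fibre average in the longitudinal direction. Unfolding
the average of `g` leaves a single integral over the rectangle against a bounded weight, which is
the form that weak convergence of `g` can handle. -/
theorem HasWeakDeriv.fiberAvg_eq {a' b' : ℝ} {ζ : ℝ → ℝ} (hab : b - a = 1)
    (h : HasWeakDeriv (Ioo a' b' ×ˢ Ioo a b) (1, 0) f g)
    (hf : IntegrableOn f (Ioo a' b' ×ˢ Ioo a b)) (hg : IntegrableOn g (Ioo a' b' ×ˢ Ioo a b))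
    (hη : ContDiff ℝ ∞ η) (hc : HasCompactSupport η) (hs : tsupport η ⊆ Ioo a b)
    (hζ : ContDiff ℝ ∞ ζ) (hζc : HasCompactSupport ζ) (hζs : tsupport ζ ⊆ Ioo a' b')
    (hζ0 : ∀ t, 0 ≤ ζ t) (hζ1 : ∫ t, ζ t = 1) :
    ∀ᵐ s ∂(volume.restrict (Ioo a' b')), Ribbon.fiberAvg (Ioo a b) η f s =
      (∫ t in Ioo a' b', ζ t • Ribbon.fiberAvg (Ioo a b) η f t) -
        ∫ z in Ioo a' b' ×ˢ Ioo a b, (avgKernel ζ s z.1 * η z.2) • g z := by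
  have := isProbabilityMeasure_Ioo hab
  set B := Ioo a b
  have j1 := integrableOn_fiberAvg hf hη.continuous hc
  have j2 := integrableOn_fiberAvg hg hη.continuous hc
  have k1 := ((h.fiberAvg hf hg hη hc hs).comp_fst (B := B) j1 j2).swap
    (integrable_comp_fst_prod j1) (integrable_comp_fst_prod j2)
  have hsw : ∀ k : ℝ → F, IntegrableOn k (Ioo a' b') →
      IntegrableOn (fun x : ℝ × ℝ => k x.2) (B ×ˢ Ioo a' b') := fun k hk => by
    rw [IntegrableOn, volume_restrict_prod]
    exact Integrable.comp_snd hk _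
  rw [preimage_swap_prod] at k1
  have k2 := k1.ae_eq_fiberAvg_sub isOpen_Ioo (hsw _ j1) (hsw _ j2) hζ hζc hζs hζ0 hζ1
  rw [volume_restrict_prod] at k2
  -- Nothing in the identity depends on the auxiliary transversal coordinate, so one generic value
  -- suffices.
  obtain ⟨r, hr⟩ := (Measure.ae_ae_of_ae_prod k2).exists
  filter_upwards [hr] with s hs'
  refine hs'.trans (congrArg₂ _ rfl ?_)
  have ib : IntegrableOn (fun z : ℝ × ℝ => (avgKernel ζ s z.1 * η z.2) • g z)
      (Ioo a' b' ×ˢ B) := by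
    obtain ⟨C, hC⟩ := hη.continuous.bounded_above_of_compact_support hc
    have iζ := hζ.continuous.integrable_of_hasCompactSupport hζc (μ := volume)
    refine Integrable.bdd_smul hg (1 * C) ?_ (ae_of_all _ fun z => ?_)
    · exact (((measurable_avgKernel iζ).comp (measurable_const.prodMk measurable_fst)).mul
        (hη.continuous.measurable.comp measurable_snd)).aestronglyMeasurable
    · rw [norm_mul]
      exact mul_le_mul (abs_avgKernel_le iζ hζ0 hζ1 _ _) (hC _) (norm_nonneg _) zero_le_one
  rw [setIntegral_prod' ib]
  congr 1 with t
  simp only [mul_smul, integral_smul]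
  rfl

end Poincare

/-! ### Compactness on strips of width one -/

section Compactness

variable {F : Type*} [NormedAddCommGroup F] [InnerProductSpace ℝ F] [FiniteDimensional ℝ F]
  [CompleteSpace F]

/-- Finite dimension enters here: in an orthonormal basis each component of the integral is an `L²`
pairing with `θ eᵢ`. -/
theorem TendstoWeakL2.tendsto_integral_smul {E : Type*} [NormedAddCommGroup E] [NormedSpace ℝ E]
    [MeasureSpace E] {Ω : Set E} [IsFiniteMeasure (volume.restrict Ω)] {f : ℕ → E → F}
    {f₀ : E → F} (hf : TendstoWeakL2 Ω f f₀) {θ : E → ℝ}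
    (hθ : AEStronglyMeasurable θ (volume.restrict Ω)) {C : ℝ} (hC : ∀ x, ‖θ x‖ ≤ C) :
    Tendsto (fun n => ∫ x in Ω, θ x • f n x) atTop (𝓝 (∫ x in Ω, θ x • f₀ x)) := by
  let e := stdOrthonormalBasis ℝ F
  have hi : ∀ k : E → F, MemLp k 2 (volume.restrict Ω) →
      ∫ x in Ω, θ x • k x = ∑ i, (∫ x in Ω, inner ℝ (k x) (θ x • e i)) • e i := fun k hk => by
    have ik : IntegrableOn (fun x => θ x • k x) Ω :=
      (hk.integrable (by norm_num)).bdd_smul C hθ (ae_of_all _ hC)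
    rw [← e.sum_repr' (∫ x in Ω, θ x • k x)]
    congr 1 with i
    rw [← _root_.integral_inner ik]
    simp [real_inner_smul_right, real_inner_smul_left, real_inner_comm]
  have hm : ∀ i, MemLp (fun x => θ x • e i) 2 (volume.restrict Ω) := fun i => by
    refine MemLp.of_bound (hθ.smul_const _) C (ae_of_all _ fun x => ?_)
    rw [norm_smul, e.norm_eq_one, mul_one]
    exact hC x
  rw [hi _ hf.2.1]
  simp only [fun n => hi _ (hf.1 n)]
  exact tendsto_finsetSum _ fun i _ => (hf.2.2 _ (hm i)).smul_const _

/-- Compactness on strips of width one: if the longitudinal derivatives are bounded in `L²` and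
the transversal ones tend to zero, then, up to constants, a subsequence converges strongly to a
function of the longitudinal variable. -/
theorem exists_subseq_tendstoL2_strip {a' b' a b : ℝ} (hab' : a' < b') (hab : b - a = 1)
    {f p q : ℕ → ℝ × ℝ → F}
    (hf : ∀ n, MemLp (f n) 2 (volume.restrict (Ioo a' b' ×ˢ Ioo a b)))
    (hp : ∀ n, MemLp (p n) 2 (volume.restrict (Ioo a' b' ×ˢ Ioo a b)))
    (hq : ∀ n, MemLp (q n) 2 (volume.restrict (Ioo a' b' ×ˢ Ioo a b)))
    (dp : ∀ n, HasWeakDeriv (Ioo a' b' ×ˢ Ioo a b) (1, 0) (f n) (p n))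
    (dq : ∀ n, HasWeakDeriv (Ioo a' b' ×ˢ Ioo a b) (0, 1) (f n) (q n)) {C : ℝ}
    (hC : ∀ n, ∫ x in Ioo a' b' ×ˢ Ioo a b, ‖p n x‖ ^ 2 ≤ C)
    (hq0 : Tendsto (fun n => ∫ x in Ioo a' b' ×ˢ Ioo a b, ‖q n x‖ ^ 2) atTop (𝓝 0)) :
    ∃ (σ : ℕ → ℕ) (c : ℕ → F) (f₀ g₀ : ℝ → F), StrictMono σ ∧
      HasWeakDeriv (Ioo a' b') 1 f₀ g₀ ∧
      MemLp f₀ 2 (volume.restrict (Ioo a' b')) ∧ MemLp g₀ 2 (volume.restrict (Ioo a' b')) ∧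
      TendstoL2 (volume.restrict (Ioo a' b' ×ˢ Ioo a b)) (fun n x => f (σ n) x - c n)
        (fun x => f₀ x.1) ∧
      TendstoWeakL2 (Ioo a' b' ×ˢ Ioo a b) (fun n => p (σ n)) (fun x => g₀ x.1) := by
  have := isProbabilityMeasure_Ioo hab
  set A := Ioo a' b' with hA
  set B := Ioo a b with hB
  have : IsFiniteMeasure (volume.restrict (A ×ˢ B)) := by
    rw [volume_restrict_prod]; infer_instance
  obtain ⟨η, hη, hηc, hηs, hη0, hη1⟩ := exists_weight (a := a) (b := b) (by linarith)
  obtain ⟨ζ, hζ, hζc, hζs, hζ0, hζ1⟩ := exists_weight hab'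
  have int1 : ∀ {k : ℝ × ℝ → F}, MemLp k 2 (volume.restrict (A ×ˢ B)) → IntegrableOn k (A ×ˢ B) :=
    fun hk => hk.integrable (by norm_num)
  obtain ⟨σ, G, hσ, hG⟩ := exists_subseq_tendstoWeakL2 hp hC
  have iζ := hζ.continuous.integrable_of_hasCompactSupport hζc (μ := volume)
  obtain ⟨Cη, hCη⟩ := hη.continuous.bounded_above_of_compact_support hηc
  have Cη0 : 0 ≤ Cη := (norm_nonneg _).trans (hCη 0)
  let θ : ℝ → ℝ × ℝ → ℝ := fun s z => avgKernel ζ s z.1 * η z.2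
  have mθ : ∀ s, AEStronglyMeasurable (θ s) (volume.restrict (A ×ˢ B)) := fun s =>
    (((measurable_avgKernel iζ).comp (measurable_const.prodMk measurable_fst)).mul
      (hη.continuous.measurable.comp measurable_snd)).aestronglyMeasurable
  have bθ : ∀ s z, ‖θ s z‖ ≤ Cη := fun s z => by
    rw [norm_mul]
    exact mul_le_of_le_one_left (norm_nonneg _) (abs_avgKernel_le iζ hζ0 hζ1 _ _) |>.trans (hCη _)
  let c : ℕ → F := fun n => ∫ t in A, ζ t • fiberAvg B η (f n) t
  let f₀ : ℝ → F := fun s => -∫ z in A ×ˢ B, θ s z • G z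
  have hav : ∀ n, ∀ᵐ s ∂(volume.restrict A), fiberAvg B η (f n) s - c n =
      -∫ z in A ×ˢ B, θ s z • p n z := fun n => by
    filter_upwards [(dp n).fiberAvg_eq hab (int1 (hf n)) (int1 (hp n)) hη hηc hηs hζ hζc hζs hζ0
      hζ1] with s hs
    rw [hs]
    simp only [c, θ]
    abel
  have hav' := fun n => ae_comp_fst_iff (B := B).2 (hav n)
  -- For fixed `x₁` the normalised average is an integral of `p` against a fixed bounded weight, so
  -- weak convergence gives pointwise convergence. Cauchy–Schwarz provides the constant dominating
  -- function.
  have T1 : TendstoL2 (volume.restrict (A ×ˢ B))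
      (fun n x => fiberAvg B η (f (σ n)) x.1 - c (σ n)) (fun x => f₀ x.1) := by
    refine tendstoL2_of_dominated (b := fun _ => Cη * Real.sqrt C *
      Real.sqrt (volume.real (A ×ˢ B))) (fun n => ?_) (memLp_const _) (fun n => ?_) ?_
    · exact ((integrable_comp_fst_prod (B := B)
        (integrableOn_fiberAvg (int1 (hf _)) hη.continuous hηc)).1).sub aestronglyMeasurable_const
    · filter_upwards [hav' (σ n)] with x hx
      rw [hx, norm_neg]
      have h1 : ‖∫ z in A ×ˢ B, θ x.1 z • p (σ n) z‖ ≤ ∫ z in A ×ˢ B, Cη * ‖p (σ n) z‖ := by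
        refine norm_integral_le_of_norm_le ((int1 (hp _)).norm.const_mul _)
          (ae_of_all _ fun z => ?_)
        rw [norm_smul]
        exact mul_le_mul_of_nonneg_right (bθ _ _) (norm_nonneg _)
      refine h1.trans ?_
      rw [integral_const_mul, mul_assoc]
      refine mul_le_mul_of_nonneg_left ?_ Cη0
      have h2 := abs_integral_inner_le (hp (σ n)).norm (memLp_const (1 : ℝ))
      have e : ∫ z in A ×ˢ B, inner ℝ ‖p (σ n) z‖ (1 : ℝ) = ∫ z in A ×ˢ B, ‖p (σ n) z‖ := by simp
      rw [e] at h2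
      refine (le_abs_self _).trans (h2.trans ?_)
      refine mul_le_mul (Real.sqrt_le_sqrt (by simpa using hC (σ n))) (le_of_eq (by simp))
        (Real.sqrt_nonneg _) (Real.sqrt_nonneg _)
    · filter_upwards [ae_all_iff.2 fun n => hav' (σ n)] with x hx
      simp only [hx]
      exact (hG.tendsto_integral_smul (mθ _) (bθ _)).neg
  -- The fibre oscillation is bounded by the transversal derivative, which tends to zero.
  have T2 : TendstoL2 (volume.restrict (A ×ˢ B))
      (fun n x => f (σ n) x - fiberAvg B η (f (σ n)) x.1) (fun _ => 0) := by
    have hPo := fun n => (dq (σ n)).integral_norm_sub_fiberAvg_sq_le isOpen_Ioo hab (int1 (hf _))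
      (int1 (hq _)) (hq _) hη hηc hηs hη0 hη1
    refine ⟨fun n => (hPo n).1, MemLp.zero, ?_⟩
    simp only [sub_zero]
    exact squeeze_zero (fun n => integral_nonneg fun x => by positivity) (fun n => (hPo n).2)
      (hq0.comp hσ.tendsto_atTop)
  have T : TendstoL2 (volume.restrict (A ×ˢ B)) (fun n x => f (σ n) x - c (σ n))
      (fun x => f₀ x.1) := by
    refine (T2.add T1).congr (fun n => ae_of_all _ fun x => ?_) (ae_of_all _ fun x => ?_) <;> simp
  have dW : HasWeakDeriv (A ×ˢ B) (1, 0) (fun x : ℝ × ℝ => f₀ x.1) G := by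
    refine HasWeakDeriv.of_tendstoWeakL2 T.weak hG fun n => ?_
    have := (dp (σ n)).add (hasWeakDeriv_const (Ω := A ×ˢ B) (1, 0) (-c (σ n)))
    refine this.congr (ae_of_all _ fun x => ?_) (ae_of_all _ fun x => ?_)
    · simp [sub_eq_add_neg]
    · simp
  -- Averaging over the fibres leaves `f₀` unchanged and yields a weak derivative on the interval.
  -- Uniqueness of weak derivatives then shows that `G` itself depends on `x₁` only.
  have d1 := dW.fiberAvg (int1 T.2.1) (int1 hG.2.1) hη hηc hηs
  have hη1' : ∫ t in B, η t = 1 := by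
    rw [← hη1]
    exact setIntegral_eq_integral_of_forall_compl_eq_zero fun t ht =>
      image_eq_zero_of_notMem_tsupport fun h => ht (hηs h)
  have e1 : fiberAvg B η (fun x : ℝ × ℝ => f₀ x.1) = f₀ := by
    ext1 s
    simp only [fiberAvg]
    rw [integral_smul_const, hη1', one_smul]
  rw [e1] at d1
  have sm : AEStronglyMeasurable f₀ (volume.restrict A) := d1.1.aestronglyMeasurable
  have sm' := d1.2.1.aestronglyMeasurable
  have m₀ := (memLp_comp_fst_iff (B := B) sm).1 T.2.1
  have iG := integrableOn_fiberAvg (int1 hG.2.1) hη.continuous hηc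
  have d2 := d1.comp_fst (B := B) (m₀.integrable (by norm_num)) iG
  have eG := dW.unique (isOpen_Ioo.prod isOpen_Ioo) d2
  refine ⟨σ, fun n => c (σ n), f₀, fiberAvg B η G, hσ, d1, m₀, ?_, T, ?_⟩
  · exact (memLp_comp_fst_iff (B := B) sm').1 (hG.2.1.ae_eq eG)
  · exact hG.congr (fun n => EventuallyEq.rfl) eG

/-- A uniform bound removes the constants. At one good point both `f` and `f - c` stay bounded,
hence so does `c`; a convergent subsequence of `c` is absorbed into the limit. -/
theorem exists_subseq_tendsto_strip_of_bounded {a' b' a b : ℝ} (hab' : a' < b') (hab : b - a = 1)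
    {f p q : ℕ → ℝ × ℝ → F} {M : ℝ}
    (hf : ∀ n, MemLp (f n) 2 (volume.restrict (Ioo a' b' ×ˢ Ioo a b)))
    (hfM : ∀ n, ∀ᵐ x ∂(volume.restrict (Ioo a' b' ×ˢ Ioo a b)), ‖f n x‖ ≤ M)
    (hp : ∀ n, MemLp (p n) 2 (volume.restrict (Ioo a' b' ×ˢ Ioo a b)))
    (hq : ∀ n, MemLp (q n) 2 (volume.restrict (Ioo a' b' ×ˢ Ioo a b)))
    (dp : ∀ n, HasWeakDeriv (Ioo a' b' ×ˢ Ioo a b) (1, 0) (f n) (p n))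
    (dq : ∀ n, HasWeakDeriv (Ioo a' b' ×ˢ Ioo a b) (0, 1) (f n) (q n)) {C : ℝ}
    (hC : ∀ n, ∫ x in Ioo a' b' ×ˢ Ioo a b, ‖p n x‖ ^ 2 ≤ C)
    (hq0 : Tendsto (fun n => ∫ x in Ioo a' b' ×ˢ Ioo a b, ‖q n x‖ ^ 2) atTop (𝓝 0)) :
    ∃ (σ : ℕ → ℕ) (f₀ g₀ : ℝ → F), StrictMono σ ∧ HasWeakDeriv (Ioo a' b') 1 f₀ g₀ ∧
      MemLp f₀ 2 (volume.restrict (Ioo a' b')) ∧ MemLp g₀ 2 (volume.restrict (Ioo a' b')) ∧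
      TendstoL2 (volume.restrict (Ioo a' b' ×ˢ Ioo a b)) (fun n => f (σ n)) (fun x => f₀ x.1) ∧
      (∀ᵐ x ∂(volume.restrict (Ioo a' b' ×ˢ Ioo a b)),
        Tendsto (fun n => f (σ n) x) atTop (𝓝 (f₀ x.1))) ∧
      TendstoWeakL2 (Ioo a' b' ×ˢ Ioo a b) (fun n => p (σ n)) (fun x => g₀ x.1) := by
  obtain ⟨σ, c, f₀, g₀, hσ, hd, hf₀, hg₀, hT, hW⟩ :=
    exists_subseq_tendstoL2_strip hab' hab hf hp hq dp dq hC hq0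
  obtain ⟨τ, hτ, hae⟩ := hT.ae_subseq
  have := isProbabilityMeasure_Ioo hab
  have : IsFiniteMeasure (volume.restrict (Ioo a' b' ×ˢ Ioo a b)) := by
    rw [volume_restrict_prod]; infer_instance
  -- The rectangle has positive measure, so almost every property holds at some point.
  have : NeBot (ae (volume.restrict (Ioo a' b' ×ˢ Ioo a b))) := by
    rw [ae_neBot, Ne, Measure.restrict_eq_zero, Measure.volume_eq_prod, Measure.prod_prod]
    simp [hab, hab']
  obtain ⟨x, hx1, hx2⟩ := (hae.and (ae_all_iff.2 hfM)).exists
  obtain ⟨R, hR⟩ := hx1.norm.bddAbove_range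
  have hcb : ∀ n, c (τ n) ∈ Metric.closedBall (0 : F) (M + R) := fun n => by
    rw [mem_closedBall_zero_iff]
    have e : c (τ n) = f (σ (τ n)) x - (f (σ (τ n)) x - c (τ n)) := by abel
    rw [e]
    exact (norm_sub_le _ _).trans (add_le_add (hx2 _) (hR ⟨n, rfl⟩))
  obtain ⟨c₀, -, ρ, hρ, hc⟩ := tendsto_subseq_of_bounded Metric.isBounded_closedBall hcb
  have hστ := hσ.comp (hτ.comp hρ)
  have hcl2 : TendstoL2 (volume.restrict (Ioo a' b' ×ˢ Ioo a b))
      (fun n _ => c (τ (ρ n))) (fun _ => c₀) := by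
    obtain ⟨K, hK⟩ := hc.norm.bddAbove_range
    exact tendstoL2_of_dominated (b := fun _ => K) (fun n => aestronglyMeasurable_const)
      (memLp_const K) (fun n => ae_of_all _ fun x => hK ⟨n, rfl⟩) (ae_of_all _ fun x => hc)
  have hd' := hd.add (hasWeakDeriv_const (Ω := Ioo a' b') 1 c₀)
  refine ⟨σ ∘ (τ ∘ ρ), fun s => f₀ s + c₀, g₀, hστ, ?_, hf₀.add (memLp_const c₀), hg₀, ?_, ?_,
    hW.comp (hτ.comp hρ)⟩
  · refine hd'.congr EventuallyEq.rfl (ae_of_all _ fun s => ?_)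
    simp
  · refine ((hT.comp (hτ.comp hρ)).add hcl2).congr (fun n => ae_of_all _ fun x => ?_)
      EventuallyEq.rfl
    simp
  · filter_upwards [hae] with x hx
    refine ((hx.comp hρ.tendsto_atTop).add hc).congr fun n => ?_
    simp

end Compactness

/-! ### Operations on Sobolev functions and on weak Sobolev convergence -/

section SobolevSpaces

variable {E F : Type*} [NormedAddCommGroup E] [NormedSpace ℝ E] [MeasureSpace E] [BorelSpace E]
  [FiniteDimensional ℝ E] [NormedAddCommGroup F] [InnerProductSpace ℝ F] [CompleteSpace F]
  {Ω : Set E}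

theorem MemSobolev.memLp {k : ℕ} {f : E → F} (h : MemSobolev Ω k f) :
    MemLp f 2 (volume.restrict Ω) := by
  cases k with
  | zero => exact h
  | succ k => exact h.1

theorem MemSobolev.congr {k : ℕ} {f f' : E → F} (h : MemSobolev Ω k f)
    (hf : f =ᵐ[volume.restrict Ω] f') : MemSobolev Ω k f' := by
  cases k with
  | zero => exact MemLp.ae_eq hf h
  | succ k =>
    refine ⟨h.1.ae_eq hf, fun v => ?_⟩
    obtain ⟨g, hg, hk⟩ := h.2 v
    exact ⟨g, hg.congr hf EventuallyEq.rfl, hk⟩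

theorem MemSobolev.add {k : ℕ} {f f' : E → F} (h : MemSobolev Ω k f) (h' : MemSobolev Ω k f') :
    MemSobolev Ω k (fun x => f x + f' x) := by
  induction k generalizing f f' with
  | zero => exact MemLp.add h h'
  | succ k ih =>
    refine ⟨h.1.add h'.1, fun v => ?_⟩
    obtain ⟨g, hg, hk⟩ := h.2 v
    obtain ⟨g', hg', hk'⟩ := h'.2 v
    exact ⟨_, hg.add hg', ih hk hk'⟩

theorem MemSobolev.const_smul {k : ℕ} {f : E → F} (h : MemSobolev Ω k f) (c : ℝ) :
    MemSobolev Ω k (fun x => c • f x) := by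
  induction k generalizing f with
  | zero => exact MemLp.const_smul h c
  | succ k ih =>
    refine ⟨h.1.const_smul c, fun v => ?_⟩
    obtain ⟨g, hg, hk⟩ := h.2 v
    exact ⟨_, hg.const_smul c, ih hk⟩

theorem MemSobolev.hasWeakDeriv {k : ℕ} {f : E → F} (h : MemSobolev Ω (k + 1) f) (v : E) :
    HasWeakDeriv Ω v f (weakDeriv Ω v f) := by
  obtain ⟨g, hg, -⟩ := h.2 v
  exact hasWeakDeriv_weakDeriv hg

theorem MemSobolev.weakDeriv (hΩ : IsOpen Ω) {k : ℕ} {f : E → F} (h : MemSobolev Ω (k + 1) f)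
    (v : E) : MemSobolev Ω k (weakDeriv Ω v f) := by
  obtain ⟨g, hg, hk⟩ := h.2 v
  exact hk.congr (hg.ae_eq_weakDeriv hΩ)

theorem TendstoWeakSobolev.memSobolev {k : ℕ} {f : ℕ → E → F} {f₀ : E → F}
    (h : TendstoWeakSobolev Ω k f f₀) : (∀ n, MemSobolev Ω k (f n)) ∧ MemSobolev Ω k f₀ := by
  cases k with
  | zero => exact ⟨h.1, h.2.1⟩
  | succ k => exact ⟨h.1, h.2.1⟩

/-- As `weakDeriv` is a chosen representative, every operation on weak Sobolev convergence has to be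
transferred to it along almost everywhere equality. -/
theorem TendstoWeakSobolev.congr (hΩ : IsOpen Ω) {k : ℕ} {f f' : ℕ → E → F} {f₀ f₀' : E → F}
    (h : TendstoWeakSobolev Ω k f f₀) (hf : ∀ n, f n =ᵐ[volume.restrict Ω] f' n)
    (hf₀ : f₀ =ᵐ[volume.restrict Ω] f₀') : TendstoWeakSobolev Ω k f' f₀' := by
  induction k generalizing f f' f₀ f₀' with
  | zero => exact TendstoWeakL2.congr h hf hf₀
  | succ k ih =>
    refine ⟨fun n => (h.1 n).congr (hf n), h.2.1.congr hf₀, h.2.2.1.congr hf hf₀, fun v => ?_⟩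
    refine ih (h.2.2.2 v) (fun n => ?_) ?_
    · exact (((h.1 n).hasWeakDeriv v).congr (hf n) EventuallyEq.rfl).ae_eq_weakDeriv hΩ
    · exact ((h.2.1.hasWeakDeriv v).congr hf₀ EventuallyEq.rfl).ae_eq_weakDeriv hΩ

theorem TendstoWeakSobolev.add (hΩ : IsOpen Ω) {k : ℕ} {f f' : ℕ → E → F} {f₀ f₀' : E → F}
    (h : TendstoWeakSobolev Ω k f f₀) (h' : TendstoWeakSobolev Ω k f' f₀') :
    TendstoWeakSobolev Ω k (fun n x => f n x + f' n x) (fun x => f₀ x + f₀' x) := by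
  induction k generalizing f f' f₀ f₀' with
  | zero => exact TendstoWeakL2.add h h'
  | succ k ih =>
    refine ⟨fun n => (h.1 n).add (h'.1 n), h.2.1.add h'.2.1, h.2.2.1.add h'.2.2.1, fun v => ?_⟩
    refine (ih (h.2.2.2 v) (h'.2.2.2 v)).congr hΩ (fun n => ?_) ?_
    · exact (((h.1 n).hasWeakDeriv v).add ((h'.1 n).hasWeakDeriv v)).ae_eq_weakDeriv hΩ
    · exact ((h.2.1.hasWeakDeriv v).add (h'.2.1.hasWeakDeriv v)).ae_eq_weakDeriv hΩ

theorem TendstoWeakSobolev.const_smul (hΩ : IsOpen Ω) {k : ℕ} {f : ℕ → E → F} {f₀ : E → F}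
    (h : TendstoWeakSobolev Ω k f f₀) (c : ℝ) :
    TendstoWeakSobolev Ω k (fun n x => c • f n x) (fun x => c • f₀ x) := by
  induction k generalizing f f₀ with
  | zero => exact TendstoWeakL2.const_smul h c
  | succ k ih =>
    refine ⟨fun n => (h.1 n).const_smul c, h.2.1.const_smul c, h.2.2.1.const_smul c, fun v => ?_⟩
    refine (ih (h.2.2.2 v)).congr hΩ (fun n => ?_) ?_
    · exact (((h.1 n).hasWeakDeriv v).const_smul c).ae_eq_weakDeriv hΩ
    · exact ((h.2.1.hasWeakDeriv v).const_smul c).ae_eq_weakDeriv hΩ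

end SobolevSpaces

section Plane

variable {F : Type*} [NormedAddCommGroup F] [InnerProductSpace ℝ F] [CompleteSpace F]
  {Ω : Set (ℝ × ℝ)}

/-- The Sobolev definitions quantify over all directions; linearity in the direction reduces them to
the two coordinate ones. -/
theorem HasWeakDeriv.of_partials {f g₁ g₂ : ℝ × ℝ → F} (h₁ : HasWeakDeriv Ω (1, 0) f g₁)
    (h₂ : HasWeakDeriv Ω (0, 1) f g₂) (v : ℝ × ℝ) :
    HasWeakDeriv Ω v f (fun x => v.1 • g₁ x + v.2 • g₂ x) := by
  have := (h₁.smul_dir v.1).add_dir (h₂.smul_dir v.2)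
  simpa using this

theorem MemSobolev.of_partials {k : ℕ} {f g₁ g₂ : ℝ × ℝ → F} (hf : MemLp f 2 (volume.restrict Ω))
    (h₁ : HasWeakDeriv Ω (1, 0) f g₁) (h₂ : HasWeakDeriv Ω (0, 1) f g₂)
    (m₁ : MemSobolev Ω k g₁) (m₂ : MemSobolev Ω k g₂) : MemSobolev Ω (k + 1) f :=
  ⟨hf, fun v => ⟨_, h₁.of_partials h₂ v, (m₁.const_smul v.1).add (m₂.const_smul v.2)⟩⟩

/-- Weak convergence in a Sobolev space on the plane can be checked on the partial derivatives. -/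
theorem TendstoWeakSobolev.of_partials (hΩ : IsOpen Ω) {k : ℕ} {f g₁ g₂ : ℕ → ℝ × ℝ → F}
    {f₀ g₁₀ g₂₀ : ℝ × ℝ → F} (hf : TendstoWeakL2 Ω f f₀)
    (h₁ : ∀ n, HasWeakDeriv Ω (1, 0) (f n) (g₁ n)) (h₂ : ∀ n, HasWeakDeriv Ω (0, 1) (f n) (g₂ n))
    (h₁₀ : HasWeakDeriv Ω (1, 0) f₀ g₁₀) (h₂₀ : HasWeakDeriv Ω (0, 1) f₀ g₂₀)
    (t₁ : TendstoWeakSobolev Ω k g₁ g₁₀) (t₂ : TendstoWeakSobolev Ω k g₂ g₂₀) :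
    TendstoWeakSobolev Ω (k + 1) f f₀ := by
  refine ⟨fun n => ?_, ?_, hf, fun v => ?_⟩
  · exact MemSobolev.of_partials (hf.1 n) (h₁ n) (h₂ n) (t₁.memSobolev.1 n) (t₂.memSobolev.1 n)
  · exact MemSobolev.of_partials hf.2.1 h₁₀ h₂₀ t₁.memSobolev.2 t₂.memSobolev.2
  · refine ((t₁.const_smul hΩ v.1).add hΩ (t₂.const_smul hΩ v.2)).congr hΩ (fun n => ?_) ?_
    · exact ((h₁ n).of_partials (h₂ n) v).ae_eq_weakDeriv hΩ
    · exact (h₁₀.of_partials h₂₀ v).ae_eq_weakDeriv hΩ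

end Plane

section Line

variable {F : Type*} [NormedAddCommGroup F] [InnerProductSpace ℝ F] {I : Set ℝ}

theorem MemSobolev.of_deriv {k : ℕ} {f g : ℝ → F} (hf : MemLp f 2 (volume.restrict I))
    (h : HasWeakDeriv I 1 f g) (hg : MemSobolev I k g) [CompleteSpace F] :
    MemSobolev I (k + 1) f :=
  ⟨hf, fun v => ⟨fun x => v • g x, by simpa using h.smul_dir v, hg.const_smul v⟩⟩

end Line

/-! ### Product rules for vector fields, and the cross product -/

section Products

variable {E : Type*} [NormedAddCommGroup E] [NormedSpace ℝ E] [MeasureSpace E] [BorelSpace E]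
  [FiniteDimensional ℝ E] [(volume : Measure E).IsAddHaarMeasure] {Ω : Set E} {v : E}

theorem memLp_bdd_mul {α : Type*} [MeasurableSpace α] {μ : Measure α} {f g : α → ℝ}
    (hf : AEStronglyMeasurable f μ) {M : ℝ} (hM : ∀ᵐ x ∂μ, |f x| ≤ M) (hg : MemLp g 2 μ) :
    MemLp (fun x => f x * g x) 2 μ := by
  refine hg.of_le_mul (c := M) (hf.mul hg.1) ?_
  filter_upwards [hM] with x hx
  rw [norm_mul]
  exact mul_le_mul_of_nonneg_right hx (norm_nonneg _)

theorem HasWeakDeriv.coord {f f' : E → R3} (h : HasWeakDeriv Ω v f f') (i : Fin 3) :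
    HasWeakDeriv Ω v (fun x => f x i) (fun x => f' x i) := by
  have := h.inner_const (EuclideanSpace.single i (1 : ℝ))
  simpa [EuclideanSpace.inner_single_left] using this

theorem abs_coord_le (x : R3) (i : Fin 3) : |x i| ≤ ‖x‖ := by
  simpa using PiLp.norm_apply_le x i

theorem memLp_coord {α : Type*} [MeasurableSpace α] {μ : Measure α} {f : α → R3}
    (hf : MemLp f 2 μ) (i : Fin 3) : MemLp (fun x => f x i) 2 μ := by
  have := hf.const_inner (𝕜 := ℝ) (EuclideanSpace.single i (1 : ℝ))
  simpa [EuclideanSpace.inner_single_left] using this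

theorem HasWeakDeriv.coord_mul (hΩ : IsOpen Ω) [IsFiniteMeasure (volume.restrict Ω)]
    {f f' g g' : E → R3} (hf : HasWeakDeriv Ω v f f')
    (hg : HasWeakDeriv Ω v g g') (hf' : MemLp f' 2 (volume.restrict Ω)) {M : ℝ}
    (hfM : ∀ᵐ x ∂(volume.restrict Ω), ‖f x‖ ≤ M) (hgM : ∀ᵐ x ∂(volume.restrict Ω), ‖g x‖ ≤ M)
    (i j : Fin 3) :
    HasWeakDeriv Ω v (fun x => f x i * g x j) (fun x => f' x i * g x j + f x i * g' x j) := by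
  refine (hf.coord i).mul hΩ (hg.coord j) ((memLp_coord hf' i).integrable (by norm_num)) (M := M)
    ?_ ?_
  · filter_upwards [hfM] with x hx using (abs_coord_le _ _).trans hx
  · filter_upwards [hgM] with x hx using (abs_coord_le _ _).trans hx

theorem HasWeakDeriv.inner_product (hΩ : IsOpen Ω) [IsFiniteMeasure (volume.restrict Ω)]
    {f f' g g' : E → R3} (hf : HasWeakDeriv Ω v f f')
    (hg : HasWeakDeriv Ω v g g') (hf' : MemLp f' 2 (volume.restrict Ω)) {M : ℝ}
    (hfM : ∀ᵐ x ∂(volume.restrict Ω), ‖f x‖ ≤ M) (hgM : ∀ᵐ x ∂(volume.restrict Ω), ‖g x‖ ≤ M) :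
    HasWeakDeriv Ω v (fun x => inner ℝ (f x) (g x))
      (fun x => inner ℝ (f' x) (g x) + inner ℝ (f x) (g' x)) := by
  have h := hf.coord_mul hΩ hg hf' hfM hgM
  refine (((h 0 0).add (h 1 1)).add (h 2 2)).congr (ae_of_all _ fun x => ?_)
    (ae_of_all _ fun x => ?_)
  · simp [PiLp.inner_apply, Fin.sum_univ_three, mul_comm]
  · simp [PiLp.inner_apply, Fin.sum_univ_three]
    ring

/-- If the inner product of two bounded fields is constant, its formal derivative vanishes. -/
theorem HasWeakDeriv.inner_eq_zero (hΩ : IsOpen Ω) [IsFiniteMeasure (volume.restrict Ω)]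
    {f f' g g' : E → R3} (hf : HasWeakDeriv Ω v f f')
    (hg : HasWeakDeriv Ω v g g') (hf' : MemLp f' 2 (volume.restrict Ω)) {M : ℝ}
    (hfM : ∀ᵐ x ∂(volume.restrict Ω), ‖f x‖ ≤ M) (hgM : ∀ᵐ x ∂(volume.restrict Ω), ‖g x‖ ≤ M)
    {c : ℝ} (hc : ∀ᵐ x ∂(volume.restrict Ω), inner ℝ (f x) (g x) = c) :
    ∀ᵐ x ∂(volume.restrict Ω), inner ℝ (f' x) (g x) + inner ℝ (f x) (g' x) = 0 :=
  ((hf.inner_product hΩ hg hf' hfM hgM).congr hc EventuallyEq.rfl).unique hΩ (hasWeakDeriv_const v c)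

theorem HasWeakDeriv.smul_const {f f' : E → ℝ} (h : HasWeakDeriv Ω v f f') (c : R3) :
    HasWeakDeriv Ω v (fun x => f x • c) (fun x => f' x • c) := by
  have hl : ∀ k : E → ℝ, LocallyIntegrableOn k Ω →
      LocallyIntegrableOn (fun x => k x • c) Ω := fun k hk x hx => by
    obtain ⟨s, hs, hi⟩ := hk x hx
    exact ⟨s, hs, Integrable.smul_const hi c⟩
  refine ⟨hl f h.1, hl f' h.2.1, fun φ h1 h2 h3 => ?_⟩
  have key := h.2.2 φ h1 h2 h3
  simp only [smul_eq_mul] at key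
  simp only [smul_smul, integral_smul_const]
  rw [key, neg_smul]

end Products

section CrossProduct

theorem cross_zero (a b : R3) : cross a b 0 = a 1 * b 2 - a 2 * b 1 := by
  simp [cross, crossProduct]

theorem cross_one (a b : R3) : cross a b 1 = a 2 * b 0 - a 0 * b 2 := by
  simp [cross, crossProduct]

theorem cross_two (a b : R3) : cross a b 2 = a 0 * b 1 - a 1 * b 0 := by
  simp [cross, crossProduct]

theorem inner_coord (a b : R3) : inner ℝ a b = a 0 * b 0 + a 1 * b 1 + a 2 * b 2 := by
  simp [PiLp.inner_apply, Fin.sum_univ_three, mul_comm]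

theorem inner_cross_left (a b : R3) : inner ℝ a (cross a b) = 0 := by
  rw [inner_coord, cross_zero, cross_one, cross_two]
  ring

theorem inner_cross_right (a b : R3) : inner ℝ b (cross a b) = 0 := by
  rw [inner_coord, cross_zero, cross_one, cross_two]
  ring

theorem norm_cross_sq (a b : R3) :
    ‖cross a b‖ ^ 2 = ‖a‖ ^ 2 * ‖b‖ ^ 2 - (inner ℝ a b) ^ 2 := by
  simp only [← real_inner_self_eq_norm_sq, inner_coord, cross_zero, cross_one, cross_two]
  ring

theorem norm_cross_eq_one {a b : R3} (ha : ‖a‖ = 1) (hb : ‖b‖ = 1) (hab : inner ℝ a b = 0) :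
    ‖cross a b‖ = 1 := by
  have := norm_cross_sq a b
  rw [ha, hb, hab] at this
  nlinarith [norm_nonneg (cross a b)]

theorem continuous_cross : Continuous fun p : R3 × R3 => cross p.1 p.2 := by
  have h : ∀ i : Fin 3, Continuous fun x : R3 => x i := fun i => by fun_prop
  rw [← (EuclideanSpace.equiv (Fin 3) ℝ).comp_continuous_iff]
  refine continuous_pi fun i => ?_
  fin_cases i
  · refine (((((h 1).comp continuous_fst).mul ((h 2).comp continuous_snd)).sub
      (((h 2).comp continuous_fst).mul ((h 1).comp continuous_snd)))).congr fun p => ?_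
    exact (cross_zero _ _).symm
  · refine (((((h 2).comp continuous_fst).mul ((h 0).comp continuous_snd)).sub
      (((h 0).comp continuous_fst).mul ((h 2).comp continuous_snd)))).congr fun p => ?_
    exact (cross_one _ _).symm
  · refine (((((h 0).comp continuous_fst).mul ((h 1).comp continuous_snd)).sub
      (((h 1).comp continuous_fst).mul ((h 0).comp continuous_snd)))).congr fun p => ?_
    exact (cross_two _ _).symm

/-- The vectors `a`, `b`, `a ∧ b` form an orthonormal basis, and Parseval's identity leaves only the
normal coefficient of `x`. -/
theorem norm_sq_eq_of_perp {a b x : R3} (ha : ‖a‖ = 1) (hb : ‖b‖ = 1) (hab : inner ℝ a b = 0)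
    (hxa : inner ℝ x a = 0) (hxb : inner ℝ x b = 0) :
    ‖x‖ ^ 2 = (inner ℝ (cross a b) x) ^ 2 := by
  have ho : Orthonormal ℝ ![a, b, cross a b] := by
    have hn := norm_cross_eq_one ha hb hab
    have h1 := inner_cross_left a b
    have h2 := inner_cross_right a b
    refine ⟨fun i => by fin_cases i <;> simp [ha, hb, hn], fun i j hij => ?_⟩
    fin_cases i <;> fin_cases j <;>
      first
        | exact absurd rfl hij
        | simp [hab, h1, h2, real_inner_comm]
  let B := basisOfOrthonormalOfCardEqFinrank ho (by simp)
  have hB : (B : Fin 3 → R3) = ![a, b, cross a b] := coe_basisOfOrthonormalOfCardEqFinrank ho (by simp)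
  let OB := B.toOrthonormalBasis (by rw [hB]; exact ho)
  have := OB.sum_sq_norm_inner_right x
  rw [← this, Fin.sum_univ_three]
  have e : ∀ i, OB i = ![a, b, cross a b] i := fun i => by
    simp [OB, hB]
  rw [e, e, e]
  simp [real_inner_comm x, hxa, hxb]

end CrossProduct

/-! ### Second derivatives of scaled isometries -/

section Isometry

variable {ℓ ε : ℝ} {y : ℝ × ℝ → R3}

theorem isOpen_strip (ℓ : ℝ) : IsOpen (strip ℓ) := isOpen_Ioo.prod isOpen_Ioo

instance isFiniteMeasure_interval (ℓ : ℝ) : IsFiniteMeasure (volume.restrict (interval ℓ)) :=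
  inferInstanceAs (IsFiniteMeasure (volume.restrict (Ioo (-ℓ / 2) (ℓ / 2))))

instance isFiniteMeasure_strip (ℓ : ℝ) : IsFiniteMeasure (volume.restrict (strip ℓ)) := by
  rw [strip, volume_restrict_prod]
  infer_instance

theorem IsScaledIsometry.deriv_one (hy : IsScaledIsometry ℓ ε y) :
    HasWeakDeriv (strip ℓ) (1, 0) y (pd1 ℓ y) :=
  hy.1.hasWeakDeriv (1, 0)

theorem IsScaledIsometry.deriv_two (hy : IsScaledIsometry ℓ ε y) :
    HasWeakDeriv (strip ℓ) (0, 1) y (pd2 ℓ y) :=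
  hy.1.hasWeakDeriv (0, 1)

theorem IsScaledIsometry.memSobolev_pd1 (hy : IsScaledIsometry ℓ ε y) :
    MemSobolev (strip ℓ) 1 (pd1 ℓ y) :=
  MemSobolev.weakDeriv (isOpen_strip ℓ) hy.1 (1, 0)

theorem IsScaledIsometry.memSobolev_pd2 (hy : IsScaledIsometry ℓ ε y) :
    MemSobolev (strip ℓ) 1 (pd2 ℓ y) :=
  MemSobolev.weakDeriv (isOpen_strip ℓ) hy.1 (0, 1)

theorem MemSobolev.memLp_pd1 (hy : MemSobolev (strip ℓ) 1 y) :
    MemLp (pd1 ℓ y) 2 (volume.restrict (strip ℓ)) :=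
  MemSobolev.weakDeriv (isOpen_strip ℓ) hy (1, 0)

theorem MemSobolev.memLp_pd2 (hy : MemSobolev (strip ℓ) 1 y) :
    MemLp (pd2 ℓ y) 2 (volume.restrict (strip ℓ)) :=
  MemSobolev.weakDeriv (isOpen_strip ℓ) hy (0, 1)

/-- The second derivatives of a scaled isometry are determined by its second fundamental form. -/
theorem IsScaledIsometry.ae_structure (hε : 0 < ε) (hy : IsScaledIsometry ℓ ε y) :
    ∀ᵐ x ∂(volume.restrict (strip ℓ)),
      ‖pd1 ℓ y x‖ = 1 ∧ ‖ε⁻¹ • pd2 ℓ y x‖ = 1 ∧ inner ℝ (pd1 ℓ y x) (ε⁻¹ • pd2 ℓ y x) = 0 ∧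
      pd2 ℓ (pd1 ℓ y) x = pd1 ℓ (pd2 ℓ y) x ∧
      inner ℝ (ε⁻¹ • pd2 ℓ y x) (pd1 ℓ (pd1 ℓ y) x) = 0 ∧
      ‖pd1 ℓ (pd1 ℓ y) x‖ ^ 2 = (secondForm ℓ ε y x 0 0) ^ 2 ∧
      ‖pd1 ℓ (pd2 ℓ y) x‖ ^ 2 = ε ^ 2 * (secondForm ℓ ε y x 0 1) ^ 2 ∧
      ‖pd2 ℓ (pd2 ℓ y) x‖ ^ 2 = ε ^ 4 * (secondForm ℓ ε y x 1 1) ^ 2 := by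
  have hΩ := isOpen_strip ℓ
  have s1 := hy.memSobolev_pd1
  have s2 := hy.memSobolev_pd2
  have d11 : HasWeakDeriv (strip ℓ) (1, 0) (pd1 ℓ y) (pd1 ℓ (pd1 ℓ y)) := s1.hasWeakDeriv (1, 0)
  have d12 : HasWeakDeriv (strip ℓ) (0, 1) (pd1 ℓ y) (pd2 ℓ (pd1 ℓ y)) := s1.hasWeakDeriv (0, 1)
  have d21 : HasWeakDeriv (strip ℓ) (1, 0) (pd2 ℓ y) (pd1 ℓ (pd2 ℓ y)) := s2.hasWeakDeriv (1, 0)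
  have d22 : HasWeakDeriv (strip ℓ) (0, 1) (pd2 ℓ y) (pd2 ℓ (pd2 ℓ y)) := s2.hasWeakDeriv (0, 1)
  have hcomm := HasWeakDeriv.comm hΩ hy.deriv_one hy.deriv_two d12 d21
  have nz : ∀ x, ‖ε⁻¹ • pd2 ℓ y x‖ = 1 → ‖pd2 ℓ y x‖ = ε := fun x hx => by
    rw [norm_smul, Real.norm_of_nonneg (by positivity)] at hx
    field_simp at hx
    exact hx
  -- The product rule asks for one bound valid for both factors, hence the maximum of `1` and `ε`.
  have b1 : ∀ᵐ x ∂(volume.restrict (strip ℓ)), ‖pd1 ℓ y x‖ ≤ max 1 ε := by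
    filter_upwards [hy.2] with x hx using hx.1.le.trans (le_max_left _ _)
  have b2 : ∀ᵐ x ∂(volume.restrict (strip ℓ)), ‖pd2 ℓ y x‖ ≤ max 1 ε := by
    filter_upwards [hy.2] with x hx using (nz x hx.2.1).le.trans (le_max_right _ _)
  have c1 : ∀ᵐ x ∂(volume.restrict (strip ℓ)), inner ℝ (pd1 ℓ y x) (pd1 ℓ y x) = 1 := by
    filter_upwards [hy.2] with x hx
    rw [real_inner_self_eq_norm_sq, hx.1, one_pow]
  have c2 : ∀ᵐ x ∂(volume.restrict (strip ℓ)), inner ℝ (pd2 ℓ y x) (pd2 ℓ y x) = ε ^ 2 := by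
    filter_upwards [hy.2] with x hx
    rw [real_inner_self_eq_norm_sq, nz x hx.2.1]
  have c3 : ∀ᵐ x ∂(volume.restrict (strip ℓ)), inner ℝ (pd1 ℓ y x) (pd2 ℓ y x) = 0 := by
    filter_upwards [hy.2] with x hx using hx.2.2
  -- The three constraints, each differentiated in both directions, give six identities. With
  -- equality of mixed derivatives they annihilate all six tangential components of the second
  -- derivatives.
  filter_upwards [hy.2, hcomm, d11.inner_eq_zero hΩ d11 s1.memLp_pd1 b1 b1 c1,
    d12.inner_eq_zero hΩ d12 s1.memLp_pd2 b1 b1 c1,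
    d21.inner_eq_zero hΩ d21 s2.memLp_pd1 b2 b2 c2,
    d22.inner_eq_zero hΩ d22 s2.memLp_pd2 b2 b2 c2,
    d11.inner_eq_zero hΩ d21 s1.memLp_pd1 b1 b2 c3,
    d12.inner_eq_zero hΩ d22 s1.memLp_pd2 b1 b2 c3] with x hx hc e1 e2 e3 e4 e5 e6
  rw [hc] at e2 e6
  rw [real_inner_comm] at e1 e2 e3 e4
  have f1 : inner ℝ (pd1 ℓ (pd1 ℓ y) x) (pd1 ℓ y x) = 0 := by
    rw [real_inner_comm]; linarith
  have f2 : inner ℝ (pd1 ℓ (pd2 ℓ y) x) (pd1 ℓ y x) = 0 := by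
    rw [real_inner_comm]; linarith
  have f3 : inner ℝ (pd1 ℓ (pd2 ℓ y) x) (pd2 ℓ y x) = 0 := by
    rw [real_inner_comm]; linarith
  have f4 : inner ℝ (pd2 ℓ (pd2 ℓ y) x) (pd2 ℓ y x) = 0 := by
    rw [real_inner_comm]; linarith
  -- The `x₁`-derivative of orthogonality, whose other term vanishes by the `x₂`-derivative of
  -- `|∂₁y| = 1`. In the same way `f6` combines the `x₂`-derivative of orthogonality with the
  -- `x₁`-derivative of `|∂₂y| = ε`.
  have f5 : inner ℝ (pd1 ℓ (pd1 ℓ y) x) (pd2 ℓ y x) = 0 := by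
    rw [real_inner_comm (pd1 ℓ (pd2 ℓ y) x)] at e5; linarith
  have f6 : inner ℝ (pd2 ℓ (pd2 ℓ y) x) (pd1 ℓ y x) = 0 := by
    rw [real_inner_comm]; linarith
  have ho : inner ℝ (pd1 ℓ y x) (ε⁻¹ • pd2 ℓ y x) = 0 := by
    rw [real_inner_smul_right, hx.2.2, mul_zero]
  have hw : ∀ v : R3, inner ℝ v (pd2 ℓ y x) = 0 → inner ℝ v (ε⁻¹ • pd2 ℓ y x) = 0 :=
    fun v hv => by rw [real_inner_smul_right, hv, mul_zero]
  refine ⟨hx.1, hx.2.1, ho, hc, ?_, ?_, ?_, ?_⟩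
  · rw [real_inner_comm]
    exact hw _ f5
  · exact norm_sq_eq_of_perp hx.1 hx.2.1 ho f1 (hw _ f5)
  · rw [norm_sq_eq_of_perp hx.1 hx.2.1 ho f2 (hw _ f3)]
    simp only [secondForm, scaledNormal, Matrix.of_apply, Matrix.cons_val_zero, Matrix.cons_val_one]
    field_simp
  · rw [norm_sq_eq_of_perp hx.1 hx.2.1 ho f6 (hw _ f4)]
    simp only [secondForm, scaledNormal, Matrix.of_apply, Matrix.cons_val_zero, Matrix.cons_val_one]
    field_simp

theorem aestronglyMeasurable_cross {α : Type*} [MeasurableSpace α] {μ : Measure α} {f g : α → R3}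
    (hf : AEStronglyMeasurable f μ) (hg : AEStronglyMeasurable g μ) :
    AEStronglyMeasurable (fun x => cross (f x) (g x)) μ :=
  continuous_cross.comp_aestronglyMeasurable (hf.prodMk hg)

theorem IsScaledIsometry.aestronglyMeasurable_scaledNormal (hy : IsScaledIsometry ℓ ε y) :
    AEStronglyMeasurable (scaledNormal ℓ ε y) (volume.restrict (strip ℓ)) :=
  aestronglyMeasurable_cross hy.memSobolev_pd1.memLp.1 (hy.memSobolev_pd2.memLp.const_smul ε⁻¹).1

theorem IsScaledIsometry.norm_scaledNormal (hy : IsScaledIsometry ℓ ε y) :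
    ∀ᵐ x ∂(volume.restrict (strip ℓ)), ‖scaledNormal ℓ ε y x‖ = 1 := by
  filter_upwards [hy.2] with x hx
  exact norm_cross_eq_one hx.1 hx.2.1 (by rw [real_inner_smul_right, hx.2.2, mul_zero])

theorem memLp_inner_unit {α : Type*} [MeasurableSpace α] {μ : Measure α} {n f : α → R3}
    (hn : AEStronglyMeasurable n μ) (hn1 : ∀ᵐ x ∂μ, ‖n x‖ = 1) (hf : MemLp f 2 μ) :
    MemLp (fun x => inner ℝ (n x) (f x)) 2 μ := by
  refine hf.of_le (hn.inner hf.1) ?_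
  filter_upwards [hn1] with x hx
  simpa [hx] using norm_inner_le_norm (𝕜 := ℝ) (n x) (f x)

theorem IsScaledIsometry.memLp_secondForm (hy : IsScaledIsometry ℓ ε y) (i j : Fin 2) :
    MemLp (fun x => secondForm ℓ ε y x i j) 2 (volume.restrict (strip ℓ)) := by
  have h := fun {f : ℝ × ℝ → R3} (hf : MemLp f 2 (volume.restrict (strip ℓ))) =>
    memLp_inner_unit hy.aestronglyMeasurable_scaledNormal hy.norm_scaledNormal hf
  have h11 := h hy.memSobolev_pd1.memLp_pd1
  have h12 := (h hy.memSobolev_pd2.memLp_pd1).const_mul ε⁻¹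
  have h22 := (h hy.memSobolev_pd2.memLp_pd2).const_mul (ε ^ 2)⁻¹
  fin_cases i <;> fin_cases j
  · exact h11
  · exact h12
  · exact h12
  · exact h22

end Isometry

/-! ### Coercivity of the energy -/

section Energy

variable {ℓ c₁ c₂ ebar θ : ℝ} {Abar : Matrix (Fin 2) (Fin 2) ℝ}

theorem frob_self (A : Matrix (Fin 2) (Fin 2) ℝ) :
    frob A A = A 0 0 ^ 2 + A 0 1 ^ 2 + A 1 0 ^ 2 + A 1 1 ^ 2 := by
  simp [frob, Fin.sum_univ_two]
  ring

theorem exists_Ltheta_eq (c₁ c₂ ebar : ℝ) (Abar : Matrix (Fin 2) (Fin 2) ℝ) (θ : ℝ) :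
    ∃ k k₁ k₂ k₃ k₄ : ℝ, ∀ A, Ltheta c₁ c₂ ebar Abar θ A =
      k + k₁ * A 0 0 + k₂ * A 0 1 + k₃ * A 1 0 + k₄ * A 1 1 := by
  set B := rotTarget Abar θ with hB
  refine ⟨c₁ * frob B B + c₂ * B.trace ^ 2 + ebar, -2 * c₁ * B 0 0 - 2 * c₂ * B.trace,
    -2 * c₁ * B 0 1, -2 * c₁ * B 1 0, -2 * c₁ * B 1 1 - 2 * c₂ * B.trace, fun A => ?_⟩
  rw [Ltheta, ← hB]
  simp [frob, Fin.sum_univ_two, Matrix.trace_fin_two]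
  ring

/-- Half of the quadratic term is spent on completing the square with the linear term. -/
theorem quadratic_lower_bound {c : ℝ} (hc : 0 < c) (k x : ℝ) :
    c / 2 * x ^ 2 - k ^ 2 / (2 * c) ≤ c * x ^ 2 + k * x := by
  have h : c * x ^ 2 + k * x - (c / 2 * x ^ 2 - k ^ 2 / (2 * c)) = (c * x + k) ^ 2 / (2 * c) := by
    field_simp
    ring
  have : 0 ≤ (c * x + k) ^ 2 / (2 * c) := by positivity
  linarith

/-- The energy controls the `L²`-norm of the second fundamental form. -/
theorem exists_bound_of_energy (hc₁ : 0 < c₁) (hc₂ : 0 < c₂) (ℓ ebar θ : ℝ)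
    (Abar : Matrix (Fin 2) (Fin 2) ℝ) (K : ℝ) :
    ∃ C, ∀ ε y, IsScaledIsometry ℓ ε y → energy ℓ c₁ c₂ ebar Abar θ ε y ≤ K →
      ∀ i j, ∫ x in strip ℓ, (secondForm ℓ ε y x i j) ^ 2 ≤ C := by
  obtain ⟨k, k₁, k₂, k₃, k₄, hL⟩ := exists_Ltheta_eq c₁ c₂ ebar Abar θ
  set c := c₁ + c₂ with hc
  have c0 : 0 < c := by positivity
  -- The constant that remains after the square has been completed in each of the four entries. It
  -- does not depend on `ε` or `y`, so the final bound is uniform.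
  set D := k - (k₁ ^ 2 / (2 * c) + k₂ ^ 2 / (2 * c) + k₃ ^ 2 / (2 * c) + k₄ ^ 2 / (2 * c)) with hD
  refine ⟨2 / c * (K - ∫ x in strip ℓ, D), fun ε y hy hK i j => ?_⟩
  have m := hy.memLp_secondForm
  have i1 : ∀ i j, IntegrableOn (fun x => secondForm ℓ ε y x i j) (strip ℓ) := fun i j =>
    (m i j).integrable (by norm_num)
  have i2 : ∀ i j, IntegrableOn (fun x => (secondForm ℓ ε y x i j) ^ 2) (strip ℓ) := fun i j =>
    (m i j).integrable_sq
  have iE : IntegrableOn (fun x => c * frob (secondForm ℓ ε y x) (secondForm ℓ ε y x)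
      + Ltheta c₁ c₂ ebar Abar θ (secondForm ℓ ε y x)) (strip ℓ) := by
    simp only [frob_self, hL]
    exact (((((i2 0 0).add (i2 0 1)).add (i2 1 0)).add (i2 1 1)).const_mul c).add
      (((((integrable_const k).add ((i1 0 0).const_mul k₁)).add ((i1 0 1).const_mul k₂)).add
        ((i1 1 0).const_mul k₃)).add ((i1 1 1).const_mul k₄))
  have hle : ∫ x in strip ℓ, (c / 2 * (secondForm ℓ ε y x i j) ^ 2 + D) ≤
      energy ℓ c₁ c₂ ebar Abar θ ε y := by
    refine integral_mono (((i2 i j).const_mul _).add (integrable_const D)) iE fun x => ?_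
    simp only [frob_self, hL]
    set a := secondForm ℓ ε y x
    have q1 := quadratic_lower_bound c0 k₁ (a 0 0)
    have q2 := quadratic_lower_bound c0 k₂ (a 0 1)
    have q3 := quadratic_lower_bound c0 k₃ (a 1 0)
    have q4 := quadratic_lower_bound c0 k₄ (a 1 1)
    have hij : c / 2 * a i j ^ 2 ≤
        c / 2 * a 0 0 ^ 2 + c / 2 * a 0 1 ^ 2 + c / 2 * a 1 0 ^ 2 + c / 2 * a 1 1 ^ 2 := by
      have p1 : 0 ≤ c / 2 * a 0 0 ^ 2 := by positivity
      have p2 : 0 ≤ c / 2 * a 0 1 ^ 2 := by positivity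
      have p3 : 0 ≤ c / 2 * a 1 0 ^ 2 := by positivity
      have p4 : 0 ≤ c / 2 * a 1 1 ^ 2 := by positivity
      fin_cases i <;> fin_cases j <;> simp only [Fin.zero_eta, Fin.mk_one] <;> linarith
    linarith
  rw [integral_add ((i2 i j).const_mul _) (integrable_const D), integral_const_mul] at hle
  have h3 : c / 2 * ∫ x in strip ℓ, (secondForm ℓ ε y x i j) ^ 2 ≤ K - ∫ x in strip ℓ, D := by
    linarith
  calc ∫ x in strip ℓ, (secondForm ℓ ε y x i j) ^ 2
      = 2 / c * (c / 2 * ∫ x in strip ℓ, (secondForm ℓ ε y x i j) ^ 2) := by field_simp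
    _ ≤ _ := by gcongr

end Energy

/-! ### Orthonormal frames -/

section Frames

variable {I : Set ℝ}

theorem memLp_mul_of_ae_le {α : Type*} [MeasurableSpace α] {μ : Measure α} {f g : α → R3} {M : ℝ}
    (hf : AEStronglyMeasurable f μ) (hfM : ∀ᵐ x ∂μ, ‖f x‖ ≤ M) (hg : MemLp g 2 μ) (i j : Fin 3) :
    MemLp (fun x => f x i * g x j) 2 μ := by
  refine memLp_bdd_mul (M := M) ?_ ?_ (memLp_coord hg j)
  · exact (by fun_prop : Continuous fun x : R3 => x i).comp_aestronglyMeasurable hf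
  · filter_upwards [hfM] with x hx using (abs_coord_le _ _).trans hx

theorem cross_eq_sum (a b : R3) : cross a b =
    (a 1 * b 2 + -1 * (a 2 * b 1)) • EuclideanSpace.single 0 (1 : ℝ) +
      (a 2 * b 0 + -1 * (a 0 * b 2)) • EuclideanSpace.single 1 (1 : ℝ) +
      (a 0 * b 1 + -1 * (a 1 * b 0)) • EuclideanSpace.single 2 (1 : ℝ) := by
  ext i
  fin_cases i
  · simpa [sub_eq_add_neg] using cross_zero a b
  · simpa [sub_eq_add_neg] using cross_one a b
  · simpa [sub_eq_add_neg] using cross_two a b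

/-- The cross product of bounded `W^{1,2}` fields on an interval is in `W^{1,2}`. -/
theorem memSobolev_cross (hI : IsOpen I) [IsFiniteMeasure (volume.restrict I)]
    {f f' g g' : ℝ → R3} (hf : HasWeakDeriv I 1 f f') (hg : HasWeakDeriv I 1 g g')
    (hf' : MemLp f' 2 (volume.restrict I)) (hg' : MemLp g' 2 (volume.restrict I)) {M : ℝ}
    (hfM : ∀ᵐ x ∂(volume.restrict I), ‖f x‖ ≤ M) (hgM : ∀ᵐ x ∂(volume.restrict I), ‖g x‖ ≤ M) :
    MemSobolev I 1 (fun x => cross (f x) (g x)) := by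
  have sf := hf.1.aestronglyMeasurable
  have sg := hg.1.aestronglyMeasurable
  have mf : MemLp f 2 (volume.restrict I) := MemLp.of_bound sf M hfM
  have mg : MemLp g 2 (volume.restrict I) := MemLp.of_bound sg M hgM
  have h := hf.coord_mul hI hg hf' hfM hgM
  have hm : ∀ i j, MemLp (fun x => f' x i * g x j + f x i * g' x j) 2 (volume.restrict I) :=
    fun i j => by
      refine MemLp.add ?_ (memLp_mul_of_ae_le sf hfM hg' i j)
      simpa only [mul_comm] using memLp_mul_of_ae_le sg hgM hf' j i
  have hm0 : ∀ i j, MemLp (fun x => f x i * g x j) 2 (volume.restrict I) :=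
    memLp_mul_of_ae_le sf hfM mg
  have mc : ∀ {s : ℝ → ℝ} (c : R3), MemLp s 2 (volume.restrict I) →
      MemLp (fun x => s x • c) 2 (volume.restrict I) := fun {s} c hs => by
    refine hs.of_le_mul (c := ‖c‖) (hs.1.smul_const c) (ae_of_all _ fun x => ?_)
    rw [norm_smul, mul_comm]
  have key := ((((h 1 2).add ((h 2 1).const_smul (-1))).smul_const
    (EuclideanSpace.single 0 (1 : ℝ))).add (((h 2 0).add ((h 0 2).const_smul (-1))).smul_const
    (EuclideanSpace.single 1 (1 : ℝ)))).add (((h 0 1).add ((h 1 0).const_smul (-1))).smul_const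
    (EuclideanSpace.single 2 (1 : ℝ)))
  have e : ∀ x, cross (f x) (g x) = _ := fun x => cross_eq_sum (f x) (g x)
  simp only [e]
  refine MemSobolev.of_deriv ?_ key ?_
  · exact ((mc _ ((hm0 1 2).add ((hm0 2 1).const_mul (-1)))).add
      (mc _ ((hm0 2 0).add ((hm0 0 2).const_mul (-1))))).add
      (mc _ ((hm0 0 1).add ((hm0 1 0).const_mul (-1))))
  · exact ((mc _ ((hm 1 2).add ((hm 2 1).const_mul (-1)))).add
      (mc _ ((hm 2 0).add ((hm 0 2).const_mul (-1))))).add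
      (mc _ ((hm 0 1).add ((hm 1 0).const_mul (-1))))

/-- The determinant is the triple product, which equals `|a ∧ b|² = 1`; this fixes the orientation.
-/
theorem mem_specialOrthogonalGroup_of_orthonormal {a b : R3} (ha : ‖a‖ = 1) (hb : ‖b‖ = 1)
    (hab : inner ℝ a b = 0) :
    (Matrix.of fun i j => (![a, b, cross a b] : Fin 3 → R3) j i) ∈
      Matrix.specialOrthogonalGroup (Fin 3) ℝ := by
  have a1 : a 0 * a 0 + a 1 * a 1 + a 2 * a 2 = 1 := by
    rw [← inner_coord, real_inner_self_eq_norm_sq, ha, one_pow]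
  have b1 : b 0 * b 0 + b 1 * b 1 + b 2 * b 2 = 1 := by
    rw [← inner_coord, real_inner_self_eq_norm_sq, hb, one_pow]
  have c1 : cross a b 0 * cross a b 0 + cross a b 1 * cross a b 1 +
      cross a b 2 * cross a b 2 = 1 := by
    rw [← inner_coord, real_inner_self_eq_norm_sq, norm_cross_eq_one ha hb hab, one_pow]
  have ab := hab
  have ac := inner_cross_left a b
  have bc := inner_cross_right a b
  rw [inner_coord] at ab ac bc
  rw [Matrix.mem_specialOrthogonalGroup_iff, Matrix.mem_orthogonalGroup_iff']
  constructor
  · ext i j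
    rw [Matrix.mul_apply, Fin.sum_univ_three]
    fin_cases i <;> fin_cases j <;> simp <;> linarith
  · rw [Matrix.det_fin_three]
    simp only [Matrix.of_apply, Matrix.cons_val_zero, Matrix.cons_val_one, Matrix.cons_val]
    rw [← c1]
    simp only [cross_zero, cross_one, cross_two]
    ring

end Frames

/-! ### Passing to the limit in normal components, and scaled bounds -/

section Limits

variable {E F : Type*} [NormedAddCommGroup E] [NormedSpace ℝ E] [MeasureSpace E]
  [NormedAddCommGroup F] [InnerProductSpace ℝ F] {Ω : Set E}

theorem tendstoL2_zero {f : ℕ → E → F} (hf : ∀ n, MemLp (f n) 2 (volume.restrict Ω))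
    (h : Tendsto (fun n => ∫ x in Ω, ‖f n x‖ ^ 2) atTop (𝓝 0)) :
    TendstoL2 (volume.restrict Ω) f (fun _ => 0) :=
  ⟨hf, MemLp.zero, by simpa using h⟩

/-- Inner products of bounded, almost everywhere convergent fields with weakly convergent fields
converge weakly. -/
theorem TendstoWeakL2.inner_of_ae_tendsto {p n : ℕ → E → F} {p₀ n₀ : E → F}
    (hp : TendstoWeakL2 Ω p p₀) {C : ℝ} (hC : ∀ k, ∫ x in Ω, ‖p k x‖ ^ 2 ≤ C)
    (hn : ∀ k, AEStronglyMeasurable (n k) (volume.restrict Ω))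
    (hn1 : ∀ k, ∀ᵐ x ∂(volume.restrict Ω), ‖n k x‖ = 1)
    (hlim : ∀ᵐ x ∂(volume.restrict Ω), Tendsto (fun k => n k x) atTop (𝓝 (n₀ x))) :
    TendstoWeakL2 Ω (fun k x => inner ℝ (n k x) (p k x)) (fun x => inner ℝ (n₀ x) (p₀ x)) := by
  have hn₀ : AEStronglyMeasurable n₀ (volume.restrict Ω) :=
    aestronglyMeasurable_of_tendsto_ae _ hn hlim
  have hn₀1 : ∀ᵐ x ∂(volume.restrict Ω), ‖n₀ x‖ = 1 := by
    filter_upwards [hlim, ae_all_iff.2 hn1] with x h1 h2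
    refine tendsto_nhds_unique h1.norm ?_
    simp only [h2]
    exact tendsto_const_nhds
  have mem : ∀ {m q : E → F}, AEStronglyMeasurable m (volume.restrict Ω) →
      (∀ᵐ x ∂(volume.restrict Ω), ‖m x‖ = 1) → MemLp q 2 (volume.restrict Ω) →
      MemLp (fun x => inner ℝ (m x) (q x)) 2 (volume.restrict Ω) := fun {m q} hm h1 hq => by
    refine hq.of_le (hm.inner hq.1) ?_
    filter_upwards [h1] with x hx
    simpa [hx] using norm_inner_le_norm (𝕜 := ℝ) (m x) (q x)
  refine ⟨fun k => mem (hn k) (hn1 k) (hp.1 k), mem hn₀ hn₀1 hp.2.1, fun g hg => ?_⟩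
  -- Moving the scalar test function `g` onto the unit fields gives a strongly convergent sequence
  -- dominated by `|g|`. What remains is a pairing of weak with strong convergence.
  have hT : TendstoL2 (volume.restrict Ω) (fun k x => g x • n k x) (fun x => g x • n₀ x) := by
    refine tendstoL2_of_dominated (fun k => hg.1.smul (hn k)) hg.norm (fun k => ?_) ?_
    · filter_upwards [hn1 k] with x hx
      rw [norm_smul, hx, mul_one]
    · filter_upwards [hlim] with x hx using hx.const_smul _
  have key := hp.tendsto_integral_inner hC hT
  have e : ∀ a b : F, ∀ r : ℝ, inner ℝ (inner ℝ a b) r = inner ℝ b (r • a) := fun a b r => by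
    have := real_inner_comm a b
    simp [real_inner_smul_right, this]
  simpa only [e] using key

end Limits

section Bounds

variable {ℓ ε C : ℝ} {y : ℝ × ℝ → R3}

/-- Keeps track of the powers of `ε`: for both `∂₁y` and `ε⁻¹∂₂y` the squared norm of the
longitudinal derivative is bounded by `C`, that of the transversal one by `ε² C`. -/
theorem IsScaledIsometry.integral_bounds (hε : 0 < ε) (hy : IsScaledIsometry ℓ ε y)
    (hC : ∀ i j, ∫ x in strip ℓ, (secondForm ℓ ε y x i j) ^ 2 ≤ C) :
    (∫ x in strip ℓ, ‖pd1 ℓ (pd1 ℓ y) x‖ ^ 2 ≤ C) ∧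
    (∫ x in strip ℓ, ‖pd2 ℓ (pd1 ℓ y) x‖ ^ 2 ≤ ε ^ 2 * C) ∧
    (∫ x in strip ℓ, ‖pd1 ℓ (pd2 ℓ y) x‖ ^ 2 ≤ ε ^ 2 * C) ∧
    (∫ x in strip ℓ, ‖pd2 ℓ (pd2 ℓ y) x‖ ^ 2 ≤ ε ^ 4 * C) ∧
    (∫ x in strip ℓ, ‖ε⁻¹ • pd1 ℓ (pd2 ℓ y) x‖ ^ 2 ≤ C) ∧
    (∫ x in strip ℓ, ‖ε⁻¹ • pd2 ℓ (pd2 ℓ y) x‖ ^ 2 ≤ ε ^ 2 * C) := by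
  have st := hy.ae_structure hε
  have aux : ∀ {f : ℝ × ℝ → R3} {k : ℝ} {i j : Fin 2}, 0 ≤ k →
      (∀ᵐ x ∂(volume.restrict (strip ℓ)), ‖f x‖ ^ 2 = k * (secondForm ℓ ε y x i j) ^ 2) →
      ∫ x in strip ℓ, ‖f x‖ ^ 2 ≤ k * C := fun {f k i j} hk h => by
    rw [integral_congr_ae h, integral_const_mul]
    exact mul_le_mul_of_nonneg_left (hC i j) hk
  refine ⟨?_, ?_, ?_, ?_, ?_, ?_⟩
  · rw [← one_mul C]
    refine aux zero_le_one (i := 0) (j := 0) ?_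
    filter_upwards [st] with x hx
    rw [one_mul]
    exact hx.2.2.2.2.2.1
  · refine aux (by positivity) (i := 0) (j := 1) ?_
    filter_upwards [st] with x hx
    rw [hx.2.2.2.1]
    exact hx.2.2.2.2.2.2.1
  · refine aux (by positivity) (i := 0) (j := 1) ?_
    filter_upwards [st] with x hx using hx.2.2.2.2.2.2.1
  · refine aux (by positivity) (i := 1) (j := 1) ?_
    filter_upwards [st] with x hx using hx.2.2.2.2.2.2.2
  · rw [← one_mul C]
    refine aux zero_le_one (i := 0) (j := 1) ?_
    filter_upwards [st] with x hx
    rw [norm_smul, mul_pow, hx.2.2.2.2.2.2.1, Real.norm_of_nonneg (by positivity)]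
    field_simp
  · refine aux (by positivity) (i := 1) (j := 1) ?_
    filter_upwards [st] with x hx
    rw [norm_smul, mul_pow, hx.2.2.2.2.2.2.2, Real.norm_of_nonneg (by positivity)]
    field_simp

theorem tendsto_integral_zero_of_le {Ω : Set (ℝ × ℝ)} {f : ℕ → ℝ × ℝ → R3} {b : ℕ → ℝ}
    (h : ∀ n, ∫ x in Ω, ‖f n x‖ ^ 2 ≤ b n) (hb : Tendsto b atTop (𝓝 0)) :
    Tendsto (fun n => ∫ x in Ω, ‖f n x‖ ^ 2) atTop (𝓝 0) :=
  squeeze_zero (fun n => integral_nonneg fun x => by positivity) h hb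

end Bounds

/-! ### Extraction of the subsequence and identification of the limits -/

section Compactness

variable {ℓ C : ℝ} {ε : ℕ → ℝ} {y : ℕ → ℝ × ℝ → R3}

/-- Compactness of scaled isometries with bounded second fundamental forms. -/
theorem exists_subseq_isometry (hℓ : 0 < ℓ) (hε : ∀ n, 0 < ε n) (hε0 : Tendsto ε atTop (𝓝 0))
    (hy : ∀ n, IsScaledIsometry ℓ (ε n) (y n))
    (hC : ∀ n i j, ∫ x in strip ℓ, (secondForm ℓ (ε n) (y n) x i j) ^ 2 ≤ C) :
    ∃ (σ : ℕ → ℕ) (a : ℕ → R3) (y₀ g₀ d₁ d₁' d₂ d₂' : ℝ → R3) (γ : ℝ × ℝ → ℝ),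
      StrictMono σ ∧ HasWeakDeriv (interval ℓ) 1 y₀ g₀ ∧ HasWeakDeriv (interval ℓ) 1 d₁ d₁' ∧
      HasWeakDeriv (interval ℓ) 1 d₂ d₂' ∧
      MemLp y₀ 2 (volume.restrict (interval ℓ)) ∧
      MemLp d₁' 2 (volume.restrict (interval ℓ)) ∧ MemLp d₂' 2 (volume.restrict (interval ℓ)) ∧
      TendstoL2 (volume.restrict (strip ℓ)) (fun n x => y (σ n) x - a n) (fun x => y₀ x.1) ∧
      TendstoWeakL2 (strip ℓ) (fun n => pd1 ℓ (y (σ n))) (fun x => g₀ x.1) ∧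
      TendstoL2 (volume.restrict (strip ℓ)) (fun n => pd1 ℓ (y (σ n))) (fun x => d₁ x.1) ∧
      (∀ᵐ x ∂(volume.restrict (strip ℓ)),
        Tendsto (fun n => pd1 ℓ (y (σ n)) x) atTop (𝓝 (d₁ x.1))) ∧
      TendstoWeakL2 (strip ℓ) (fun n => pd1 ℓ (pd1 ℓ (y (σ n)))) (fun x => d₁' x.1) ∧
      TendstoL2 (volume.restrict (strip ℓ)) (fun n x => (ε (σ n))⁻¹ • pd2 ℓ (y (σ n)) x)
        (fun x => d₂ x.1) ∧
      (∀ᵐ x ∂(volume.restrict (strip ℓ)),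
        Tendsto (fun n => (ε (σ n))⁻¹ • pd2 ℓ (y (σ n)) x) atTop (𝓝 (d₂ x.1))) ∧
      TendstoWeakL2 (strip ℓ) (fun n x => (ε (σ n))⁻¹ • pd1 ℓ (pd2 ℓ (y (σ n))) x)
        (fun x => d₂' x.1) ∧
      TendstoWeakL2 (strip ℓ) (fun n x => secondForm ℓ (ε (σ n)) (y (σ n)) x 1 1) γ := by
  have hℓ' : -ℓ / 2 < ℓ / 2 := by linarith
  have h1 : (1 / 2 : ℝ) - (-1 / 2) = 1 := by norm_num
  have bd := fun n => (hy n).integral_bounds (hε n) (hC n)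
  have hε2 : Tendsto (fun n => ε n ^ 2 * C) atTop (𝓝 0) := by
    simpa using (hε0.pow 2).mul_const C
  have st := fun n => (hy n).ae_structure (hε n)
  have u1 : ∀ n, ∀ᵐ x ∂(volume.restrict (strip ℓ)), ‖pd1 ℓ (y n) x‖ ≤ 1 := fun n => by
    filter_upwards [st n] with x hx using hx.1.le
  have w1 : ∀ n, ∀ᵐ x ∂(volume.restrict (strip ℓ)), ‖(ε n)⁻¹ • pd2 ℓ (y n) x‖ ≤ 1 := fun n => by
    filter_upwards [st n] with x hx using hx.2.1.le
  have hu : ∀ n, ∫ x in strip ℓ, ‖pd1 ℓ (y n) x‖ ^ 2 ≤ volume.real (strip ℓ) := fun n => by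
    have : ∫ x in strip ℓ, ‖pd1 ℓ (y n) x‖ ^ 2 = ∫ x in strip ℓ, (1 : ℝ) := by
      refine integral_congr_ae ?_
      filter_upwards [st n] with x hx
      rw [hx.1, one_pow]
    rw [this]
    simp
  have hz : ∀ n, ∫ x in strip ℓ, ‖pd2 ℓ (y n) x‖ ^ 2 ≤ ε n ^ 2 * volume.real (strip ℓ) := fun n => by
    have : ∫ x in strip ℓ, ‖pd2 ℓ (y n) x‖ ^ 2 = ∫ x in strip ℓ, ε n ^ 2 := by
      refine integral_congr_ae ?_
      filter_upwards [st n] with x hx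
      have := hx.2.1
      have hn := hε n
      rw [norm_smul, Real.norm_of_nonneg (by positivity)] at this
      field_simp at this
      rw [this]
    rw [this]
    simp [mul_comm]
  have hz0 : Tendsto (fun n => ε n ^ 2 * volume.real (strip ℓ)) atTop (𝓝 0) := by
    simpa using (hε0.pow 2).mul_const (volume.real (strip ℓ))
  -- The deformations are controlled only up to translation, so the constants are kept here.
  obtain ⟨σ₁, a, y₀, g₀, hσ₁, dy, my, -, Ty, Wy⟩ := exists_subseq_tendstoL2_strip hℓ' h1
    (fun n => (hy n).1.memLp) (fun n => (hy n).memSobolev_pd1.memLp)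
    (fun n => (hy n).memSobolev_pd2.memLp) (fun n => (hy n).deriv_one) (fun n => (hy n).deriv_two)
    hu (tendsto_integral_zero_of_le hz hz0)
  -- The field `∂₁y` has unit length, so no constants are needed; the same holds below for `ε⁻¹∂₂y`.
  obtain ⟨σ₂, d₁, d₁', hσ₂, dd₁, -, md₁', T₁, ae₁, W₁⟩ := exists_subseq_tendsto_strip_of_bounded
    hℓ' h1 (fun n => (hy (σ₁ n)).memSobolev_pd1.memLp) (fun n => u1 (σ₁ n))
    (fun n => (hy (σ₁ n)).memSobolev_pd1.memLp_pd1) (fun n => (hy (σ₁ n)).memSobolev_pd1.memLp_pd2)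
    (fun n => (hy (σ₁ n)).memSobolev_pd1.hasWeakDeriv (1, 0))
    (fun n => (hy (σ₁ n)).memSobolev_pd1.hasWeakDeriv (0, 1)) (fun n => (bd (σ₁ n)).1)
    (tendsto_integral_zero_of_le (fun n => (bd (σ₁ n)).2.1) (hε2.comp hσ₁.tendsto_atTop))
  have hσ₁₂ := hσ₁.comp hσ₂
  obtain ⟨σ₃, d₂, d₂', hσ₃, dd₂, -, md₂', T₂, ae₂, W₂⟩ := exists_subseq_tendsto_strip_of_bounded
    (f := fun n x => (ε (σ₁ (σ₂ n)))⁻¹ • pd2 ℓ (y (σ₁ (σ₂ n))) x)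
    (p := fun n x => (ε (σ₁ (σ₂ n)))⁻¹ • pd1 ℓ (pd2 ℓ (y (σ₁ (σ₂ n)))) x)
    (q := fun n x => (ε (σ₁ (σ₂ n)))⁻¹ • pd2 ℓ (pd2 ℓ (y (σ₁ (σ₂ n)))) x)
    hℓ' h1 (fun n => (hy (σ₁ (σ₂ n))).memSobolev_pd2.memLp.const_smul (ε (σ₁ (σ₂ n)))⁻¹)
    (fun n => w1 (σ₁ (σ₂ n)))
    (fun n => (hy (σ₁ (σ₂ n))).memSobolev_pd2.memLp_pd1.const_smul (ε (σ₁ (σ₂ n)))⁻¹)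
    (fun n => (hy (σ₁ (σ₂ n))).memSobolev_pd2.memLp_pd2.const_smul (ε (σ₁ (σ₂ n)))⁻¹)
    (fun n => ((hy (σ₁ (σ₂ n))).memSobolev_pd2.hasWeakDeriv (1, 0)).const_smul (ε (σ₁ (σ₂ n)))⁻¹)
    (fun n => ((hy (σ₁ (σ₂ n))).memSobolev_pd2.hasWeakDeriv (0, 1)).const_smul (ε (σ₁ (σ₂ n)))⁻¹)
    (fun n => (bd (σ₁ (σ₂ n))).2.2.2.2.1)
    (tendsto_integral_zero_of_le (fun n => (bd (σ₁ (σ₂ n))).2.2.2.2.2)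
      (hε2.comp hσ₁₂.tendsto_atTop))
  -- Since `ε⁻²∂₂∂₂y` is not a longitudinal derivative of a compact field, only a weak limit of this
  -- entry is extracted.
  obtain ⟨σ₄, γ, hσ₄, Wγ⟩ := exists_subseq_tendstoWeakL2 (Ω := strip ℓ)
    (f := fun n x => secondForm ℓ (ε (σ₁ (σ₂ (σ₃ n)))) (y (σ₁ (σ₂ (σ₃ n)))) x 1 1) (C := C)
    (fun n => (hy _).memLp_secondForm 1 1) (fun n => by simpa using hC _ 1 1)
  have h34 := hσ₃.comp hσ₄
  have h234 := hσ₂.comp h34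
  refine ⟨fun n => σ₁ (σ₂ (σ₃ (σ₄ n))), fun n => a (σ₂ (σ₃ (σ₄ n))), y₀, g₀, d₁, d₁', d₂, d₂', γ,
    hσ₁.comp h234, dy, dd₁, dd₂, my, md₁', md₂', Ty.comp h234, Wy.comp h234, T₁.comp h34, ?_,
    W₁.comp h34, T₂.comp hσ₄, ?_, W₂.comp hσ₄, Wγ⟩
  · filter_upwards [ae₁] with x hx using hx.comp h34.tendsto_atTop
  · filter_upwards [ae₂] with x hx using hx.comp hσ₄.tendsto_atTop

end Compactness


theorem tendsto_cross {f g : ℕ → R3} {a b : R3} (hf : Tendsto f atTop (𝓝 a))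
    (hg : Tendsto g atTop (𝓝 b)) : Tendsto (fun n => cross (f n) (g n)) atTop (𝓝 (cross a b)) := by
  have h := continuous_cross.tendsto (a, b)
  dsimp only at h
  exact Tendsto.comp (g := fun p : R3 × R3 => cross p.1 p.2) (f := fun n => (f n, g n)) h
    (hf.prodMk_nhds hg)

/-- Compactness of scaled isometries with bounded second fundamental forms, with the identification
of all limits in terms of an orthonormal frame. -/
theorem exists_limit_frame {ℓ C : ℝ} {ε : ℕ → ℝ} {y : ℕ → ℝ × ℝ → R3} (hℓ : 0 < ℓ)
    (hε : ∀ n, 0 < ε n) (hε0 : Tendsto ε atTop (𝓝 0)) (hy : ∀ n, IsScaledIsometry ℓ (ε n) (y n))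
    (hC' : ∀ n i j, ∫ x in strip ℓ, (secondForm ℓ (ε n) (y n) x i j) ^ 2 ≤ C) :
    ∃ (σ : ℕ → ℕ) (a : ℕ → R3) (y₀ : ℝ → R3) (d : Fin 3 → ℝ → R3),
      StrictMono σ ∧
      MemSobolev (interval ℓ) 2 y₀ ∧
      IsSobolevFrame ℓ d ∧
      (∀ᵐ t ∂(volume.restrict (interval ℓ)),
        d 0 t = weakDeriv (interval ℓ) 1 y₀ t ∧
        inner ℝ (weakDeriv (interval ℓ) 1 (d 0) t) (d 1 t) = 0) ∧
      TendstoWeakSobolev (strip ℓ) 2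
        (fun n x => y (σ n) x - a n) (fun x => y₀ x.1) ∧
      (∀ i : Fin 2, TendstoWeakSobolev (strip ℓ) 1
        (fun n => scaledGrad ℓ (ε (σ n)) (y (σ n)) i) (fun x => d i.castSucc x.1)) ∧
      ∃ γ : ℝ × ℝ → ℝ, MemLp γ 2 (volume.restrict (strip ℓ)) ∧
        ∀ i j : Fin 2, TendstoWeakL2 (strip ℓ)
          (fun n x => secondForm ℓ (ε (σ n)) (y (σ n)) x i j)
          (fun x => limitForm ℓ d γ x i j) := by
  obtain ⟨σ, a, y₀, g₀, d₁, d₁', d₂, d₂', γ, hσ, dy, dd₁, dd₂, my, md₁', md₂', Ty, Wy, T₁, ae₁,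
    W₁, T₂, ae₂, W₂, Wγ⟩ := exists_subseq_isometry hℓ hε hε0 hy hC'
  have hΩ := isOpen_strip ℓ
  have hI : IsOpen (interval ℓ) := isOpen_Ioo
  have : IsProbabilityMeasure (volume.restrict (Ioo (-1 / 2 : ℝ) (1 / 2))) :=
    isProbabilityMeasure_Ioo (by norm_num)
  have toI : ∀ {p : ℝ → Prop}, (∀ᵐ x ∂(volume.restrict (strip ℓ)), p x.1) →
      ∀ᵐ t ∂(volume.restrict (interval ℓ)), p t := fun {p} h => ae_comp_fst_iff.1 h
  have toS : ∀ {p : ℝ → Prop}, (∀ᵐ t ∂(volume.restrict (interval ℓ)), p t) →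
      ∀ᵐ x ∂(volume.restrict (strip ℓ)), p x.1 := fun {p} h => ae_comp_fst_iff.2 h
  have st := fun n => (hy (σ n)).ae_structure (hε (σ n))
  have bd := fun n => (hy (σ n)).integral_bounds (hε (σ n)) (hC' (σ n))
  have hε0' := hε0.comp hσ.tendsto_atTop
  have hε2 : Tendsto (fun n => ε (σ n) ^ 2 * C) atTop (𝓝 0) := by
    simpa using (hε0'.pow 2).mul_const C
  have hε4 : Tendsto (fun n => ε (σ n) ^ 4 * C) atTop (𝓝 0) := by
    simpa using (hε0'.pow 4).mul_const C
  -- the limit frame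
  have frS : ∀ᵐ x ∂(volume.restrict (strip ℓ)),
      ‖d₁ x.1‖ = 1 ∧ ‖d₂ x.1‖ = 1 ∧ inner ℝ (d₁ x.1) (d₂ x.1) = 0 := by
    filter_upwards [ae₁, ae₂, ae_all_iff.2 st] with x h1 h2 h3
    refine ⟨tendsto_nhds_unique h1.norm ?_, tendsto_nhds_unique h2.norm ?_,
      tendsto_nhds_unique (h1.inner h2) ?_⟩
    · simp only [(h3 _).1]; exact tendsto_const_nhds
    · simp only [(h3 _).2.1]; exact tendsto_const_nhds
    · simp only [(h3 _).2.2.1]; exact tendsto_const_nhds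
  have fr : ∀ᵐ t ∂(volume.restrict (interval ℓ)),
      ‖d₁ t‖ = 1 ∧ ‖d₂ t‖ = 1 ∧ inner ℝ (d₁ t) (d₂ t) = 0 := toI frS
  have b₁ : ∀ᵐ t ∂(volume.restrict (interval ℓ)), ‖d₁ t‖ ≤ 1 := fr.mono fun t h => h.1.le
  have b₂ : ∀ᵐ t ∂(volume.restrict (interval ℓ)), ‖d₂ t‖ ≤ 1 := fr.mono fun t h => h.2.1.le
  have md₁ : MemLp d₁ 2 (volume.restrict (interval ℓ)) :=
    MemLp.of_bound dd₁.1.aestronglyMeasurable 1 b₁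
  have md₂ : MemLp d₂ 2 (volume.restrict (interval ℓ)) :=
    MemLp.of_bound dd₂.1.aestronglyMeasurable 1 b₂
  have s₁ : MemSobolev (interval ℓ) 1 d₁ := MemSobolev.of_deriv (k := 0) md₁ dd₁ md₁'
  have s₂ : MemSobolev (interval ℓ) 1 d₂ := MemSobolev.of_deriv (k := 0) md₂ dd₂ md₂'
  have s₃ := memSobolev_cross hI dd₁ dd₂ md₁' md₂' b₁ b₂
  -- The sequence `∂₁y` converges weakly to the derivative of `y₀` and strongly to `d₁`, so the two
  -- limits agree.
  have eg : g₀ =ᵐ[volume.restrict (interval ℓ)] d₁ := toI (Wy.ae_unique T₁.weak)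
  have dy' : HasWeakDeriv (interval ℓ) 1 y₀ d₁ := dy.congr EventuallyEq.rfl eg
  have wd₁ := dd₁.ae_eq_weakDeriv hI
  have wd₂ := dd₂.ae_eq_weakDeriv hI
  -- the normals converge almost everywhere
  have aeN : ∀ᵐ x ∂(volume.restrict (strip ℓ)),
      Tendsto (fun n => scaledNormal ℓ (ε (σ n)) (y (σ n)) x) atTop
        (𝓝 (cross (d₁ x.1) (d₂ x.1))) := by
    filter_upwards [ae₁, ae₂] with x h1 h2
    exact tendsto_cross h1 h2
  have sN := fun n => (hy (σ n)).aestronglyMeasurable_scaledNormal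
  have nN := fun n => (hy (σ n)).norm_scaledNormal
  have L11 := W₁.inner_of_ae_tendsto (fun n => (bd n).1) sN nN aeN
  have L12 := W₂.inner_of_ae_tendsto (fun n => (bd n).2.2.2.2.1) sN nN aeN
  -- The product of `ε⁻¹∂₂y` and `∂₁∂₁y` vanishes along the sequence. The first factor has unit
  -- length and converges almost everywhere, the second converges weakly, so the product of the
  -- limits vanishes too.
  have perp : ∀ᵐ t ∂(volume.restrict (interval ℓ)), inner ℝ (d₂ t) (d₁' t) = 0 := by
    have L := W₁.inner_of_ae_tendsto (fun n => (bd n).1) (fun n => (T₂.1 n).1)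
      (fun n => (st n).mono fun x h => h.2.1) ae₂
    have Z : TendstoWeakL2 (strip ℓ) (fun (_ : ℕ) _ => (0 : ℝ)) (fun _ => 0) :=
      ⟨fun _ => MemLp.zero, MemLp.zero, fun g _ => tendsto_const_nhds⟩
    exact toI ((L.congr (fun n => (st n).mono fun x h => h.2.2.2.2.1) EventuallyEq.rfl).ae_unique Z)
  -- pulled back derivatives
  have i₁ : IntegrableOn d₁ (interval ℓ) := md₁.integrable (by norm_num)
  have i₂ : IntegrableOn d₂ (interval ℓ) := md₂.integrable (by norm_num)
  have iy : IntegrableOn y₀ (interval ℓ) := my.integrable (by norm_num)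
  have i₁' : IntegrableOn d₁' (interval ℓ) := md₁'.integrable (by norm_num)
  have i₂' : IntegrableOn d₂' (interval ℓ) := md₂'.integrable (by norm_num)
  have c₁ : HasWeakDeriv (strip ℓ) (1, 0) (fun x => d₁ x.1) (fun x => d₁' x.1) :=
    dd₁.comp_fst i₁ i₁'
  have c₂ : HasWeakDeriv (strip ℓ) (1, 0) (fun x => d₂ x.1) (fun x => d₂' x.1) :=
    dd₂.comp_fst i₂ i₂'
  have cy : HasWeakDeriv (strip ℓ) (1, 0) (fun x => y₀ x.1) (fun x => d₁ x.1) :=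
    dy'.comp_fst iy i₁
  have e₁ : HasWeakDeriv (strip ℓ) (0, 1) (fun x => d₁ x.1) (fun _ => 0) :=
    hasWeakDeriv_comp_fst_snd i₁
  have e₂ : HasWeakDeriv (strip ℓ) (0, 1) (fun x => d₂ x.1) (fun _ => 0) :=
    hasWeakDeriv_comp_fst_snd i₂
  have ey : HasWeakDeriv (strip ℓ) (0, 1) (fun x => y₀ x.1) (fun _ => 0) :=
    hasWeakDeriv_comp_fst_snd iy
  have z0 : ∀ v : ℝ × ℝ, HasWeakDeriv (strip ℓ) v (fun _ => (0 : R3)) (fun _ => 0) := fun v =>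
    hasWeakDeriv_const v 0
  have su := fun n => (hy (σ n)).memSobolev_pd1
  have sz := fun n => (hy (σ n)).memSobolev_pd2
  have conv_u : TendstoWeakSobolev (strip ℓ) 1 (fun n => pd1 ℓ (y (σ n))) (fun x => d₁ x.1) :=
    TendstoWeakSobolev.of_partials (k := 0) hΩ T₁.weak (fun n => (su n).hasWeakDeriv (1, 0))
      (fun n => (su n).hasWeakDeriv (0, 1)) c₁ e₁ W₁
      (tendstoL2_zero (fun n => (su n).memLp_pd2)
        (tendsto_integral_zero_of_le (fun n => (bd n).2.1) hε2)).weak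
  have conv_w : TendstoWeakSobolev (strip ℓ) 1
      (fun n x => (ε (σ n))⁻¹ • pd2 ℓ (y (σ n)) x) (fun x => d₂ x.1) :=
    TendstoWeakSobolev.of_partials (k := 0) hΩ T₂.weak
      (fun n => ((sz n).hasWeakDeriv (1, 0)).const_smul (ε (σ n))⁻¹)
      (fun n => ((sz n).hasWeakDeriv (0, 1)).const_smul (ε (σ n))⁻¹)
      c₂ e₂ W₂
      (tendstoL2_zero (fun n => (sz n).memLp_pd2.const_smul (ε (σ n))⁻¹)
        (tendsto_integral_zero_of_le (fun n => (bd n).2.2.2.2.2) hε2)).weak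
  have Tz : TendstoL2 (volume.restrict (strip ℓ)) (fun n => pd2 ℓ (y (σ n))) (fun _ => 0) := by
    refine tendstoL2_zero (fun n => (sz n).memLp) (tendsto_integral_zero_of_le (fun n => ?_)
      (b := fun n => ε (σ n) ^ 2 * volume.real (strip ℓ))
      (by simpa using (hε0'.pow 2).mul_const (volume.real (strip ℓ))))
    have h : ∫ x in strip ℓ, ‖pd2 ℓ (y (σ n)) x‖ ^ 2 = ∫ x in strip ℓ, ε (σ n) ^ 2 := by
      refine integral_congr_ae ((st n).mono fun x hx => ?_)
      have h2 := hx.2.1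
      have hn := hε (σ n)
      rw [norm_smul, Real.norm_of_nonneg (by positivity)] at h2
      field_simp at h2
      simp only [h2]
    rw [h]
    simp [mul_comm]
  have conv_z : TendstoWeakSobolev (strip ℓ) 1 (fun n => pd2 ℓ (y (σ n))) (fun _ => 0) :=
    TendstoWeakSobolev.of_partials (k := 0) hΩ Tz.weak (fun n => (sz n).hasWeakDeriv (1, 0))
      (fun n => (sz n).hasWeakDeriv (0, 1)) (z0 _) (z0 _)
      (tendstoL2_zero (fun n => (sz n).memLp_pd1)
        (tendsto_integral_zero_of_le (fun n => (bd n).2.2.1) hε2)).weak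
      (tendstoL2_zero (fun n => (sz n).memLp_pd2)
        (tendsto_integral_zero_of_le (fun n => (bd n).2.2.2.1) hε4)).weak
  have sub_const : ∀ n v, HasWeakDeriv (strip ℓ) v (fun x => y (σ n) x - a n)
      (weakDeriv (strip ℓ) v (y (σ n))) := fun n v => by
    refine (((hy (σ n)).1.hasWeakDeriv v).add (hasWeakDeriv_const v (-a n))).congr
      (ae_of_all _ fun x => ?_) (ae_of_all _ fun x => ?_)
    · simp [sub_eq_add_neg]
    · simp
  have conv_y : TendstoWeakSobolev (strip ℓ) 2 (fun n x => y (σ n) x - a n)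
      (fun x => y₀ x.1) :=
    TendstoWeakSobolev.of_partials hΩ Ty.weak (fun n => sub_const n (1, 0))
      (fun n => sub_const n (0, 1)) cy ey conv_u
      conv_z
  refine ⟨σ, a, y₀, ![d₁, d₂, fun t => cross (d₁ t) (d₂ t)], hσ,
    MemSobolev.of_deriv (k := 1) my dy' s₁, ⟨fun i => ?_, ?_⟩, ?_, conv_y, fun i => ?_, γ, Wγ.2.1,
    fun i j => ?_⟩
  · fin_cases i
    exacts [s₁, s₂, s₃]
  · filter_upwards [fr] with t ht
    convert mem_specialOrthogonalGroup_of_orthonormal ht.1 ht.2.1 ht.2.2 using 1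
    ext i j
    fin_cases j <;> rfl
  · filter_upwards [dy'.ae_eq_weakDeriv hI, wd₁, perp] with t h1 h2 h3
    refine ⟨h1, ?_⟩
    change inner ℝ (weakDeriv (interval ℓ) 1 d₁ t) (d₂ t) = 0
    rw [← h2, real_inner_comm, h3]
  · fin_cases i
    exacts [conv_u, conv_w]
  · have A11 : TendstoWeakL2 (strip ℓ) (fun n x => secondForm ℓ (ε (σ n)) (y (σ n)) x 0 0)
        (fun x => inner ℝ (weakDeriv (interval ℓ) 1 d₁ x.1) (cross (d₁ x.1) (d₂ x.1))) := by
      refine L11.congr (fun n => EventuallyEq.rfl) ?_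
      filter_upwards [toS wd₁] with x hx
      rw [← hx, real_inner_comm]
    have A12 : TendstoWeakL2 (strip ℓ) (fun n x => secondForm ℓ (ε (σ n)) (y (σ n)) x 0 1)
        (fun x => inner ℝ (weakDeriv (interval ℓ) 1 d₂ x.1) (cross (d₁ x.1) (d₂ x.1))) := by
      -- In `secondForm` the factor `ε⁻¹` stands outside the inner product; in `L12` it multiplies
      -- the second derivative.
      refine L12.congr (fun n => ae_of_all _ fun x => real_inner_smul_right _ _ _) ?_
      filter_upwards [toS wd₂] with x hx
      rw [← hx, real_inner_comm]
    fin_cases i <;> fin_cases j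
    exacts [A11, A12, A12, Wγ]

end Ribbon

end

theorem lemma2p1
    (ℓ : ℝ) (hℓ : 0 < ℓ)
    (c₁ c₂ ebar : ℝ) (hc₁ : 0 < c₁) (hc₂ : 0 < c₂) (hebar : 0 ≤ ebar)
    (Abar : Matrix (Fin 2) (Fin 2) ℝ) (hAbar : Abar.IsSymm)
    (θ : ℝ) (hθ : θ ∈ Set.Ico 0 Real.pi)
    (ε : ℕ → ℝ) (hε : ∀ n, 0 < ε n) (hε0 : Tendsto ε atTop (𝓝 0))
    (y : ℕ → ℝ × ℝ → Ribbon.R3)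
    (hy : ∀ n, Ribbon.IsScaledIsometry ℓ (ε n) (y n))
    (hJ : BddAbove (Set.range fun n => Ribbon.energy ℓ c₁ c₂ ebar Abar θ (ε n) (y n))) :
    ∃ (σ : ℕ → ℕ) (a : ℕ → Ribbon.R3) (y₀ : ℝ → Ribbon.R3) (d : Fin 3 → ℝ → Ribbon.R3),
      StrictMono σ ∧
      Ribbon.MemSobolev (Ribbon.interval ℓ) 2 y₀ ∧
      Ribbon.IsSobolevFrame ℓ d ∧
      (∀ᵐ t ∂(volume.restrict (Ribbon.interval ℓ)),
        d 0 t = Ribbon.weakDeriv (Ribbon.interval ℓ) 1 y₀ t ∧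
        inner ℝ (Ribbon.weakDeriv (Ribbon.interval ℓ) 1 (d 0) t) (d 1 t) = 0) ∧
      Ribbon.TendstoWeakSobolev (Ribbon.strip ℓ) 2
        (fun n x => y (σ n) x - a n) (fun x => y₀ x.1) ∧
      (∀ i : Fin 2, Ribbon.TendstoWeakSobolev (Ribbon.strip ℓ) 1
        (fun n => Ribbon.scaledGrad ℓ (ε (σ n)) (y (σ n)) i) (fun x => d i.castSucc x.1)) ∧
      ∃ γ : ℝ × ℝ → ℝ, MemLp γ 2 (volume.restrict (Ribbon.strip ℓ)) ∧
        ∀ i j : Fin 2, Ribbon.TendstoWeakL2 (Ribbon.strip ℓ)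
          (fun n x => Ribbon.secondForm ℓ (ε (σ n)) (y (σ n)) x i j)
          (fun x => Ribbon.limitForm ℓ d γ x i j) := by
  obtain ⟨K, hK⟩ := hJ
  obtain ⟨C, hC⟩ := Ribbon.exists_bound_of_energy hc₁ hc₂ ℓ ebar θ Abar K
  exact Ribbon.exists_limit_frame hℓ hε hε0 hy fun n => hC _ _ (hy n) (hK ⟨n, rfl⟩)
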